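/- **Setting.** Let $x_1,\dots,x_n\in\mathbb R^d$ be training inputs and $y_1,\dots,y_n\in\mathbb R^k$ training targets, $k\ge 1$. For $W\in\mathbb R^{m\times d}$, $V\in\mathbb R^{k\times m}$ consider the two-layer ReLU network $f_W(x)=V\sigma(Wx)$, $\sigma(z)=\max\{z,0\}$ entrywise, with training loss $$L(W)=\frac1n\sum_{i=1}^n \ell(f_W(x_i),y_i),\qquad \ell(\hat y,y)=\tfrac12\|\hat y-y\|_2^2 .$$ Only $W$ is trained. Initially the entries of $W^{(0)}$ are i.i.d. $N(0,2/m)$ and those of $V$ are i.i.d. $N(0,1/k)$, independent of each other. Minibatch SGD with batch size $B$, $1\le B\le n$, and step size $\eta$ iterates $$W^{(t+1)}=W^{(t)}-\frac{\eta}{B}\sum_{s\in\mathcal B^{(t)}}\nabla_W\,\ell\big(f_{W^{(t)}}(x_s),y_s\big),$$ where $\mathcal B^{(0)},\mathcal B^{(1)},\dots$ are independent uniformly random $B$-element subsets of $\{1,\dots,n\}$, independent of the initialization, and $\nabla_W\,\ell(f_W(x),y)=\big((f_W(x)-y)^\top V\Sigma\big)^\top x^\top$ with $\Sigma=\mathrm{diag}(\sigma'((Wx)_j))$,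 $\sigma'(z)=\mathbf 1\{z>0\}$. **Assumptions.** $\|x_i\|_2=1$ and $\|y_i\|_2\le Y$ for all $i$; $\|x_i-x_j\|_2\ge\phi$ and $\|x_i+x_j\|_2\ge\mu\phi$ for all $i\ne j$, where $\phi>0$, and $\mu>0$ and $Y$ are constants. **Theorem.** There are positive constants $c_0,C_1,C_2$, depending only on $Y$ and $\mu$, and for every $c\in(0,c_0]$ a constant $C_3>0$, depending only on $Y,\mu,c$, such that the following holds for all $n,d,k,B,\phi$, all data as above and all widths $m\ge 2$ with $$m\;\ge\; C_1\,\frac{k^{5/2}\,n^{11}\,\log^3(m)}{\phi^{8}B},$$ when the step size is $\eta=c\,\dfrac{kB\phi}{n^3\,m\log(m)}$. With probability at least $1-C_2n^{-1}$ over the initialization $(W^{(0)},V)$ there is an event $A$ for the sequence of minibatches, of (conditional) probability at least $1-C_2n^{-1}$, such that for every $\epsilon\in(0,1/2]$ and every integer $$T\;\ge\; C_3\,\frac{n^5\log(m)\log(1/\epsilon)}{B\phi^2}$$ the expected training loss satisfies $\mathbb E\big[L(W^{(T)})\,\big|\,W^{(0)},V,A\big]\le\epsilon$, the expectation being over the minibatches.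 Thus, with probability $1-O(n^{-1})$, SGD reaches expected training loss $\epsilon$ within $T=O\big(n^5\log(m)\log(1/\epsilon)/(B\phi^2)\big)$ iterations. -/

import Mathlib

open MeasureTheory ProbabilityTheory
open scoped NNReal Matrix

noncomputable section

namespace TwoLayerReLU

/-- The ReLU activation. -/
def relu (z : ℝ) : ℝ := max z 0

/-- The derivative of the ReLU, with the usual convention `relu' 0 = 0`. -/
def reluDeriv (z : ℝ) : ℝ := if 0 < z then 1 else 0

/-- The two-layer network `f_W(x) = V σ(W x)` with `W ∈ ℝ^{m×d}` and `V ∈ ℝ^{k×m}`. -/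
def network {d m k : ℕ} (V : Matrix (Fin k) (Fin m) ℝ) (W : Matrix (Fin m) (Fin d) ℝ)
    (x : EuclideanSpace ℝ (Fin d)) : EuclideanSpace ℝ (Fin k) :=
  WithLp.toLp 2 (V *ᵥ fun j => relu ((W *ᵥ x.ofLp) j))

/-- The square loss `ℓ(f_W(x), y) = ‖f_W(x) - y‖² / 2` of one example. -/
def exampleLoss {d m k : ℕ} (V : Matrix (Fin k) (Fin m) ℝ) (x : EuclideanSpace ℝ (Fin d))
    (y : EuclideanSpace ℝ (Fin k)) (W : Matrix (Fin m) (Fin d) ℝ) : ℝ :=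
  ‖network V W x - y‖ ^ 2 / 2

/-- The gradient in `W` of the loss of one example, `((f_W(x) - y)ᵀ V Σ)ᵀ xᵀ`, where `Σ` is the
diagonal matrix with entries `relu' ((W x)_j)`. The output layer `V` is not trained. -/
def exampleGrad {d m k : ℕ} (V : Matrix (Fin k) (Fin m) ℝ) (x : EuclideanSpace ℝ (Fin d))
    (y : EuclideanSpace ℝ (Fin k)) (W : Matrix (Fin m) (Fin d) ℝ) : Matrix (Fin m) (Fin d) ℝ :=
  Matrix.vecMulVec
    (fun j => ((network V W x - y).ofLp ᵥ* V) j * reluDeriv ((W *ᵥ x.ofLp) j)) x.ofLp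

/-- The training loss `L(W) = (1/n) ∑ᵢ ℓ(f_W(xᵢ), yᵢ)`. -/
def trainLoss {n d m k : ℕ} (x : Fin n → EuclideanSpace ℝ (Fin d))
    (y : Fin n → EuclideanSpace ℝ (Fin k)) (V : Matrix (Fin k) (Fin m) ℝ)
    (W : Matrix (Fin m) (Fin d) ℝ) : ℝ :=
  (∑ i, exampleLoss V (x i) (y i) W) / n

/-- The SGD iterates `W^{(t+1)} = W^{(t)} - (η/B) ∑_{s ∈ b t} ∇ℓ(f_{W^{(t)}}(x_s), y_s)`
started at `W0`, where `b t` is the minibatch used in step `t`. -/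
def sgd {n d m k : ℕ} (x : Fin n → EuclideanSpace ℝ (Fin d))
    (y : Fin n → EuclideanSpace ℝ (Fin k)) (B : ℕ) (η : ℝ) (V : Matrix (Fin k) (Fin m) ℝ)
    (W0 : Matrix (Fin m) (Fin d) ℝ) (b : ℕ → Finset (Fin n)) : ℕ → Matrix (Fin m) (Fin d) ℝ
  | 0 => W0
  | t + 1 => sgd x y B η V W0 b t
      - (η / B) • ∑ s ∈ b t, exampleGrad V (x s) (y s) (sgd x y B η V W0 b t)

/-- The law of the initialization `(W^{(0)}, V)`: all entries are independent, those of `W^{(0)}`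
are `N(0, 2/m)` and those of `V` are `N(0, 1/k)`. -/
def initLaw (d m k : ℕ) : Measure ((Fin m → Fin d → ℝ) × (Fin k → Fin m → ℝ)) :=
  (Measure.pi fun _ => Measure.pi fun _ => gaussianReal 0 (2 / (m : ℝ≥0))).prod
    (Measure.pi fun _ => Measure.pi fun _ => gaussianReal 0 (1 / (k : ℝ≥0)))

/-- The uniform distribution on the `B`-element subsets of the index set `Fin n`. -/
def minibatchLaw (n B : ℕ) : Measure (Finset (Fin n)) :=
  uniformOn {s : Finset (Fin n) | s.card = B}

theorem isProbabilityMeasure_minibatchLaw {n B : ℕ} (hB : B ≤ n) :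
    IsProbabilityMeasure (minibatchLaw n B) := by
  refine isProbabilityMeasure_uniformOn (Set.toFinite _) ?_
  obtain ⟨s, -, hs⟩ := Finset.exists_subset_card_eq
    (s := (Finset.univ : Finset (Fin n))) (n := B) (by simpa using hB)
  exact ⟨s, hs⟩

/-- The law of an i.i.d. sequence of uniform minibatches of size `B`. -/
def minibatchSeqLaw (n B : ℕ) (hB : B ≤ n) : Measure (ℕ → Finset (Fin n)) :=
  haveI := isProbabilityMeasure_minibatchLaw hB
  Measure.infinitePi fun _ => minibatchLaw n B

end TwoLayerReLU

end

open TwoLayerReLU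

/-! In the kernel regime a wide network is nearly linear in `W` around its initialization, so SGD
behaves as it would on a strongly convex quadratic.

Kernel. The squared Frobenius norm of the gradient of the total loss is a quadratic form in the
residuals. Averaged over the initialization its matrix is, up to the factor a = m/k, the identity on
outputs tensored with t_ij (1/4 + arcsin(t_ij)/(2π)), where t_ij = ⟨x_i, x_j⟩ (`gaussian_quadrant`,
`kernel_lower`). The series of t arcsin t has positive coefficients and every entrywise power of a
Gram matrix is positive semidefinite, so any block of terms may be kept and the others dropped.
Separation gives |t_ij| ≤ 1 - δ off the diagonal with δ of order φ², hence powers of order N ≈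
log(n)/δ are diagonally dominant. The coefficients with index in [N, 2N) add up to order 1/√N, so
the least eigenvalue is at least of order φ/√log n (`quadForm_arcsin_lower`). The proof works with a
slightly smaller λ, in which √log n is replaced by r = (2n)^(1/16).

Initialization. Only second moments are used. For a 0/1-valued g the matrix ∑_j g(w_j) v_j v_jᵀ is
compared with its mean in Frobenius norm by Markov's inequality (`measureReal_neuronDev_ge_le`). The
choices g = 1, g = "preactivation near zero" and g = "active at both inputs" control the operator
norm of V, the effect of sign flips and the empirical kernel. Together with a tail bound for the
entries of V they give `GoodInit`. The initial loss is O(n^(3/2)) by a fourth-moment bound.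

One step. A neuron changes sign at x_i only if its preactivation was small initially or its weights
moved far, and the latter is paid for by ‖W - W0‖² (`GoodInit.flip_le`). So in a Frobenius ball of
squared radius R2 the kernel keeps a fixed fraction of λ and the loss is close to its linearization.
One SGD step then shrinks the expected loss by 1 - γ, γ = ηaλ/(4n)
(`GoodInit.integral_totalLoss_sgdStep_le`).

Staying in the ball. The loss stopped on leaving the ball decays geometrically in expectation, hence
so do the expected squared step lengths. A weighted Cauchy-Schwarz inequality and Markov's
inequality bound the probability of ever leaving by 4DΦ₀/(γ²R2), where Φ₀ is the initial total loss
(`exists_stay_event`). With R2 = 512 n^(7/2)/(aλ²) this is at most 1/n, and the width hypothesis is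
what keeps the sign flips harmless in a ball of that size (`flip_budget`). Conditioning on staying
costs at most a factor 2. -/

noncomputable section
namespace TwoLayerReLU

/-! ### The power series of the arcsine -/

/-- The coefficients of the power series of `1 / √(1 - z)`. -/
def invSqrtCoeff (j : ℕ) : ℝ := Ring.choose ((1 / 2 : ℝ) + j - 1) j

lemma invSqrtCoeff_eq (j : ℕ) :
    invSqrtCoeff j = (ascPochhammer ℝ j).eval (1 / 2) / j.factorial := by
  rw [invSqrtCoeff, Ring.choose_eq_smul, Polynomial.descPochhammer_smeval_eq_ascPochhammer,
    Polynomial.ascPochhammer_smeval_eq_eval]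
  rw [show (1 / 2 : ℝ) + j - 1 - j + 1 = 1 / 2 by ring]
  simp only [smul_eq_mul]
  ring

lemma invSqrtCoeff_zero : invSqrtCoeff 0 = 1 := by simp [invSqrtCoeff_eq]

lemma invSqrtCoeff_succ (j : ℕ) :
    invSqrtCoeff (j + 1) = invSqrtCoeff j * ((2 * j + 1) / (2 * j + 2)) := by
  rw [invSqrtCoeff_eq, invSqrtCoeff_eq, ascPochhammer_succ_eval, Nat.factorial_succ]
  push_cast
  have : (j.factorial : ℝ) ≠ 0 := by positivity
  field_simp
  ring

lemma invSqrtCoeff_pos (j : ℕ) : 0 < invSqrtCoeff j := by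
  induction j with
  | zero => simp [invSqrtCoeff_zero]
  | succ j ih => rw [invSqrtCoeff_succ]; positivity

/-- The right side is nondecreasing in `j`, because (2j+1)² ≥ 4j(j+1), and equals 1 at j = 1. It
encodes a lower bound 1/(2√j) for the coefficient. -/
lemma one_le_invSqrtCoeff_sq (j : ℕ) (hj : 1 ≤ j) : 1 ≤ invSqrtCoeff j ^ 2 * (4 * j) := by
  induction j, hj using Nat.le_induction with
  | base => rw [invSqrtCoeff_succ, invSqrtCoeff_zero]; norm_num
  | succ j hj ih =>
    refine ih.trans ?_
    rw [invSqrtCoeff_succ, mul_pow, mul_assoc]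
    refine mul_le_mul_of_nonneg_left ?_ (sq_nonneg _)
    push_cast
    rw [div_pow, div_mul_eq_mul_div, le_div_iff₀ (by positivity)]
    nlinarith [Nat.cast_nonneg (α := ℝ) j]

lemma hasSum_invSqrtCoeff {z : ℝ} (hz : |z| < 1) :
    HasSum (fun j => invSqrtCoeff j * z ^ j) (1 / √(1 - z)) := by
  have h := (Real.one_div_one_sub_rpow_hasFPowerSeriesOnBall_zero (1 / 2)).hasSum (y := z)
    (by simpa [Metric.mem_eball, edist_dist] using hz)
  simp only [zero_add, FormalMultilinearSeries.ofScalars_apply_eq] at h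
  rw [Real.sqrt_eq_rpow]
  simpa [invSqrtCoeff, smul_eq_mul] using h

/-- The coefficient of `t ^ (2 j + 1)` in the power series of the arcsine. -/
def arcsinCoeff (j : ℕ) : ℝ := invSqrtCoeff j / (2 * j + 1)

lemma arcsinCoeff_pos (j : ℕ) : 0 < arcsinCoeff j :=
  div_pos (invSqrtCoeff_pos j) (by positivity)

/-- Termwise integration of the series of 1/√(1 - s²) between 0 and `t`; on this segment each term
is dominated by its value at s = t. -/
lemma hasSum_arcsin {t : ℝ} (ht : |t| < 1) :
    HasSum (fun j => arcsinCoeff j * t ^ (2 * j + 1)) (Real.arcsin t) := by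
  have habs : ∀ s ∈ Set.uIcc 0 t, |s| ≤ |t| := by
    intro s hs
    have := Set.abs_sub_left_of_mem_uIcc hs
    simpa using this
  have hlt : |t ^ 2| < 1 := by rw [abs_pow]; exact pow_lt_one₀ (abs_nonneg _) ht two_ne_zero
  have h := intervalIntegral.hasSum_intervalIntegral_of_summable_norm (a := 0) (b := t)
    (f := fun j : ℕ => ⟨fun s : ℝ => invSqrtCoeff j * (s ^ 2) ^ j, by fun_prop⟩) (by
      refine Summable.of_nonneg_of_le (fun _ => norm_nonneg _) (fun j => ?_)
        (hasSum_invSqrtCoeff (z := t ^ 2) hlt).summable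
      rw [ContinuousMap.norm_le _ (mul_nonneg (invSqrtCoeff_pos j).le (by positivity))]
      intro s
      have hs := habs s.1 s.2
      simp only [ContinuousMap.restrict_apply, ContinuousMap.coe_mk, norm_mul, Real.norm_eq_abs,
        abs_of_pos (invSqrtCoeff_pos j), abs_pow]
      refine mul_le_mul_of_nonneg_left ?_ (invSqrtCoeff_pos j).le
      rw [← sq_abs t]
      gcongr)
  have hsum : ∫ s in (0 : ℝ)..t, ∑' j, (⟨fun s : ℝ => invSqrtCoeff j * (s ^ 2) ^ j, by fun_prop⟩ :
      C(ℝ, ℝ)) s = Real.arcsin t := by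
    have heq : Set.EqOn (fun s : ℝ => ∑' j, (⟨fun s : ℝ => invSqrtCoeff j * (s ^ 2) ^ j,
        by fun_prop⟩ : C(ℝ, ℝ)) s) (fun s => 1 / √(1 - s ^ 2)) (Set.uIcc 0 t) := by
      intro s hs
      have hs' := habs s hs
      exact (hasSum_invSqrtCoeff (z := s ^ 2) (by
        rw [abs_pow]; exact pow_lt_one₀ (abs_nonneg _) (by linarith) two_ne_zero)).tsum_eq
    rw [intervalIntegral.integral_congr heq]
    have hne : ∀ s ∈ Set.uIcc 0 t, s ≠ -1 ∧ s ≠ 1 := by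
      intro s hs
      have hs' := habs s hs
      constructor <;> rintro rfl <;> simp at hs' <;> linarith
    rw [intervalIntegral.integral_eq_sub_of_hasDerivAt
      (fun s hs => Real.hasDerivAt_arcsin (hne s hs).1 (hne s hs).2), Real.arcsin_zero, sub_zero]
    refine ContinuousOn.intervalIntegrable ?_
    refine ContinuousOn.div continuousOn_const (by fun_prop) (fun s hs => ?_)
    have hs' := habs s hs
    rw [Real.sqrt_ne_zero']
    have : |s| < 1 := by linarith
    nlinarith [abs_lt.1 this]
  rw [hsum] at h
  have hfun : (fun j => arcsinCoeff j * t ^ (2 * j + 1)) =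
      fun j => ∫ s in (0 : ℝ)..t, invSqrtCoeff j * (s ^ 2) ^ j := by
    funext j
    rw [intervalIntegral.integral_const_mul]
    simp_rw [← pow_mul]
    rw [integral_pow, arcsinCoeff]
    push_cast
    simp
    ring
  rw [hfun]
  exact h

/-- For t < 1 the terms are nonnegative, so a partial sum is at most arcsin t ≤ π/2; now let t tend
to 1. This replaces convergence of the series at the end point, which the diagonal of the kernel
would otherwise require. -/
lemma sum_arcsinCoeff_le (L : ℕ) : ∑ j ∈ Finset.range L, arcsinCoeff j ≤ Real.pi / 2 := by
  have hlim : Filter.Tendsto (fun t : ℝ => ∑ j ∈ Finset.range L, arcsinCoeff j * t ^ (2 * j + 1))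
      (nhdsWithin 1 (Set.Ioo 0 1)) (nhds (∑ j ∈ Finset.range L, arcsinCoeff j)) := by
    have hc : Continuous
        (fun t : ℝ => ∑ j ∈ Finset.range L, arcsinCoeff j * t ^ (2 * j + 1)) := by fun_prop
    have := (hc.tendsto 1).mono_left (nhdsWithin_le_nhds (s := Set.Ioo 0 1))
    simpa using this
  have : (nhdsWithin (1 : ℝ) (Set.Ioo 0 1)).NeBot := by
    apply mem_closure_iff_nhdsWithin_neBot.1
    rw [closure_Ioo (by norm_num)]
    simp
  refine le_of_tendsto hlim ?_
  filter_upwards [self_mem_nhdsWithin] with t ht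
  refine le_trans ?_ (Real.arcsin_le_pi_div_two t)
  exact sum_le_hasSum _ (fun j _ => mul_nonneg (arcsinCoeff_pos j).le (pow_nonneg ht.1.le _))
    (hasSum_arcsin (by rw [abs_of_pos ht.1]; exact ht.2))

lemma arcsinCoeff_lower (j N : ℕ) (hN : 1 ≤ j) (hj : j < 2 * N) :
    1 / (12 * N * √N) ≤ arcsinCoeff j := by
  have hN0 : (0 : ℝ) < N := by
    have : 0 < N := by omega
    exact_mod_cast this
  have hj' : (j : ℝ) + 1 ≤ 2 * N := by exact_mod_cast hj
  have hj1 : (1 : ℝ) ≤ j := by exact_mod_cast hN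
  have h1 := one_le_invSqrtCoeff_sq j hN
  -- With j < 2N the squared coefficient is at least 1/(4j) ≥ 1/(8N) ≥ 1/(9N).
  have hs : 1 / (3 * √N) ≤ invSqrtCoeff j := by
    rw [div_le_iff₀ (by positivity)]
    refine (sq_le_sq₀ (by norm_num) (by have := invSqrtCoeff_pos j; positivity)).1 ?_
    rw [mul_pow, mul_pow, Real.sq_sqrt hN0.le]
    have := sq_nonneg (invSqrtCoeff j)
    nlinarith
  rw [arcsinCoeff, le_div_iff₀ (by positivity)]
  refine le_trans ?_ hs
  rw [div_mul_eq_mul_div, div_le_div_iff₀ (by positivity) (by positivity)]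
  have : 0 < √(N : ℝ) := by positivity
  nlinarith

/-- The N terms of this block are each of order N^(-3/2). The resulting 1/√N, rather than a smaller
power, is what makes the eigenvalue linear in φ. -/
lemma sum_arcsinCoeff_lower (N : ℕ) (hN : 1 ≤ N) :
    1 / (12 * √N) ≤ ∑ j ∈ Finset.Ico N (2 * N), arcsinCoeff j := by
  have hN0 : (0 : ℝ) < N := by exact_mod_cast hN
  have := Finset.card_nsmul_le_sum (Finset.Ico N (2 * N)) arcsinCoeff (1 / (12 * N * √N))
    (fun j hj => by
      rw [Finset.mem_Ico] at hj
      exact arcsinCoeff_lower j N (by omega) hj.2)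
  refine le_trans (le_of_eq ?_) this
  rw [Nat.card_Ico, nsmul_eq_mul, show 2 * N - N = N by omega]
  field_simp

/-! ### Positive definiteness of the limiting kernel -/

/-- Schur product theorem, applied inductively to the Gram matrix. -/
lemma posSemidef_gram_pow {n : ℕ} {E : Type*} [NormedAddCommGroup E] [InnerProductSpace ℝ E]
    (x : Fin n → E) (p : ℕ) :
    (Matrix.of fun i j => (inner ℝ (x i) (x j) : ℝ) ^ p).PosSemidef := by
  induction p with
  | zero =>
    have := Matrix.posSemidef_vecMulVec_self_star (fun _ : Fin n => (1 : ℝ))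
    convert this using 1
    ext i j
    simp [Matrix.vecMulVec_apply]
  | succ p ih =>
    have h : (Matrix.of fun i j => (inner ℝ (x i) (x j) : ℝ) ^ (p + 1)) =
        (Matrix.of fun i j => (inner ℝ (x i) (x j) : ℝ) ^ p) ⊙ Matrix.gram ℝ x := by
      ext i j
      simp [Matrix.gram_apply, pow_succ]
    rw [h]
    exact ih.hadamard (Matrix.posSemidef_gram ℝ x)

lemma quadForm_gram_pow_nonneg {n : ℕ} {E : Type*} [NormedAddCommGroup E] [InnerProductSpace ℝ E]
    (x : Fin n → E) (p : ℕ) (u : Fin n → ℝ) :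
    0 ≤ ∑ i, ∑ j, u i * u j * (inner ℝ (x i) (x j) : ℝ) ^ p := by
  have := (posSemidef_gram_pow x p).dotProduct_mulVec_nonneg u
  simp only [dotProduct, Matrix.mulVec, Matrix.of_apply, star_trivial, Pi.star_apply,
    Finset.mul_sum] at this
  refine this.trans (le_of_eq ?_)
  refine Finset.sum_congr rfl fun i _ => Finset.sum_congr rfl fun j _ => by ring

lemma sum_abs_sq_le {n : ℕ} (u : Fin n → ℝ) :
    ∑ i, ∑ j, |u i| * |u j| ≤ n * ∑ i, u i ^ 2 := by
  rw [← Finset.sum_mul_sum, ← sq]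
  have := sq_sum_le_card_mul_sum_sq (s := Finset.univ) (f := fun i : Fin n => |u i|)
  simpa using this

/-- Diagonal dominance: the diagonal is 1 and the off-diagonal part contributes at most q(∑|u_i|)² ≤
nq‖u‖². -/
lemma quadForm_gram_pow_lower {n : ℕ} {E : Type*} [NormedAddCommGroup E] [InnerProductSpace ℝ E]
    (x : Fin n → E) (hx : ∀ i, ‖x i‖ = 1) (q : ℝ) (hq : 0 ≤ q) (p : ℕ)
    (hoff : ∀ i j, i ≠ j → |(inner ℝ (x i) (x j) : ℝ)| ^ p ≤ q) (hnq : n * q ≤ 1 / 2)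
    (u : Fin n → ℝ) :
    (1 / 2) * ∑ i, u i ^ 2 ≤ ∑ i, ∑ j, u i * u j * (inner ℝ (x i) (x j) : ℝ) ^ p := by
  have hterm : ∀ i j, (if i = j then u i ^ 2 else 0) - q * (|u i| * |u j|)
      ≤ u i * u j * (inner ℝ (x i) (x j) : ℝ) ^ p := by
    intro i j
    by_cases h : i = j
    · subst h
      rw [real_inner_self_eq_norm_sq, hx]
      have : 0 ≤ q * (|u i| * |u i|) := by positivity
      simp
      nlinarith
    · rw [if_neg h]
      have h1 : |u i * u j * (inner ℝ (x i) (x j) : ℝ) ^ p| ≤ q * (|u i| * |u j|) := by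
        rw [abs_mul, abs_mul, abs_pow, mul_comm]
        exact mul_le_mul_of_nonneg_right (hoff i j h) (by positivity)
      have := (abs_le.1 h1).1
      linarith
  have hsum := Finset.sum_le_sum fun i (_ : i ∈ Finset.univ) =>
    Finset.sum_le_sum fun j (_ : j ∈ Finset.univ) => hterm i j
  refine le_trans ?_ hsum
  simp only [Finset.sum_sub_distrib, Finset.sum_ite_eq, Finset.mem_univ, if_true]
  rw [show ∑ i, ∑ j, q * (|u i| * |u j|) = q * ∑ i, ∑ j, |u i| * |u j| by
    simp only [Finset.mul_sum]]
  have h2 := sum_abs_sq_le u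
  have h3 : 0 ≤ ∑ i, u i ^ 2 := Finset.sum_nonneg fun i _ => sq_nonneg _
  nlinarith

/-- Every term of the series of t arcsin t contributes a positive semidefinite form, so only the
indices in [N, 2N) are kept; there the powers are so high that the form is at least ‖u‖²/2. -/
lemma quadForm_arcsin_lower {n : ℕ} {E : Type*} [NormedAddCommGroup E] [InnerProductSpace ℝ E]
    (x : Fin n → E) (hx : ∀ i, ‖x i‖ = 1) (δ : ℝ) (hδ : 0 < δ) (hδ1 : δ ≤ 1)
    (hoff : ∀ i j, i ≠ j → |(inner ℝ (x i) (x j) : ℝ)| ≤ 1 - δ)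
    (N : ℕ) (hN : 1 ≤ N) (hNn : n * (1 - δ) ^ N ≤ 1 / 2) (u : Fin n → ℝ) :
    1 / (24 * √N) * ∑ i, u i ^ 2 ≤
      ∑ i, ∑ j, u i * u j * ((inner ℝ (x i) (x j) : ℝ) * Real.arcsin (inner ℝ (x i) (x j))) := by
  set t : Fin n → Fin n → ℝ := fun i j => inner ℝ (x i) (x j) with ht
  have hdiag : ∀ i, t i i = 1 := fun i => by simp [ht, hx]
  have hS : 0 ≤ ∑ i, u i ^ 2 := Finset.sum_nonneg fun i _ => sq_nonneg _
  -- The series is available only for |t| < 1, so the diagonal is given its exact value arcsin 1 =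
  -- π/2. Replacing it later by the partial sum can only lower the form, since u_i² ≥ 0.
  let F : ℕ → Fin n → Fin n → ℝ := fun L i j =>
    if i = j then Real.pi / 2
      else ∑ l ∈ Finset.range L, arcsinCoeff l * t i j ^ (2 * l + 2)
  have hlim : Filter.Tendsto (fun L => ∑ i, ∑ j, u i * u j * F L i j) Filter.atTop
      (nhds (∑ i, ∑ j, u i * u j * (t i j * Real.arcsin (t i j)))) := by
    refine tendsto_finsetSum _ fun i _ => tendsto_finsetSum _ fun j _ =>
      Filter.Tendsto.const_mul _ ?_
    by_cases h : i = j
    · subst h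
      simp [F, hdiag]
    · simp only [F, if_neg h]
      have := ((hasSum_arcsin (t := t i j) (lt_of_le_of_lt (hoff i j h) (by linarith))).mul_left
        (t i j)).tendsto_sum_nat
      refine this.congr fun L => Finset.sum_congr rfl fun l _ => by ring
  refine ge_of_tendsto hlim ?_
  filter_upwards [Filter.eventually_ge_atTop (2 * N)] with L hL
  have h1 : ∑ i, ∑ j, u i * u j * ∑ l ∈ Finset.range L, arcsinCoeff l * t i j ^ (2 * l + 2)
      ≤ ∑ i, ∑ j, u i * u j * F L i j := by
    refine Finset.sum_le_sum fun i _ => Finset.sum_le_sum fun j _ => ?_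
    by_cases h : i = j
    · subst h
      simp only [F, if_true, hdiag, one_pow, mul_one]
      exact mul_le_mul_of_nonneg_left (sum_arcsinCoeff_le L) (mul_self_nonneg _)
    · simp only [F, if_neg h]; rfl
  refine le_trans ?_ h1
  have h2 : ∑ i, ∑ j, u i * u j * ∑ l ∈ Finset.range L, arcsinCoeff l * t i j ^ (2 * l + 2)
      = ∑ l ∈ Finset.range L, arcsinCoeff l * ∑ i, ∑ j, u i * u j * t i j ^ (2 * l + 2) := by
    simp only [Finset.mul_sum]
    rw [Finset.sum_comm]
    rw [Finset.sum_comm]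
    simp_rw [Finset.sum_comm (s := Finset.range L)]
    refine Finset.sum_congr rfl fun i _ => Finset.sum_congr rfl fun j _ =>
      Finset.sum_congr rfl fun l _ => by ring
  rw [h2]
  have hsub : Finset.Ico N (2 * N) ⊆ Finset.range L := by
    intro l hl
    rw [Finset.mem_Ico] at hl
    rw [Finset.mem_range]; omega
  refine le_trans ?_ (Finset.sum_le_sum_of_subset_of_nonneg hsub fun l _ _ =>
    mul_nonneg (arcsinCoeff_pos l).le (quadForm_gram_pow_nonneg x _ u))
  have h3 : ∀ l ∈ Finset.Ico N (2 * N), arcsinCoeff l * ((1 / 2) * ∑ i, u i ^ 2) ≤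
      arcsinCoeff l * ∑ i, ∑ j, u i * u j * t i j ^ (2 * l + 2) := by
    intro l hl
    rw [Finset.mem_Ico] at hl
    refine mul_le_mul_of_nonneg_left ?_ (arcsinCoeff_pos l).le
    refine quadForm_gram_pow_lower x hx ((1 - δ) ^ N) (pow_nonneg (by linarith) _) _ ?_ hNn u
    intro i j h
    calc |t i j| ^ (2 * l + 2) ≤ (1 - δ) ^ (2 * l + 2) := by gcongr; exact hoff i j h
      _ ≤ (1 - δ) ^ N := pow_le_pow_of_le_one (by linarith) (by linarith) (by omega)
  refine le_trans ?_ (Finset.sum_le_sum h3)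
  rw [← Finset.sum_mul]
  have h4 := sum_arcsinCoeff_lower N hN
  calc 1 / (24 * √N) * ∑ i, u i ^ 2 = 1 / (12 * √N) * (1 / 2 * ∑ i, u i ^ 2) := by ring
    _ ≤ _ := mul_le_mul_of_nonneg_right h4 (by positivity)


/-! ### Linear functionals of independent Gaussians -/

section Gaussian
variable {ι : Type*} [Fintype ι]

lemma memLp_eval_pi_gaussian (v : ℝ≥0) (a : ι) (p : ENNReal) (hp : p ≠ ⊤) :
    MemLp (fun w : ι → ℝ => w a) p (Measure.pi fun _ : ι => gaussianReal 0 v) :=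
  (memLp_id_gaussianReal' (μ := 0) (v := v) p hp).comp_measurePreserving
    (measurePreserving_eval (fun _ : ι => gaussianReal 0 v) a)

lemma hasGaussianLaw_eval_pi (v : ℝ≥0) :
    HasGaussianLaw (fun (w : ι → ℝ) => fun a => w a)
      (Measure.pi fun _ : ι => gaussianReal 0 v) := by
  refine iIndepFun.hasGaussianLaw (X := fun a (w : ι → ℝ) => w a) (fun a => ?_) ?_
  · have : HasLaw (fun w : ι → ℝ => w a) (gaussianReal 0 v)
        (Measure.pi fun _ : ι => gaussianReal 0 v) :=
      ⟨(measurable_pi_apply a).aemeasurable,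
        (measurePreserving_eval (fun _ : ι => gaussianReal 0 v) a).map_eq⟩
    exact this.hasGaussianLaw
  · exact iIndepFun_pi (X := fun _ => id) (fun _ => aemeasurable_id)

/-- The linear functional `w ↦ ∑ a, w a * c a` as a continuous linear map. -/
def dotCLM (c : ι → ℝ) : (ι → ℝ) →L[ℝ] ℝ :=
  ∑ a, c a • ContinuousLinearMap.proj (R := ℝ) (φ := fun _ : ι => ℝ) a

lemma dotCLM_apply (c w : ι → ℝ) : dotCLM c w = ∑ a, w a * c a := by
  simp [dotCLM, mul_comm]

lemma integral_dot_pi_gaussian (v : ℝ≥0) (c : ι → ℝ) :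
    ∫ w : ι → ℝ, ∑ a, w a * c a ∂(Measure.pi fun _ : ι => gaussianReal 0 v) = 0 := by
  rw [integral_finsetSum]
  · refine Finset.sum_eq_zero fun a _ => ?_
    rw [integral_mul_const]
    have h2 : ∫ w : ι → ℝ, w a ∂(Measure.pi fun _ : ι => gaussianReal 0 v) = 0 := by
      rw [integral_eval]; simp
    rw [h2, zero_mul]
  · intro a _
    exact ((memLp_eval_pi_gaussian v a 1 (by simp)).integrable le_rfl).mul_const _

lemma covariance_dot_pi_gaussian [DecidableEq ι] (v : ℝ≥0) (c e : ι → ℝ) :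
    cov[fun w : ι → ℝ => ∑ a, w a * c a, fun w : ι → ℝ => ∑ a, w a * e a;
      Measure.pi fun _ : ι => gaussianReal 0 v] = v * ∑ a, c a * e a := by
  rw [covariance_fun_sum_fun_sum
    (fun a => (memLp_eval_pi_gaussian v a 2 (by simp)).mul_const _)
    (fun a => (memLp_eval_pi_gaussian v a 2 (by simp)).mul_const _)]
  have hcov : ∀ a b : ι, cov[fun w : ι → ℝ => w a * c a, fun w : ι → ℝ => w b * e b;
      Measure.pi fun _ : ι => gaussianReal 0 v] = if a = b then v * (c a * e a) else 0 := by
    intro a b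
    rw [covariance_mul_const_left, covariance_mul_const_right]
    split_ifs with h
    · subst h
      rw [covariance_self (measurable_pi_apply a).aemeasurable]
      have : Var[fun w : ι → ℝ => w a; Measure.pi fun _ : ι => gaussianReal 0 v] = v := by
        have h1 := variance_map (X := id) (Y := fun w : ι → ℝ => w a)
          (μ := Measure.pi fun _ : ι => gaussianReal 0 v) aemeasurable_id
          (measurable_pi_apply a).aemeasurable
        rw [(measurePreserving_eval (fun _ : ι => gaussianReal 0 v) a).map_eq,
          variance_id_gaussianReal] at h1
        exact h1.symm
      rw [this]; ring
    · have hind : iIndepFun (fun (a : ι) (w : ι → ℝ) => w a)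
          (Measure.pi fun _ : ι => gaussianReal 0 v) :=
        iIndepFun_pi (X := fun _ => id) (fun _ => aemeasurable_id)
      rw [(hind.indepFun h).covariance_eq_zero (memLp_eval_pi_gaussian v a 2 (by simp))
        (memLp_eval_pi_gaussian v b 2 (by simp))]
      simp
  simp_rw [hcov]
  simp [Finset.mul_sum]

lemma map_dot_pi_gaussian (v : ℝ≥0) (c : ι → ℝ) :
    (Measure.pi fun _ : ι => gaussianReal 0 v).map (fun w => ∑ a, w a * c a) =
      gaussianReal 0 (v * (∑ a, c a ^ 2).toNNReal) := by
  classical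
  have h := ((hasGaussianLaw_eval_pi (ι := ι) v).map_fun (dotCLM c))
  simp only [dotCLM_apply] at h
  rw [h.map_eq_gaussianReal, integral_dot_pi_gaussian]
  congr 1
  have hm : AEMeasurable (fun w : ι → ℝ => ∑ a, w a * c a)
      (Measure.pi fun _ : ι => gaussianReal 0 v) := Measurable.aemeasurable (by fun_prop)
  rw [← covariance_self hm, covariance_dot_pi_gaussian, Real.toNNReal_mul (by positivity)]
  simp [sq]

/-- The two functionals are jointly Gaussian and uncorrelated, hence independent. -/
lemma map_dot_prod_pi_gaussian (v : ℝ≥0) (c e : ι → ℝ) (hc : ∑ a, c a ^ 2 = 1)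
    (he : ∑ a, e a ^ 2 = 1) (hce : ∑ a, c a * e a = 0) :
    (Measure.pi fun _ : ι => gaussianReal 0 v).map
      (fun w => (∑ a, w a * c a, ∑ a, w a * e a)) =
      (gaussianReal 0 v).prod (gaussianReal 0 v) := by
  classical
  have h := ((hasGaussianLaw_eval_pi (ι := ι) v).map_fun ((dotCLM c).prod (dotCLM e)))
  simp only [ContinuousLinearMap.prod_apply, dotCLM_apply] at h
  have hind := h.indepFun_of_covariance_eq_zero (by rw [covariance_dot_pi_gaussian, hce, mul_zero])
  rw [(indepFun_iff_map_prod_eq_prod_map_map (Measurable.aemeasurable (by fun_prop))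
      (Measurable.aemeasurable (by fun_prop))).1 hind,
    map_dot_pi_gaussian, map_dot_pi_gaussian, hc, he]
  simp

end Gaussian

/-! ### Quadrant probabilities -/

lemma measurableSet_pos_and {α : Type*} [MeasurableSpace α] {f g : α → ℝ} (hf : Measurable f)
    (hg : Measurable g) : MeasurableSet {a | 0 < f a ∧ 0 < g a} := by
  rw [Set.ofPred_and]
  exact (measurableSet_lt measurable_const hf).inter (measurableSet_lt measurable_const hg)

/-- In polar coordinates the standard Gaussian density depends on the radius only, so the measure of
a cone factors into a radial integral and the length of its angle set. -/
lemma lintegral_stdGaussian_cone (S : Set (ℝ × ℝ)) (hS : MeasurableSet S) (Θ : Set ℝ)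
    (hΘ : MeasurableSet Θ)
    (h : ∀ r θ : ℝ, 0 < r → θ ∈ Set.Ioo (-Real.pi) Real.pi →
      ((r * Real.cos θ, r * Real.sin θ) ∈ S ↔ θ ∈ Θ)) :
    (gaussianReal 0 1).prod (gaussianReal 0 1) S =
      (∫⁻ r in Set.Ioi (0 : ℝ), ENNReal.ofReal r *
        ENNReal.ofReal ((√(2 * Real.pi))⁻¹ ^ 2 * Real.exp (-r ^ 2 / 2))) *
      volume (Θ ∩ Set.Ioo (-Real.pi) Real.pi) := by
  rw [gaussianReal_of_var_ne_zero 0 one_ne_zero,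
    prod_withDensity (measurable_gaussianPDF _ _) (measurable_gaussianPDF _ _),
    withDensity_apply _ hS, ← lintegral_indicator hS,
    ← Measure.volume_eq_prod, ← lintegral_comp_polarCoord_symm]
  have htarget : polarCoord.target = Set.Ioi (0 : ℝ) ×ˢ Set.Ioo (-Real.pi) Real.pi := rfl
  have hcongr : ∀ p ∈ polarCoord.target,
      ENNReal.ofReal p.1 • S.indicator
        (fun z : ℝ × ℝ => gaussianPDF 0 1 z.1 * gaussianPDF 0 1 z.2) (polarCoord.symm p) =
      (ENNReal.ofReal p.1 *
        ENNReal.ofReal ((√(2 * Real.pi))⁻¹ ^ 2 * Real.exp (-p.1 ^ 2 / 2))) *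
        Θ.indicator (fun _ => (1 : ENNReal)) p.2 := by
    rintro ⟨r, θ⟩ hp
    rw [htarget] at hp
    have hiff := h r θ hp.1 hp.2
    simp only [polarCoord_symm_apply, smul_eq_mul]
    by_cases hθ : θ ∈ Θ
    · rw [Set.indicator_of_mem (hiff.2 hθ), Set.indicator_of_mem hθ, mul_one]
      congr 1
      rw [gaussianPDF, gaussianPDF, ← ENNReal.ofReal_mul (gaussianPDFReal_nonneg _ _ _)]
      congr 1
      simp only [gaussianPDFReal, sub_zero, NNReal.coe_one, mul_one]
      have hexp : -r ^ 2 / 2 = -(r * Real.cos θ) ^ 2 / 2 + -(r * Real.sin θ) ^ 2 / 2 := by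
        linear_combination (r ^ 2 / 2) * Real.sin_sq_add_cos_sq θ
      rw [hexp, Real.exp_add]
      ring
    · rw [Set.indicator_of_notMem (fun hh => hθ (hiff.1 hh)), Set.indicator_of_notMem hθ]
      simp
  rw [setLIntegral_congr_fun polarCoord.open_target.measurableSet hcongr, htarget,
    Measure.volume_eq_prod, ← Measure.prod_restrict,
    lintegral_prod_mul (f := fun r : ℝ => ENNReal.ofReal r *
        ENNReal.ofReal ((√(2 * Real.pi))⁻¹ ^ 2 * Real.exp (-r ^ 2 / 2)))
      (g := Θ.indicator (fun _ => (1 : ENNReal))) (by fun_prop)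
      ((measurable_const.indicator hΘ).aemeasurable)]
  congr 1
  rw [lintegral_indicator hΘ, setLIntegral_one, Measure.restrict_apply hΘ]

/-- The radial integral need not be computed: the case of the whole plane, which has measure 1,
fixes its value as 1/(2π). -/
lemma stdGaussian_prod_cone (S : Set (ℝ × ℝ)) (hS : MeasurableSet S) (Θ : Set ℝ)
    (hΘ : MeasurableSet Θ)
    (h : ∀ r θ : ℝ, 0 < r → θ ∈ Set.Ioo (-Real.pi) Real.pi →
      ((r * Real.cos θ, r * Real.sin θ) ∈ S ↔ θ ∈ Θ)) :
    ((gaussianReal 0 1).prod (gaussianReal 0 1)).real S =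
      volume.real (Θ ∩ Set.Ioo (-Real.pi) Real.pi) / (2 * Real.pi) := by
  have h1 := lintegral_stdGaussian_cone Set.univ MeasurableSet.univ Set.univ MeasurableSet.univ
    (by simp)
  have h2 := lintegral_stdGaussian_cone S hS Θ hΘ h
  set K := (∫⁻ r in Set.Ioi (0 : ℝ), ENNReal.ofReal r *
        ENNReal.ofReal ((√(2 * Real.pi))⁻¹ ^ 2 * Real.exp (-r ^ 2 / 2))) with hK
  rw [measure_univ, Set.univ_inter, Real.volume_Ioo] at h1
  have h3 : K.toReal * (2 * Real.pi) = 1 := by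
    have := congrArg ENNReal.toReal h1
    rw [ENNReal.toReal_mul, ENNReal.toReal_ofReal (by linarith [Real.pi_pos])] at this
    simp at this
    linarith
  rw [measureReal_def, h2, ENNReal.toReal_mul, measureReal_def]
  have := Real.pi_pos
  field_simp
  linear_combination (volume (Θ ∩ Set.Ioo (-Real.pi) Real.pi)).toReal * h3

/-- In polar coordinates the two conditions read cos θ > 0 and cos(θ - α) > 0, which leaves the
angles between α - π/2 and π/2. -/
lemma stdGaussian_prod_wedge (α : ℝ) (h0 : 0 ≤ α) (h1 : α ≤ Real.pi) :
    ((gaussianReal 0 1).prod (gaussianReal 0 1)).real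
      {p : ℝ × ℝ | 0 < p.1 ∧ 0 < Real.cos α * p.1 + Real.sin α * p.2} =
      (Real.pi - α) / (2 * Real.pi) := by
  have hpi := Real.pi_pos
  rw [stdGaussian_prod_cone _ _ (Set.Ioo (α - Real.pi / 2) (Real.pi / 2)) measurableSet_Ioo]
  · rw [Set.inter_eq_left.2 (Set.Ioo_subset_Ioo (by linarith) (by linarith)), measureReal_def,
      Real.volume_Ioo, ENNReal.toReal_ofReal (by linarith)]
    ring
  · intro r θ hr hθ
    have e1 : Real.cos α * (r * Real.cos θ) + Real.sin α * (r * Real.sin θ)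
        = r * Real.cos (θ - α) := by rw [Real.cos_sub]; ring
    simp only [Set.mem_ofPred_eq, e1, mul_pos_iff_of_pos_left hr, Set.mem_Ioo]
    obtain ⟨hl, hu⟩ := hθ
    constructor
    · rintro ⟨hc1, hc2⟩
      constructor
      · by_contra hcon
        push Not at hcon
        have := Real.cos_nonpos_of_pi_div_two_le_of_le (x := -(θ - α)) (by linarith)
        by_cases h3 : -(θ - α) ≤ Real.pi + Real.pi / 2
        · have := this h3
          rw [Real.cos_neg] at this
          linarith
        · push Not at h3
          have hθ2 : θ < -(Real.pi / 2) := by linarith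
          have := Real.cos_nonpos_of_pi_div_two_le_of_le (x := -θ) (by linarith) (by linarith)
          rw [Real.cos_neg] at this
          linarith
      · by_contra hcon
        push Not at hcon
        have := Real.cos_nonpos_of_pi_div_two_le_of_le (x := θ) hcon (by linarith)
        linarith
    · rintro ⟨ha, hb⟩
      exact ⟨Real.cos_pos_of_mem_Ioo ⟨by linarith, hb⟩,
        Real.cos_pos_of_mem_Ioo ⟨by linarith, by linarith⟩⟩
  · exact measurableSet_pos_and (by fun_prop) (by fun_prop)

lemma gaussian_prod_wedge (v : ℝ≥0) (hv : v ≠ 0) (t : ℝ) (h0 : -1 ≤ t) (h1 : t ≤ 1) :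
    ((gaussianReal 0 v).prod (gaussianReal 0 v)).real
      {p : ℝ × ℝ | 0 < p.1 ∧ 0 < t * p.1 + √(1 - t ^ 2) * p.2} =
      1 / 4 + Real.arcsin t / (2 * Real.pi) := by
  have hw := stdGaussian_prod_wedge (Real.arccos t) (Real.arccos_nonneg t) (Real.arccos_le_pi t)
  rw [Real.cos_arccos h0 h1, Real.sin_arccos] at hw
  have hs : 0 < √(v : ℝ) := by positivity
  have hmap : gaussianReal 0 v = (gaussianReal 0 1).map (fun x => √(v : ℝ) * x) := by
    rw [gaussianReal_map_const_mul]
    congr 1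
    · simp
    · ext; simp
  have hm : Measurable (fun x : ℝ => √(v : ℝ) * x) := by fun_prop
  have hmeas : MeasurableSet {p : ℝ × ℝ | 0 < p.1 ∧ 0 < t * p.1 + √(1 - t ^ 2) * p.2} :=
    measurableSet_pos_and (by fun_prop) (by fun_prop)
  rw [hmap, Measure.map_prod_map _ _ hm hm, measureReal_def,
    Measure.map_apply (hm.prodMap hm) hmeas]
  have hpre : Prod.map (fun x => √(v : ℝ) * x) (fun x => √(v : ℝ) * x) ⁻¹'
      {p : ℝ × ℝ | 0 < p.1 ∧ 0 < t * p.1 + √(1 - t ^ 2) * p.2} =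
      {p : ℝ × ℝ | 0 < p.1 ∧ 0 < t * p.1 + √(1 - t ^ 2) * p.2} := by
    ext p
    simp only [Set.mem_preimage, Prod.map_fst, Prod.map_snd, Set.mem_ofPred_eq]
    rw [show t * (√(v : ℝ) * p.1) + √(1 - t ^ 2) * (√(v : ℝ) * p.2)
      = √(v : ℝ) * (t * p.1 + √(1 - t ^ 2) * p.2) by ring, mul_pos_iff_of_pos_left hs,
      mul_pos_iff_of_pos_left hs]
  rw [hpre, ← measureReal_def, hw, Real.arccos]
  have := Real.pi_pos
  field_simp
  ring

/-- Sheppard's formula for the probability that two linear functionals of a Gaussian vector are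
both positive. -/
lemma gaussian_quadrant {ι : Type*} [Fintype ι] (v : ℝ≥0) (hv : v ≠ 0)
    (x y : EuclideanSpace ℝ ι) (hx : ‖x‖ = 1) (hy : ‖y‖ = 1) :
    (Measure.pi fun _ : ι => gaussianReal 0 v).real
      {w | 0 < ∑ a, w a * x a ∧ 0 < ∑ a, w a * y a} =
      1 / 4 + Real.arcsin (inner ℝ x y) / (2 * Real.pi) := by
  set t : ℝ := inner ℝ x y with ht
  have habs : |t| ≤ 1 := by
    have := abs_real_inner_le_norm x y
    rwa [hx, hy, mul_one] at this
  obtain ⟨h0, h1⟩ := abs_le.1 habs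
  have hxs : ∑ a, x a ^ 2 = 1 := by rw [← EuclideanSpace.real_norm_sq_eq, hx]; norm_num
  have hys : ∑ a, y a ^ 2 = 1 := by rw [← EuclideanSpace.real_norm_sq_eq, hy]; norm_num
  have htx : ∑ a, x a * y a = t := by
    rw [ht, PiLp.inner_apply]
    exact Finset.sum_congr rfl fun a _ => by simp [mul_comm]
  set s : ℝ := √(1 - t ^ 2) with hs
  have hs2 : s ^ 2 = 1 - t ^ 2 := Real.sq_sqrt (by nlinarith)
  have hsq : ∑ a, (y a - t * x a) ^ 2 = s ^ 2 := by
    have : ∀ a, (y a - t * x a) ^ 2 = y a ^ 2 - 2 * t * (x a * y a) + t ^ 2 * x a ^ 2 :=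
      fun a => by ring
    simp_rw [this, Finset.sum_add_distrib, Finset.sum_sub_distrib, ← Finset.mul_sum]
    rw [hxs, hys, htx, hs2]; ring
  rw [← gaussian_prod_wedge v hv t h0 h1]
  have hmeas : MeasurableSet {p : ℝ × ℝ | 0 < p.1 ∧ 0 < t * p.1 + s * p.2} :=
    measurableSet_pos_and (by fun_prop) (by fun_prop)
  -- When `s` vanishes, y = t x and only one Gaussian variable is involved; otherwise Gram-Schmidt
  -- supplies an orthonormal pair x, (y - t x)/s.
  rcases eq_or_ne s 0 with hs0 | hs0
  · have hy' : ∀ a, y a = t * x a := by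
      intro a
      rw [hs0] at hsq
      have := (Finset.sum_eq_zero_iff_of_nonneg (fun a _ => sq_nonneg _)).1
        (hsq.trans (by norm_num)) a (Finset.mem_univ a)
      have := pow_eq_zero_iff (two_ne_zero) |>.1 this
      linarith
    have hset : {p : ℝ × ℝ | 0 < p.1 ∧ 0 < t * p.1 + s * p.2} =
        Prod.fst ⁻¹' {a : ℝ | 0 < a ∧ 0 < t * a} := by
      ext p; simp [hs0]
    have hset2 : {w : ι → ℝ | 0 < ∑ a, w a * x a ∧ 0 < ∑ a, w a * y a} =
        (fun w => ∑ a, w a * x a) ⁻¹' {a : ℝ | 0 < a ∧ 0 < t * a} := by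
      ext w
      simp only [hy', Set.mem_ofPred_eq, Set.mem_preimage, Finset.mul_sum]
      have : ∀ a, w a * (t * x a) = t * (w a * x a) := fun a => by ring
      simp_rw [this]
    have hm1 : MeasurableSet {a : ℝ | 0 < a ∧ 0 < t * a} :=
      measurableSet_pos_and (by fun_prop) (by fun_prop)
    rw [hset, hset2, measureReal_def, measureReal_def,
      ← Measure.map_apply (by fun_prop) hm1, ← Measure.map_apply (by fun_prop) hm1,
      map_dot_pi_gaussian, hxs, Measure.map_fst_prod]
    simp
  · have he : ∑ a, ((y a - t * x a) / s) ^ 2 = 1 := by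
      simp_rw [div_pow, ← Finset.sum_div, hsq]
      field_simp
    have hxe : ∑ a, x a * ((y a - t * x a) / s) = 0 := by
      have : ∀ a, x a * ((y a - t * x a) / s) = (x a * y a - t * x a ^ 2) / s :=
        fun a => by ring
      simp_rw [this, ← Finset.sum_div, Finset.sum_sub_distrib, ← Finset.mul_sum, htx, hxs]
      simp
    rw [← map_dot_prod_pi_gaussian v (fun a => x a) _ hxs he hxe, measureReal_def,
      measureReal_def, Measure.map_apply (by fun_prop) hmeas]
    congr 2
    ext w
    simp only [Set.mem_ofPred_eq, Set.mem_preimage]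
    have : t * ∑ a, w a * x a + s * ∑ a, w a * ((y a - t * x a) / s) = ∑ a, w a * y a := by
      rw [Finset.mul_sum, Finset.mul_sum, ← Finset.sum_add_distrib]
      refine Finset.sum_congr rfl fun a _ => ?_
      field_simp
      ring
    rw [this]


/-! ### Frobenius norm, ReLU increments and good initializations -/

/-- The squared Frobenius norm of a matrix. -/
def normSq {p q : ℕ} (M : Matrix (Fin p) (Fin q) ℝ) : ℝ := ∑ j, ∑ c, M j c ^ 2

lemma normSq_nonneg {p q : ℕ} (M : Matrix (Fin p) (Fin q) ℝ) : 0 ≤ normSq M :=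
  Finset.sum_nonneg fun _ _ => Finset.sum_nonneg fun _ _ => sq_nonneg _

lemma normSq_add_le {p q : ℕ} (M M' : Matrix (Fin p) (Fin q) ℝ) :
    normSq (M + M') ≤ 2 * normSq M + 2 * normSq M' := by
  simp only [normSq, Finset.mul_sum, ← Finset.sum_add_distrib, Matrix.add_apply]
  refine Finset.sum_le_sum fun j _ => Finset.sum_le_sum fun c _ => ?_
  nlinarith [sq_nonneg (M j c - M' j c)]

lemma normSq_smul {p q : ℕ} (s : ℝ) (M : Matrix (Fin p) (Fin q) ℝ) :
    normSq (s • M) = s ^ 2 * normSq M := by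
  simp only [normSq, Finset.mul_sum, Matrix.smul_apply, smul_eq_mul, mul_pow]

lemma normSq_neg {p q : ℕ} (M : Matrix (Fin p) (Fin q) ℝ) : normSq (-M) = normSq M := by
  simp [normSq]

lemma normSq_sum_le {ι : Type*} {p q : ℕ} (s : Finset ι) (M : ι → Matrix (Fin p) (Fin q) ℝ) :
    normSq (∑ i ∈ s, M i) ≤ s.card * ∑ i ∈ s, normSq (M i) := by
  have h : ∀ j c, (∑ i ∈ s, M i) j c ^ 2 ≤ s.card * ∑ i ∈ s, M i j c ^ 2 := by
    intro j c
    rw [Matrix.sum_apply]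
    exact sq_sum_le_card_mul_sum_sq
  refine (Finset.sum_le_sum fun j _ => Finset.sum_le_sum fun c _ => h j c).trans (le_of_eq ?_)
  simp only [normSq]
  rw [Finset.sum_comm (s := s), Finset.mul_sum]
  refine Finset.sum_congr rfl fun j _ => ?_
  rw [Finset.sum_comm (s := s), Finset.mul_sum]

lemma sum_sq_mulVec_le {p q : ℕ} (M : Matrix (Fin p) (Fin q) ℝ) (x : EuclideanSpace ℝ (Fin q))
    (hx : ‖x‖ = 1) : ∑ j, (M *ᵥ x.ofLp) j ^ 2 ≤ normSq M := by
  refine Finset.sum_le_sum fun j _ => ?_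
  have h := Finset.sum_mul_sq_le_sq_mul_sq Finset.univ (fun c => M j c) (fun c => x c)
  rw [← EuclideanSpace.real_norm_sq_eq x, hx] at h
  simpa [Matrix.mulVec, dotProduct] using h

lemma relu_sub_sq_le (z z' : ℝ) : (relu z' - relu z) ^ 2 ≤ (z' - z) ^ 2 := by
  have h := abs_max_sub_max_le_abs z' z 0
  exact sq_le_sq.2 h

lemma reluDeriv_nonneg (z : ℝ) : 0 ≤ reluDeriv z := by unfold reluDeriv; split_ifs <;> norm_num

lemma reluDeriv_le_one (z : ℝ) : reluDeriv z ≤ 1 := by unfold reluDeriv; split_ifs <;> norm_num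

/-- A number farther than ρ from zero cannot change sign by moving less than ρ. -/
lemma abs_le_or_of_reluDeriv_ne {z z' ρ : ℝ} (h : reluDeriv z ≠ reluDeriv z') :
    |z'| ≤ ρ ∨ ρ ≤ |z - z'| := by
  by_contra hcon
  push Not at hcon
  obtain ⟨h1, h2⟩ := hcon
  apply h
  unfold reluDeriv
  have h3 := abs_lt.1 h2
  rcases lt_abs.1 h1 with h4 | h4
  · rw [if_pos (by linarith), if_pos]
    by_contra h5
    linarith [abs_nonneg (z - z')]
  · rw [if_neg (by linarith), if_neg]
    intro h5
    linarith [abs_nonneg (z - z')]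

/-- The ReLU is exactly linear between points with equal derivative; otherwise the linearization
error is at most |z' - z|. -/
lemma mul_relu_sub_le (p z z' : ℝ) :
    p * (relu z' - relu z) ≤ p * (reluDeriv z * (z' - z)) +
      if reluDeriv z ≠ reluDeriv z' then |p| * |z' - z| else 0 := by
  have key : (reluDeriv z = reluDeriv z' → relu z' - relu z = reluDeriv z * (z' - z)) ∧
      |relu z' - relu z - reluDeriv z * (z' - z)| ≤ |z' - z| := by
    unfold relu reluDeriv
    by_cases h1 : 0 < z <;> by_cases h2 : 0 < z'
    · simp [h1, h2, max_eq_left h1.le, max_eq_left h2.le]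
    · push Not at h2
      simp only [h1, not_lt.2 h2, max_eq_left h1.le, max_eq_right h2, if_true, if_false]
      refine ⟨by norm_num, ?_⟩
      rw [abs_le, abs_of_nonpos (by linarith)]
      constructor <;> linarith
    · push Not at h1
      simp only [h2, not_lt.2 h1, max_eq_left h2.le, max_eq_right h1, if_true, if_false]
      refine ⟨by norm_num, ?_⟩
      rw [abs_le, abs_of_nonneg (by linarith)]
      constructor <;> linarith
    · push Not at h1 h2
      simp [not_lt.2 h1, not_lt.2 h2, max_eq_right h1, max_eq_right h2]
  split_ifs with h
  · have h3 : p * (relu z' - relu z - reluDeriv z * (z' - z)) ≤ |p| * |z' - z| :=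
      (le_abs_self _).trans (by
        rw [abs_mul]; exact mul_le_mul_of_nonneg_left key.2 (abs_nonneg _))
    linarith
  · push Not at h
    rw [key.1 h]; simp

/-- The deterministic properties of the initialization that the convergence proof uses; the
parameter `a` stands for `m / k`. -/
structure GoodInit {n d m k : ℕ} (x : Fin n → EuclideanSpace ℝ (Fin d))
    (W0 : Matrix (Fin m) (Fin d) ℝ) (V : Matrix (Fin k) (Fin m) ℝ) (ρ a κ M lam : ℝ) : Prop where
  op : ∀ u : Fin k → ℝ, ∑ j, (u ᵥ* V) j ^ 2 ≤ 2 * a * ∑ b, u b ^ 2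
  small : ∀ i, ∀ u : Fin k → ℝ,
    ∑ j, (if |(W0 *ᵥ (x i).ofLp) j| ≤ ρ then (u ᵥ* V) j ^ 2 else 0) ≤ κ * a * ∑ b, u b ^ 2
  col : ∀ j, ∑ b, V b j ^ 2 ≤ M
  lower : ∀ U : Fin n → Fin k → ℝ, lam * a * ∑ i, ∑ b, U i b ^ 2 ≤
    ∑ j, ∑ c, (∑ i, (U i ᵥ* V) j * reluDeriv ((W0 *ᵥ (x i).ofLp) j) * x i c) ^ 2

/-! ### Kernel, gradients and losses near a good initialization -/

section Deterministic

variable {n d m k : ℕ} {x : Fin n → EuclideanSpace ℝ (Fin d)} {y : Fin n → EuclideanSpace ℝ (Fin k)}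
  {W0 : Matrix (Fin m) (Fin d) ℝ} {V : Matrix (Fin k) (Fin m) ℝ} {ρ a κ M lam : ℝ}

lemma vecMul_sq_le (hcol : ∀ j, ∑ b, V b j ^ 2 ≤ M) (u : Fin k → ℝ) (j : Fin m) :
    (u ᵥ* V) j ^ 2 ≤ M * ∑ b, u b ^ 2 := by
  have h := Finset.sum_mul_sq_le_sq_mul_sq Finset.univ u (fun b => V b j)
  have hu : 0 ≤ ∑ b, u b ^ 2 := Finset.sum_nonneg fun _ _ => sq_nonneg _
  calc (u ᵥ* V) j ^ 2 = (∑ b, u b * V b j) ^ 2 := by simp [Matrix.vecMul, dotProduct]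
    _ ≤ _ := h
    _ ≤ M * ∑ b, u b ^ 2 := by rw [mul_comm]; exact mul_le_mul_of_nonneg_right (hcol j) hu

/-- A flipped neuron either started within ρ of zero, which `small` accounts for, or its
preactivation moved by at least ρ. In the second case its squared move over ρ² is at least 1, and
the squared moves add up to at most ‖W - W0‖²; each weight (uᵀV)_j² is at most M‖u‖². -/
lemma GoodInit.flip_le (h : GoodInit x W0 V ρ a κ M lam) (hx : ∀ i, ‖x i‖ = 1) (hρ : 0 < ρ)
    (W : Matrix (Fin m) (Fin d) ℝ) (i : Fin n) (u : Fin k → ℝ) :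
    ∑ j, (if reluDeriv ((W *ᵥ (x i).ofLp) j) ≠ reluDeriv ((W0 *ᵥ (x i).ofLp) j)
      then (u ᵥ* V) j ^ 2 else 0) ≤
      (κ * a + M * normSq (W - W0) / ρ ^ 2) * ∑ b, u b ^ 2 := by
  have hu : 0 ≤ ∑ b, u b ^ 2 := Finset.sum_nonneg fun _ _ => sq_nonneg _
  have hterm : ∀ j, (if reluDeriv ((W *ᵥ (x i).ofLp) j) ≠ reluDeriv ((W0 *ᵥ (x i).ofLp) j)
      then (u ᵥ* V) j ^ 2 else 0) ≤
      (if |(W0 *ᵥ (x i).ofLp) j| ≤ ρ then (u ᵥ* V) j ^ 2 else 0) +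
        (M * ∑ b, u b ^ 2) / ρ ^ 2 * ((W - W0) *ᵥ (x i).ofLp) j ^ 2 := by
    intro j
    have hM : 0 ≤ M := le_trans (Finset.sum_nonneg fun _ _ => sq_nonneg _) (h.col j)
    have hnn : 0 ≤ (M * ∑ b, u b ^ 2) / ρ ^ 2 * ((W - W0) *ᵥ (x i).ofLp) j ^ 2 := by positivity
    have hq := vecMul_sq_le h.col u j
    split_ifs with h1 h2 h2
    · linarith
    · rcases abs_le_or_of_reluDeriv_ne (ρ := ρ) h1 with h3 | h3
      · exact absurd h3 h2
      · rw [zero_add, Matrix.sub_mulVec, Pi.sub_apply, div_mul_eq_mul_div,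
          le_div_iff₀ (by positivity)]
        have h4 : ρ ^ 2 ≤ ((W *ᵥ (x i).ofLp) j - (W0 *ᵥ (x i).ofLp) j) ^ 2 := by
          rw [← sq_abs ((W *ᵥ (x i).ofLp) j - (W0 *ᵥ (x i).ofLp) j)]
          gcongr
        exact mul_le_mul hq h4 (by positivity) (by positivity)
    · have := sq_nonneg ((u ᵥ* V) j); linarith
    · linarith
  refine (Finset.sum_le_sum fun j _ => hterm j).trans ?_
  rw [Finset.sum_add_distrib, ← Finset.mul_sum]
  have h1 := h.small i u
  by_cases hm : Nonempty (Fin m)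
  · have hM : 0 ≤ M := le_trans (Finset.sum_nonneg fun _ _ => sq_nonneg _) (h.col hm.some)
    have h2 : (M * ∑ b, u b ^ 2) / ρ ^ 2 * ∑ j, ((W - W0) *ᵥ (x i).ofLp) j ^ 2 ≤
        (M * ∑ b, u b ^ 2) / ρ ^ 2 * normSq (W - W0) :=
      mul_le_mul_of_nonneg_left (sum_sq_mulVec_le _ _ (hx i)) (by positivity)
    calc _ ≤ κ * a * ∑ b, u b ^ 2 + (M * ∑ b, u b ^ 2) / ρ ^ 2 * normSq (W - W0) :=
          add_le_add h1 h2
      _ = _ := by ring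
  · have he : IsEmpty (Fin m) := not_nonempty_iff.1 hm
    simp only [normSq, Finset.univ_eq_empty, Finset.sum_empty, mul_zero, zero_div, add_zero] at h1 ⊢
    exact h1

/-- The gradient at `W0` is the one at `W` plus the contribution of flipped neurons. The inequality
(p + q)² ≤ 2p² + 2q² halves λ, and Cauchy-Schwarz over the examples produces the factor n in front
of κ'. -/
lemma GoodInit.lower_of_near (h : GoodInit x W0 V ρ a κ M lam) (hx : ∀ i, ‖x i‖ = 1) (hρ : 0 < ρ)
    (W : Matrix (Fin m) (Fin d) ℝ) {κ' : ℝ}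
    (hκ : κ * a + M * normSq (W - W0) / ρ ^ 2 ≤ κ' * a)
    (U : Fin n → Fin k → ℝ) :
    (lam / 2 - n * κ') * a * ∑ i, ∑ b, U i b ^ 2 ≤
      ∑ j, ∑ c, (∑ i, (U i ᵥ* V) j * reluDeriv ((W *ᵥ (x i).ofLp) j) * x i c) ^ 2 := by
  set D : Fin m → Fin n → ℝ := fun j i =>
    reluDeriv ((W0 *ᵥ (x i).ofLp) j) - reluDeriv ((W *ᵥ (x i).ofLp) j) with hD
  have hDsq : ∀ j i, D j i ^ 2 =
      if reluDeriv ((W *ᵥ (x i).ofLp) j) ≠ reluDeriv ((W0 *ᵥ (x i).ofLp) j) then 1 else 0 := by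
    intro j i
    simp only [hD, reluDeriv]
    split_ifs <;> simp_all
  have hrow : ∀ j c, (∑ i, (U i ᵥ* V) j * reluDeriv ((W0 *ᵥ (x i).ofLp) j) * x i c) ^ 2 ≤
      2 * (∑ i, (U i ᵥ* V) j * reluDeriv ((W *ᵥ (x i).ofLp) j) * x i c) ^ 2 +
      2 * (n * ∑ i, (U i ᵥ* V) j ^ 2 * D j i ^ 2 * x i c ^ 2) := by
    intro j c
    have e : ∑ i, (U i ᵥ* V) j * reluDeriv ((W0 *ᵥ (x i).ofLp) j) * x i c =
        ∑ i, (U i ᵥ* V) j * reluDeriv ((W *ᵥ (x i).ofLp) j) * x i c +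
        ∑ i, (U i ᵥ* V) j * D j i * x i c := by
      rw [← Finset.sum_add_distrib]
      exact Finset.sum_congr rfl fun i _ => by simp only [hD]; ring
    have hcs := sq_sum_le_card_mul_sum_sq (s := Finset.univ)
      (f := fun i => (U i ᵥ* V) j * D j i * x i c)
    simp only [Finset.card_univ, Fintype.card_fin, mul_pow] at hcs
    rw [e]
    nlinarith [sq_nonneg (∑ i, (U i ᵥ* V) j * reluDeriv ((W *ᵥ (x i).ofLp) j) * x i c -
        ∑ i, (U i ᵥ* V) j * D j i * x i c)]
  have hsum := Finset.sum_le_sum fun j (_ : j ∈ Finset.univ) =>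
    Finset.sum_le_sum fun c (_ : c ∈ Finset.univ) => hrow j c
  simp only [Finset.sum_add_distrib, ← Finset.mul_sum] at hsum
  have hflip : ∑ j, ∑ c, ∑ i, (U i ᵥ* V) j ^ 2 * D j i ^ 2 * x i c ^ 2 ≤
      κ' * a * ∑ i, ∑ b, U i b ^ 2 := by
    have e1 : ∑ j, ∑ c, ∑ i, (U i ᵥ* V) j ^ 2 * D j i ^ 2 * x i c ^ 2 =
        ∑ i, ∑ j, (U i ᵥ* V) j ^ 2 * D j i ^ 2 := by
      rw [Finset.sum_comm (s := Finset.univ (α := Fin n))]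
      refine Finset.sum_congr rfl fun j _ => ?_
      rw [Finset.sum_comm]
      refine Finset.sum_congr rfl fun i _ => ?_
      rw [← Finset.mul_sum, ← EuclideanSpace.real_norm_sq_eq (x i), hx i]
      simp
    rw [e1, Finset.mul_sum]
    refine Finset.sum_le_sum fun i _ => ?_
    have hu : 0 ≤ ∑ b, U i b ^ 2 := Finset.sum_nonneg fun _ _ => sq_nonneg _
    refine le_trans (le_of_eq ?_) ((h.flip_le hx hρ W i (U i)).trans
      (mul_le_mul_of_nonneg_right hκ hu))
    refine Finset.sum_congr rfl fun j _ => ?_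
    rw [hDsq]
    split_ifs <;> simp
  have hl := h.lower U
  have hn : (0 : ℝ) ≤ n := Nat.cast_nonneg n
  have := mul_le_mul_of_nonneg_left hflip hn
  nlinarith

lemma network_apply (W : Matrix (Fin m) (Fin d) ℝ) (z : EuclideanSpace ℝ (Fin d)) (b : Fin k) :
    network V W z b = ∑ j, V b j * relu ((W *ᵥ z.ofLp) j) := by
  simp [network, Matrix.mulVec, dotProduct]

/-- A matrix and its transpose have the same operator norm. -/
lemma sum_sq_mulVec_le_of_vecMul {A : ℝ} (hA : 0 ≤ A)
    (hop : ∀ u : Fin k → ℝ, ∑ j, (u ᵥ* V) j ^ 2 ≤ A * ∑ b, u b ^ 2)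
    (s : Fin m → ℝ) : ∑ b, (V *ᵥ s) b ^ 2 ≤ A * ∑ j, s j ^ 2 := by
  set f := V *ᵥ s with hf
  have e : ∑ b, f b ^ 2 = ∑ j, (f ᵥ* V) j * s j := by
    have : f ⬝ᵥ (V *ᵥ s) = (f ᵥ* V) ⬝ᵥ s := Matrix.dotProduct_mulVec f V s
    rw [← hf] at this
    simpa [dotProduct, sq] using this
  have hcs := Finset.sum_mul_sq_le_sq_mul_sq Finset.univ (f ᵥ* V) s
  rw [← e] at hcs
  have h1 := hop f
  have hs : 0 ≤ ∑ j, s j ^ 2 := Finset.sum_nonneg fun _ _ => sq_nonneg _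
  have hf0 : 0 ≤ ∑ b, f b ^ 2 := Finset.sum_nonneg fun _ _ => sq_nonneg _
  rcases hf0.eq_or_lt with h0 | h0
  · rw [← h0]
    positivity
  · have : (∑ b, f b ^ 2) * ∑ b, f b ^ 2 ≤ (∑ b, f b ^ 2) * (A * ∑ j, s j ^ 2) := by
      nlinarith [mul_le_mul_of_nonneg_right h1 hs]
    exact le_of_mul_le_mul_left this h0

/-- The residual of the `i`-th example. -/
def resid (x : Fin n → EuclideanSpace ℝ (Fin d)) (y : Fin n → EuclideanSpace ℝ (Fin k))
    (V : Matrix (Fin k) (Fin m) ℝ) (W : Matrix (Fin m) (Fin d) ℝ) (i : Fin n) : Fin k → ℝ :=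
  (network V W (x i) - y i).ofLp

/-- The total loss `∑ᵢ ℓ(f_W(xᵢ), yᵢ)`. -/
def totalLoss (x : Fin n → EuclideanSpace ℝ (Fin d)) (y : Fin n → EuclideanSpace ℝ (Fin k))
    (V : Matrix (Fin k) (Fin m) ℝ) (W : Matrix (Fin m) (Fin d) ℝ) : ℝ :=
  ∑ i, exampleLoss V (x i) (y i) W

lemma exampleLoss_eq (W : Matrix (Fin m) (Fin d) ℝ) (i : Fin n) :
    exampleLoss V (x i) (y i) W = (∑ b, resid x y V W i b ^ 2) / 2 := by
  rw [exampleLoss, EuclideanSpace.real_norm_sq_eq]; rfl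

lemma exampleLoss_nonneg (W : Matrix (Fin m) (Fin d) ℝ) (i : Fin n) :
    0 ≤ exampleLoss V (x i) (y i) W := by unfold exampleLoss; positivity

lemma exampleLoss_le_totalLoss (W : Matrix (Fin m) (Fin d) ℝ) (i : Fin n) :
    exampleLoss V (x i) (y i) W ≤ totalLoss x y V W :=
  Finset.single_le_sum (f := fun i => exampleLoss V (x i) (y i) W)
    (fun i _ => exampleLoss_nonneg W i) (Finset.mem_univ i)

lemma totalLoss_nonneg (W : Matrix (Fin m) (Fin d) ℝ) : 0 ≤ totalLoss x y V W :=
  Finset.sum_nonneg fun i _ => exampleLoss_nonneg W i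

lemma sum_resid_sq (W : Matrix (Fin m) (Fin d) ℝ) :
    ∑ i, ∑ b, resid x y V W i b ^ 2 = 2 * totalLoss x y V W := by
  rw [totalLoss, Finset.mul_sum]
  exact Finset.sum_congr rfl fun i _ => by rw [exampleLoss_eq]; ring

lemma exampleGrad_apply (W : Matrix (Fin m) (Fin d) ℝ) (i : Fin n) (j : Fin m) (c : Fin d) :
    exampleGrad V (x i) (y i) W j c =
      (resid x y V W i ᵥ* V) j * reluDeriv ((W *ᵥ (x i).ofLp) j) * x i c := rfl

lemma GoodInit.normSq_exampleGrad_le (h : GoodInit x W0 V ρ a κ M lam) (hx : ∀ i, ‖x i‖ = 1)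
    (W : Matrix (Fin m) (Fin d) ℝ) (i : Fin n) :
    normSq (exampleGrad V (x i) (y i) W) ≤ 4 * a * exampleLoss V (x i) (y i) W := by
  have h1 : normSq (exampleGrad V (x i) (y i) W) ≤ ∑ j, (resid x y V W i ᵥ* V) j ^ 2 := by
    refine Finset.sum_le_sum fun j _ => ?_
    simp only [exampleGrad_apply, mul_pow, ← Finset.mul_sum]
    rw [← EuclideanSpace.real_norm_sq_eq (x i), hx i, one_pow, mul_one]
    have h2 : reluDeriv ((W *ᵥ (x i).ofLp) j) ^ 2 ≤ 1 :=
      pow_le_one₀ (reluDeriv_nonneg _) (reluDeriv_le_one _)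
    exact mul_le_of_le_one_right (sq_nonneg _) h2
  refine h1.trans ((h.op _).trans (le_of_eq ?_))
  rw [exampleLoss_eq]; ring

lemma resid_sub (W W' : Matrix (Fin m) (Fin d) ℝ) (i : Fin n) :
    resid x y V W' i - resid x y V W i =
      V *ᵥ fun j => relu ((W' *ᵥ (x i).ofLp) j) - relu ((W *ᵥ (x i).ofLp) j) := by
  funext b
  simp only [resid, Pi.sub_apply, WithLp.ofLp_sub, network_apply, Matrix.mulVec, dotProduct,
    mul_sub, Finset.sum_sub_distrib]
  ring

lemma GoodInit.sum_sq_resid_sub_le (h : GoodInit x W0 V ρ a κ M lam) (ha : 0 ≤ a)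
    (hx : ∀ i, ‖x i‖ = 1) (W W' : Matrix (Fin m) (Fin d) ℝ) (i : Fin n) :
    ∑ b, (resid x y V W' i - resid x y V W i) b ^ 2 ≤ 2 * a * normSq (W' - W) := by
  rw [resid_sub]
  refine (sum_sq_mulVec_le_of_vecMul (by positivity) h.op _).trans ?_
  refine mul_le_mul_of_nonneg_left ?_ (by positivity)
  refine le_trans (Finset.sum_le_sum fun j _ => relu_sub_sq_le _ _) ?_
  refine le_trans (le_of_eq ?_) (sum_sq_mulVec_le (W' - W) (x i) (hx i))
  simp [Matrix.sub_mulVec]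

/-- One step from `W` to `W'`, both near the initialization, changes the loss of an example almost
as its linearization predicts. -/
lemma GoodInit.exampleLoss_step (h : GoodInit x W0 V ρ a κ M lam) (ha : 0 ≤ a)
    (hx : ∀ i, ‖x i‖ = 1) (hρ : 0 < ρ) {κ' : ℝ} (W W' : Matrix (Fin m) (Fin d) ℝ)
    (hW : κ * a + M * normSq (W - W0) / ρ ^ 2 ≤ κ' * a)
    (hW' : κ * a + M * normSq (W' - W0) / ρ ^ 2 ≤ κ' * a) {α : ℝ} (hα : 0 < α) (i : Fin n) :
    exampleLoss V (x i) (y i) W' ≤ exampleLoss V (x i) (y i) W +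
      ∑ j, ∑ c, exampleGrad V (x i) (y i) W j c * (W' - W) j c +
      2 * α * κ' * a * exampleLoss V (x i) (y i) W + (1 / (2 * α) + a) * normSq (W' - W) := by
  set r := resid x y V W i with hr
  set r' := resid x y V W' i with hr'
  have hsq := h.sum_sq_resid_sub_le (y := y) ha hx W W' i
  have hid : (∑ b, r' b ^ 2) / 2 = (∑ b, r b ^ 2) / 2 + ∑ b, r b * (r' - r) b +
      (∑ b, (r' - r) b ^ 2) / 2 := by
    rw [Finset.sum_div, Finset.sum_div, Finset.sum_div, ← Finset.sum_add_distrib,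
      ← Finset.sum_add_distrib]
    exact Finset.sum_congr rfl fun b _ => by simp only [Pi.sub_apply]; ring
  have hlin : ∑ b, r b * (r' - r) b = ∑ j, (r ᵥ* V) j *
      (relu ((W' *ᵥ (x i).ofLp) j) - relu ((W *ᵥ (x i).ofLp) j)) := by
    rw [hr, hr', resid_sub]
    exact Matrix.dotProduct_mulVec _ V _
  have hterm : ∀ j, (r ᵥ* V) j *
      (relu ((W' *ᵥ (x i).ofLp) j) - relu ((W *ᵥ (x i).ofLp) j)) ≤
      ∑ c, exampleGrad V (x i) (y i) W j c * (W' - W) j c +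
      (α / 2 * ((if reluDeriv ((W *ᵥ (x i).ofLp) j) ≠ reluDeriv ((W0 *ᵥ (x i).ofLp) j)
          then (r ᵥ* V) j ^ 2 else 0) +
        (if reluDeriv ((W' *ᵥ (x i).ofLp) j) ≠ reluDeriv ((W0 *ᵥ (x i).ofLp) j)
          then (r ᵥ* V) j ^ 2 else 0)) + 1 / (2 * α) * ((W' - W) *ᵥ (x i).ofLp) j ^ 2) := by
    intro j
    set p := (r ᵥ* V) j
    set z := (W *ᵥ (x i).ofLp) j with hz
    set z' := (W' *ᵥ (x i).ofLp) j with hz'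
    set z0 := (W0 *ᵥ (x i).ofLp) j
    have hzz : ((W' - W) *ᵥ (x i).ofLp) j = z' - z := by rw [Matrix.sub_mulVec]; rfl
    have hg : ∑ c, exampleGrad V (x i) (y i) W j c * (W' - W) j c =
        p * (reluDeriv z * (z' - z)) := by
      rw [← hzz]
      simp only [Matrix.mulVec, dotProduct, Finset.mul_sum]
      exact Finset.sum_congr rfl fun c _ => by rw [exampleGrad_apply]; ring
    rw [hzz, hg]
    refine (mul_relu_sub_le p z z').trans ?_
    -- Young's inequality with a free parameter α, which is tuned to the step size when the one-step
    -- estimate is assembled.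
    have hyoung : |p| * |z' - z| ≤ α / 2 * p ^ 2 + 1 / (2 * α) * (z' - z) ^ 2 := by
      rw [← sq_abs p, ← sq_abs (z' - z)]
      have e : α / 2 * |p| ^ 2 + 1 / (2 * α) * |z' - z| ^ 2 - |p| * |z' - z| =
          1 / (2 * α) * (α * |p| - |z' - z|) ^ 2 := by field_simp; ring
      have : 0 ≤ 1 / (2 * α) * (α * |p| - |z' - z|) ^ 2 := by positivity
      linarith
    have hp2 := sq_nonneg p
    have hz2 : 0 ≤ 1 / (2 * α) * (z' - z) ^ 2 := by positivity
    have hap : 0 ≤ α / 2 * p ^ 2 := by positivity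
    gcongr
    -- If the derivatives at `z` and `z'` differ, at least one of them differs from that at `z0`, so
    -- the error is charged to the flips of `W` or of `W'` relative to `W0`.
    by_cases h1 : reluDeriv z = reluDeriv z0
    · by_cases h2 : reluDeriv z' = reluDeriv z0
      · simp only [h1, h2]; simpa using hz2
      · have h3 : reluDeriv z ≠ reluDeriv z' := fun e => h2 (e ▸ h1)
        rw [if_pos h3, if_pos h2]
        simp only [h1]; simpa using hyoung
    · rw [if_pos h1]
      have h5 : 0 ≤ if reluDeriv z' ≠ reluDeriv z0 then p ^ 2 else 0 := by
        split_ifs <;> positivity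
      have h6 : (if reluDeriv z ≠ reluDeriv z' then |p| * |z' - z| else 0) ≤ |p| * |z' - z| := by
        split_ifs
        · exact le_rfl
        · positivity
      nlinarith
  have hsum := Finset.sum_le_sum fun j (_ : j ∈ Finset.univ) => hterm j
  rw [← hlin] at hsum
  simp only [Finset.sum_add_distrib, ← Finset.mul_sum] at hsum
  have hr0 : 0 ≤ ∑ b, r b ^ 2 := Finset.sum_nonneg fun _ _ => sq_nonneg _
  have f1 := (h.flip_le hx hρ W i r).trans (mul_le_mul_of_nonneg_right hW hr0)
  have f2 := (h.flip_le hx hρ W' i r).trans (mul_le_mul_of_nonneg_right hW' hr0)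
  have f3 := mul_le_mul_of_nonneg_left (sum_sq_mulVec_le (W' - W) (x i) (hx i))
    (show 0 ≤ 1 / (2 * α) by positivity)
  have f4 := mul_le_mul_of_nonneg_left (add_le_add f1 f2) (show 0 ≤ α / 2 by positivity)
  rw [exampleLoss_eq, exampleLoss_eq, ← hr, ← hr', hid]
  have e : (1 / (2 * α) + a) * normSq (W' - W) =
    1 / (2 * α) * normSq (W' - W) + 2 * a * normSq (W' - W) / 2 := by ring
  rw [e]
  linarith

end Deterministic


/-! ### Averages over minibatches -/

lemma integral_minibatchLaw {n B : ℕ} (F : Finset (Fin n) → ℝ) :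
    ∫ b, F b ∂(minibatchLaw n B) =
      (∑ b ∈ Finset.powersetCard B Finset.univ, F b) / (n.choose B : ℝ) := by
  have hset : {s : Finset (Fin n) | s.card = B} =
      ((Finset.powersetCard B (Finset.univ : Finset (Fin n)) : Finset (Finset (Fin n))) :
        Set (Finset (Fin n))) := by
    ext s; simp
  rw [minibatchLaw, uniformOn, ProbabilityTheory.cond, hset, integral_smul_measure,
    setIntegral_finset _ Integrable.of_finite.integrableOn, Measure.count_apply_finset]
  simp [measureReal_def, div_eq_inv_mul]

lemma integral_minibatchLaw_mono {n B : ℕ} {F F' : Finset (Fin n) → ℝ}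
    (h : ∀ b, b.card = B → F b ≤ F' b) :
    ∫ b, F b ∂(minibatchLaw n B) ≤ ∫ b, F' b ∂(minibatchLaw n B) := by
  rw [integral_minibatchLaw, integral_minibatchLaw]
  gcongr with b hb
  exact h b (Finset.mem_powersetCard.1 hb).2

/-- Each index lies in C(n-1, B-1) of the C(n, B) batches, a proportion B/n. -/
lemma integral_minibatchLaw_sum {n B : ℕ} (hB : 1 ≤ B) (hBn : B ≤ n) (c : Fin n → ℝ) :
    ∫ b, ∑ s ∈ b, c s ∂(minibatchLaw n B) = B / n * ∑ s, c s := by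
  rw [integral_minibatchLaw]
  have hn : (0 : ℝ) < n := by
    have : 0 < n := by omega
    exact_mod_cast this
  have hch : (0 : ℝ) < n.choose B := by exact_mod_cast Nat.choose_pos hBn
  have hcount : ∀ s : Fin n,
      ((Finset.powersetCard B (Finset.univ : Finset (Fin n))).filter (fun b => s ∈ b)).card =
        (n - 1).choose (B - 1) := by
    intro s
    have := Finset.card_filter_powersetCard_subset {s} (Finset.univ : Finset (Fin n)) B
      (by simp) (by simpa using hB)
    simpa using this
  have h1 : ∑ b ∈ Finset.powersetCard B (Finset.univ : Finset (Fin n)), ∑ s ∈ b, c s =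
      ∑ s, ((n - 1).choose (B - 1) : ℝ) * c s := by
    have : ∀ b : Finset (Fin n), ∑ s ∈ b, c s = ∑ s, if s ∈ b then c s else 0 := by
      intro b; rw [Finset.sum_ite_mem, Finset.univ_inter]
    simp_rw [this]
    rw [Finset.sum_comm]
    refine Finset.sum_congr rfl fun s _ => ?_
    rw [← Finset.sum_filter, Finset.sum_const, hcount, nsmul_eq_mul]
  rw [h1, ← Finset.mul_sum]
  have h2 : (n : ℝ) * (n - 1).choose (B - 1) = n.choose B * B := by
    have := Nat.add_one_mul_choose_eq (n - 1) (B - 1)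
    rw [Nat.sub_add_cancel hB, Nat.sub_add_cancel (hB.trans hBn)] at this
    exact_mod_cast this
  field_simp
  linear_combination (∑ s, c s) * h2

/-! ### Functions of finitely many minibatches -/

section Sequence

variable {n B : ℕ} (hB : B ≤ n)

lemma isProbabilityMeasure_minibatchSeqLaw : IsProbabilityMeasure (minibatchSeqLaw n B hB) := by
  have := isProbabilityMeasure_minibatchLaw hB
  unfold minibatchSeqLaw
  infer_instance

/-- Extension of a finite sequence of minibatches by empty ones. -/
def extendBatches (t : ℕ) (z : Finset.range t → Finset (Fin n)) : ℕ → Finset (Fin n) :=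
  fun s => if h : s ∈ Finset.range t then z ⟨s, h⟩ else ∅

lemma DependsOn.eq_extendBatches {β : Type*} {t : ℕ} {f : (ℕ → Finset (Fin n)) → β}
    (hf : DependsOn f (Set.Iio t)) (b : ℕ → Finset (Fin n)) :
    f b = f (extendBatches t fun i => b i) := by
  refine hf fun i hi => ?_
  simp only [extendBatches]
  rw [dif_pos (Finset.mem_range.2 hi)]

lemma measurable_of_dependsOn {β : Type*} [MeasurableSpace β] {t : ℕ}
    {f : (ℕ → Finset (Fin n)) → β} (hf : DependsOn f (Set.Iio t)) : Measurable f := by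
  have : f = (fun z => f (extendBatches t z)) ∘ fun b (i : Finset.range t) => b i := by
    funext b; exact DependsOn.eq_extendBatches hf b
  rw [this]
  exact (Measurable.of_discrete).comp (measurable_pi_lambda _ fun i => measurable_pi_apply _)

/-- Finitely many batches, each with finitely many possible values, leave only finitely many values
of `f`, so it is bounded. -/
lemma integrable_of_dependsOn {t : ℕ} {f : (ℕ → Finset (Fin n)) → ℝ}
    (hf : DependsOn f (Set.Iio t)) : Integrable f (minibatchSeqLaw n B hB) := by
  have := isProbabilityMeasure_minibatchSeqLaw hB
  have hfin : (Set.range f).Finite := by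
    refine (Set.finite_range fun z : Finset.range t → Finset (Fin n) =>
      f (extendBatches t z)).subset ?_
    rintro _ ⟨b, rfl⟩
    exact ⟨_, (DependsOn.eq_extendBatches hf b).symm⟩
  obtain ⟨C, hC⟩ := (hfin.image norm).bddAbove
  exact Integrable.of_bound (measurable_of_dependsOn hf).aestronglyMeasurable C
    (Filter.Eventually.of_forall fun b => hC ⟨_, ⟨b, rfl⟩, rfl⟩)

/-- Averaging over the `t`-th minibatch when the earlier ones are fixed. -/
lemma integral_minibatchSeqLaw_step (t : ℕ)
    (F : (ℕ → Finset (Fin n)) → Finset (Fin n) → ℝ) (hF : DependsOn F (Set.Iio t)) :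
    ∫ b, F b (b t) ∂(minibatchSeqLaw n B hB) =
      ∫ b, ∫ s, F b s ∂(minibatchLaw n B) ∂(minibatchSeqLaw n B hB) := by
  have hprob := isProbabilityMeasure_minibatchLaw hB
  have hP := isProbabilityMeasure_minibatchSeqLaw hB
  set P := minibatchSeqLaw n B hB with hPdef
  set Z : (ℕ → Finset (Fin n)) → Finset.range t → Finset (Fin n) := fun b i => b i with hZ
  have hZm : Measurable Z := measurable_pi_lambda _ fun i => measurable_pi_apply _
  have hind : iIndepFun (fun (i : ℕ) (b : ℕ → Finset (Fin n)) => b i) P :=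
    iIndepFun_infinitePi (X := fun _ s => s) (fun _ => measurable_id)
  have hind2 : IndepFun Z (fun b : ℕ → Finset (Fin n) => b t) P := by
    have h := hind.indepFun_finset (Finset.range t) {t} (by simp)
      (fun i => measurable_pi_apply i)
    exact h.comp (φ := fun z => z) (ψ := fun z : ({t} : Finset ℕ) → Finset (Fin n) =>
      z ⟨t, Finset.mem_singleton_self t⟩) measurable_id (measurable_pi_apply _)
  have hmap := (indepFun_iff_map_prod_eq_prod_map_map hZm.aemeasurable
    (measurable_pi_apply t).aemeasurable).1 hind2
  have hev : P.map (fun b => b t) = minibatchLaw n B :=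
    Measure.infinitePi_map_eval (fun _ => minibatchLaw n B) t
  have hmZ : IsProbabilityMeasure (P.map Z) := Measure.isProbabilityMeasure_map hZm.aemeasurable
  set F' : (Finset.range t → Finset (Fin n)) × Finset (Fin n) → ℝ :=
    fun p => F (extendBatches t p.1) p.2 with hF'
  have hFF : ∀ b, F b = F (extendBatches t (Z b)) := DependsOn.eq_extendBatches hF
  calc ∫ b, F b (b t) ∂P = ∫ b, F' (Z b, b t) ∂P := by
        refine integral_congr_ae (Filter.Eventually.of_forall fun b => ?_)
        simp only [hF']; rw [← hFF]
    _ = ∫ p, F' p ∂(P.map fun b => (Z b, b t)) := by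
        rw [integral_map (hZm.prodMk (measurable_pi_apply t)).aemeasurable
          (Measurable.of_discrete).aestronglyMeasurable]
    _ = ∫ z, ∫ s, F' (z, s) ∂(minibatchLaw n B) ∂(P.map Z) := by
        rw [hmap, hev, integral_prod _ Integrable.of_finite]
    _ = ∫ b, ∫ s, F b s ∂(minibatchLaw n B) ∂P := by
        rw [integral_map hZm.aemeasurable (Measurable.of_discrete).aestronglyMeasurable]
        refine integral_congr_ae (Filter.Eventually.of_forall fun b => ?_)
        simp only [hF']; rw [← hFF]

end Sequence

/-! ### One step of stochastic gradient descent -/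

section Step

variable {n d m k : ℕ} {x : Fin n → EuclideanSpace ℝ (Fin d)} {y : Fin n → EuclideanSpace ℝ (Fin k)}
  {W0 : Matrix (Fin m) (Fin d) ℝ} {V : Matrix (Fin k) (Fin m) ℝ} {ρ a κ M lam : ℝ}

/-- One step of SGD from `W` with the minibatch `b`. -/
def sgdStep (x : Fin n → EuclideanSpace ℝ (Fin d)) (y : Fin n → EuclideanSpace ℝ (Fin k)) (B : ℕ)
    (η : ℝ) (V : Matrix (Fin k) (Fin m) ℝ) (W : Matrix (Fin m) (Fin d) ℝ) (b : Finset (Fin n)) :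
    Matrix (Fin m) (Fin d) ℝ :=
  W - (η / B) • ∑ s ∈ b, exampleGrad V (x s) (y s) W

lemma GoodInit.normSq_sgdStep_sub_le (h : GoodInit x W0 V ρ a κ M lam) (hx : ∀ i, ‖x i‖ = 1)
    {B : ℕ} (hB : 1 ≤ B) (η : ℝ) (W : Matrix (Fin m) (Fin d) ℝ) (b : Finset (Fin n))
    (hb : b.card = B) :
    normSq (sgdStep x y B η V W b - W) ≤
      η ^ 2 / B * ∑ s ∈ b, 4 * a * exampleLoss V (x s) (y s) W := by
  have hB0 : (0 : ℝ) < B := by exact_mod_cast hB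
  have e : sgdStep x y B η V W b - W = -((η / B) • ∑ s ∈ b, exampleGrad V (x s) (y s) W) := by
    rw [sgdStep]; abel
  rw [e, normSq_neg, normSq_smul]
  have h1 := normSq_sum_le b fun s => exampleGrad V (x s) (y s) W
  rw [hb] at h1
  have h2 : ∑ s ∈ b, normSq (exampleGrad V (x s) (y s) W) ≤
      ∑ s ∈ b, 4 * a * exampleLoss V (x s) (y s) W :=
    Finset.sum_le_sum fun s _ => h.normSq_exampleGrad_le hx W s
  calc (η / B) ^ 2 * normSq (∑ s ∈ b, exampleGrad V (x s) (y s) W)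
      ≤ (η / B) ^ 2 * (B * ∑ s ∈ b, 4 * a * exampleLoss V (x s) (y s) W) := by
        gcongr
        exact h1.trans (mul_le_mul_of_nonneg_left h2 hB0.le)
    _ = _ := by field_simp

lemma GoodInit.integral_normSq_sgdStep_sub_le (h : GoodInit x W0 V ρ a κ M lam)
    (hx : ∀ i, ‖x i‖ = 1) {B : ℕ} (hB : 1 ≤ B) (hBn : B ≤ n) (η : ℝ)
    (W : Matrix (Fin m) (Fin d) ℝ) :
    ∫ b, normSq (sgdStep x y B η V W b - W) ∂(minibatchLaw n B) ≤
      η ^ 2 * (4 * a) / n * totalLoss x y V W := by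
  have hB0 : (0 : ℝ) < B := by exact_mod_cast hB
  refine (integral_minibatchLaw_mono fun b hb => h.normSq_sgdStep_sub_le hx hB η W b hb).trans ?_
  rw [integral_const_mul, integral_minibatchLaw_sum hB hBn, ← Finset.mul_sum, totalLoss]
  refine le_of_eq ?_
  field_simp

/-- This holds for every batch, not just on average: the linearization of the loss requires both
ends of the step to be near `W0`. The loss in the ball is at most twice the initial one plus 2aR2,
and a small ηa makes the step shorter than √R2. -/
lemma GoodInit.normSq_sgdStep_sub_init_le (h : GoodInit x W0 V ρ a κ M lam) (ha : 0 ≤ a)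
    (hx : ∀ i, ‖x i‖ = 1) {B : ℕ} (hB : 1 ≤ B) {η R2 : ℝ} (hη : 0 ≤ η) (hηa : η * a ≤ 1 / 32)
    (hR : 16 * η ^ 2 * a * totalLoss x y V W0 ≤ R2) (W : Matrix (Fin m) (Fin d) ℝ)
    (hW : normSq (W - W0) ≤ R2) (b : Finset (Fin n)) (hb : b.card = B) :
    normSq (sgdStep x y B η V W b - W0) ≤ 4 * R2 := by
  have hB0 : (0 : ℝ) < B := by exact_mod_cast hB
  have hR2 : 0 ≤ R2 := (normSq_nonneg _).trans hW
  have h1 := h.normSq_sgdStep_sub_le (y := y) hx hB η W b hb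
  have h2 : ∀ s, exampleLoss V (x s) (y s) W ≤ 2 * totalLoss x y V W0 + 2 * a * R2 := by
    intro s
    have h3 := h.sum_sq_resid_sub_le (y := y) ha hx W0 W s
    have h4 := exampleLoss_le_totalLoss (x := x) (y := y) (V := V) W0 s
    have h5 : ∑ b, resid x y V W s b ^ 2 ≤ 2 * ∑ b, resid x y V W0 s b ^ 2 +
        2 * ∑ b, (resid x y V W s - resid x y V W0 s) b ^ 2 := by
      rw [Finset.mul_sum, Finset.mul_sum, ← Finset.sum_add_distrib]
      refine Finset.sum_le_sum fun b _ => ?_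
      simp only [Pi.sub_apply]
      nlinarith [sq_nonneg (resid x y V W s b - 2 * resid x y V W0 s b)]
    have h6 : 2 * a * normSq (W - W0) ≤ 2 * a * R2 := by gcongr
    rw [exampleLoss_eq] at h4 ⊢
    linarith
  have h3 : ∑ s ∈ b, 4 * a * exampleLoss V (x s) (y s) W ≤
      B * (4 * a * (2 * totalLoss x y V W0 + 2 * a * R2)) := by
    have := Finset.sum_le_card_nsmul b (fun s => 4 * a * exampleLoss V (x s) (y s) W)
      (4 * a * (2 * totalLoss x y V W0 + 2 * a * R2)) (fun s _ => by gcongr; exact h2 s)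
    rwa [hb, nsmul_eq_mul] at this
  have h4 : normSq (sgdStep x y B η V W b - W) ≤ R2 := by
    refine h1.trans ?_
    calc η ^ 2 / B * ∑ s ∈ b, 4 * a * exampleLoss V (x s) (y s) W
        ≤ η ^ 2 / B * (B * (4 * a * (2 * totalLoss x y V W0 + 2 * a * R2))) := by gcongr
      _ = (16 * η ^ 2 * a * totalLoss x y V W0) / 2 + 8 * (η * a) ^ 2 * R2 := by
        field_simp; ring
      _ ≤ R2 / 2 + 8 * (1 / 32) ^ 2 * R2 := by gcongr
      _ ≤ R2 := by linarith
  have e : sgdStep x y B η V W b - W0 = (sgdStep x y B η V W b - W) + (W - W0) := by abel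
  rw [e]
  refine (normSq_add_le _ _).trans ?_
  linarith

/-- The expected decrease of the loss in one step of SGD near the initialization. -/
lemma GoodInit.integral_totalLoss_sgdStep_le (h : GoodInit x W0 V ρ a κ M lam) (ha : 0 ≤ a)
    (hx : ∀ i, ‖x i‖ = 1) (hρ : 0 < ρ) (hlam : 0 < lam) (hlam1 : lam ≤ 1) (hM : 0 ≤ M)
    {B : ℕ} (hB : 1 ≤ B) (hBn : B ≤ n) {η R2 κ' : ℝ} (hη : 0 < η)
    (hκ : κ * a + M * (4 * R2) / ρ ^ 2 ≤ κ' * a)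
    (hκ' : κ' ≤ lam ^ 2 / (1024 * n ^ 2)) (hηa : η * a ≤ lam / (32 * n))
    (hR : 16 * η ^ 2 * a * totalLoss x y V W0 ≤ R2) (W : Matrix (Fin m) (Fin d) ℝ)
    (hW : normSq (W - W0) ≤ R2) :
    ∫ b, totalLoss x y V (sgdStep x y B η V W b) ∂(minibatchLaw n B) ≤
      (1 - η * a * lam / (4 * n)) * totalLoss x y V W := by
  have hB0 : (0 : ℝ) < B := by exact_mod_cast hB
  have hn1 : (1 : ℝ) ≤ n := by exact_mod_cast hB.trans hBn
  have hn0 : (0 : ℝ) < n := by linarith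
  have hR2 : 0 ≤ R2 := (normSq_nonneg _).trans hW
  have := isProbabilityMeasure_minibatchLaw hBn
  set Φ := totalLoss x y V W with hΦ
  have hΦ0 : 0 ≤ Φ := totalLoss_nonneg W
  -- This value balances the two errors that depend on α: with κ' ≤ λ²/(1024n²), the flip term and
  -- the 1/(2α) term each come to at most ηaλΦ/(16n).
  set α : ℝ := 32 * n * η / lam with hα
  have hα0 : 0 < α := by positivity
  have hnear : ∀ W' : Matrix (Fin m) (Fin d) ℝ, normSq (W' - W0) ≤ 4 * R2 →
      κ * a + M * normSq (W' - W0) / ρ ^ 2 ≤ κ' * a := by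
    intro W' hW'
    refine le_trans ?_ hκ
    gcongr
  have hηa' : η * a ≤ 1 / 32 := by
    refine hηa.trans ?_
    rw [div_le_div_iff₀ (by positivity) (by norm_num)]
    nlinarith
  -- the gradient of the total loss
  set g : Fin m → Fin d → ℝ := fun j c => ∑ i, exampleGrad V (x i) (y i) W j c with hg
  -- The kernel bound is applied to the residuals; since nκ' ≤ λ/4, half of λ/2 survives the sign
  -- flips.
  have hg2 : lam / 4 * a * (2 * Φ) ≤ ∑ j, ∑ c, g j c ^ 2 := by
    have hl := h.lower_of_near hx hρ W (hnear W (by linarith)) (resid x y V W)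
    rw [sum_resid_sq, ← hΦ] at hl
    refine le_trans ?_ hl
    gcongr
    have : n * κ' ≤ lam / 4 := by
      calc n * κ' ≤ n * (lam ^ 2 / (1024 * n ^ 2)) := by gcongr
        _ = lam * (lam / (1024 * n)) := by field_simp
        _ ≤ lam * (1 / 4) := by
          refine mul_le_mul_of_nonneg_left ?_ hlam.le
          rw [div_le_div_iff₀ (by positivity) (by norm_num)]
          nlinarith
        _ = lam / 4 := by ring
    linarith
  -- pointwise estimate
  have hpt : ∀ b : Finset (Fin n), b.card = B → totalLoss x y V (sgdStep x y B η V W b) ≤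
      (1 + 2 * α * κ' * a) * Φ + (-(η / B)) * ∑ s ∈ b, ∑ j, ∑ c, g j c *
        exampleGrad V (x s) (y s) W j c +
      n * (1 / (2 * α) + a) * normSq (sgdStep x y B η V W b - W) := by
    intro b hb
    have hW' := h.normSq_sgdStep_sub_init_le (y := y) ha hx hB hη.le hηa' hR W hW b hb
    have hst := Finset.sum_le_sum fun i (_ : i ∈ Finset.univ) =>
      h.exampleLoss_step (y := y) ha hx hρ W _ (hnear W (by linarith)) (hnear _ hW') hα0 i
    simp only [Finset.sum_add_distrib, ← Finset.mul_sum, Finset.sum_const, Finset.card_univ,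
      Fintype.card_fin, nsmul_eq_mul] at hst
    have e1 : ∑ i, ∑ j, ∑ c, exampleGrad V (x i) (y i) W j c * (sgdStep x y B η V W b - W) j c =
        (-(η / B)) * ∑ s ∈ b, ∑ j, ∑ c, g j c * exampleGrad V (x s) (y s) W j c := by
      have e2 : ∀ j c, (sgdStep x y B η V W b - W) j c =
          (-(η / B)) * ∑ s ∈ b, exampleGrad V (x s) (y s) W j c := by
        intro j c
        simp only [sgdStep, Matrix.sub_apply, Matrix.smul_apply, Matrix.sum_apply, smul_eq_mul]
        ring
      rw [Finset.sum_comm, Finset.sum_comm (s := b), Finset.mul_sum]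
      refine Finset.sum_congr rfl fun j _ => ?_
      rw [Finset.sum_comm, Finset.sum_comm (s := b), Finset.mul_sum]
      refine Finset.sum_congr rfl fun c _ => ?_
      rw [e2, ← Finset.sum_mul, ← Finset.mul_sum]
      ring
    rw [e1] at hst
    refine hst.trans (le_of_eq ?_)
    rw [hΦ, totalLoss]
    ring
  have hint : ∀ f : Finset (Fin n) → ℝ, Integrable f (minibatchLaw n B) :=
    fun f => Integrable.of_finite
  refine (integral_minibatchLaw_mono hpt).trans ?_
  rw [integral_add (hint _) (hint _), integral_add (hint _) (hint _), integral_const_mul,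
    integral_const_mul, integral_const_mul, integral_minibatchLaw_sum hB hBn, integral_const,
    probReal_univ, one_smul]
  have e3 : ∑ s, ∑ j, ∑ c, g j c * exampleGrad V (x s) (y s) W j c = ∑ j, ∑ c, g j c ^ 2 := by
    rw [Finset.sum_comm]
    refine Finset.sum_congr rfl fun j _ => ?_
    rw [Finset.sum_comm]
    refine Finset.sum_congr rfl fun c _ => ?_
    rw [← Finset.mul_sum, sq]
  rw [e3]
  have hstep := h.integral_normSq_sgdStep_sub_le (y := y) hx hB hBn η W
  rw [← hΦ] at hstep
  have hc : 0 ≤ n * (1 / (2 * α) + a) := by positivity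
  -- In units of ηaλΦ/n: the gradient term gains 1/2, the flips lose 1/16, and the quadratic term
  -- loses 1/16 + 1/8. The net gain is 1/4.
  have t1 : -(η / B) * (B / n * ∑ j, ∑ c, g j c ^ 2) ≤ -(η * a * lam / n) * (1 / 2) * Φ := by
    have : η / n * (lam / 4 * a * (2 * Φ)) ≤ η / n * ∑ j, ∑ c, g j c ^ 2 := by gcongr
    have e4 : -(η / B) * (B / n * ∑ j, ∑ c, g j c ^ 2) = -(η / n * ∑ j, ∑ c, g j c ^ 2) := by
      field_simp
    rw [e4]
    have e5 : η / n * (lam / 4 * a * (2 * Φ)) = (η * a * lam / n) * (1 / 2) * Φ := by ring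
    linarith
  have t2 : 2 * α * κ' * a * Φ ≤ (η * a * lam / n) * (1 / 16) * Φ := by
    refine mul_le_mul_of_nonneg_right ?_ hΦ0
    calc 2 * α * κ' * a ≤ 2 * α * (lam ^ 2 / (1024 * n ^ 2)) * a := by gcongr
      _ = (η * a * lam / n) * (1 / 16) := by rw [hα]; field_simp; ring
  have t3 : n * (1 / (2 * α) + a) * (η ^ 2 * (4 * a) / n * Φ) ≤
      (η * a * lam / n) * (3 / 16) * Φ := by
    have e6 : n * (1 / (2 * α) + a) * (η ^ 2 * (4 * a) / n * Φ) =
        (η * a * lam / n) * (1 / 16) * Φ + 4 * (η * a) * (η * a) * Φ := by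
      rw [hα]; field_simp; ring
    rw [e6]
    have : 4 * (η * a) * (η * a) * Φ ≤ 4 * (η * a) * (lam / (32 * n)) * Φ := by gcongr
    have e7 : 4 * (η * a) * (lam / (32 * n)) * Φ = (η * a * lam / n) * (1 / 8) * Φ := by
      field_simp; ring
    linarith
  have t4 := mul_le_mul_of_nonneg_left hstep hc
  have e8 : (1 - η * a * lam / (4 * n)) * Φ = Φ - (η * a * lam / n) * (1 / 4) * Φ := by
    field_simp
  rw [e8]
  linarith

end Step


/-! ### The SGD trajectory -/

lemma geom_sum_le_inv {q : ℝ} (h0 : 0 ≤ q) (h1 : q < 1) (t : ℕ) :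
    ∑ s ∈ Finset.range t, q ^ s ≤ (1 - q)⁻¹ :=
  (summable_geometric_of_lt_one h0 h1).sum_le_tsum _ (fun _ _ => by positivity) |>.trans
    (tsum_geometric_of_lt_one h0 h1).le

/-- The displacement of a path in terms of a weighted sum of squared increments. -/
lemma normSq_sub_le_weighted {p r : ℕ} (w : ℕ → Matrix (Fin p) (Fin r) ℝ) {q : ℝ} (h0 : 0 < q)
    (h1 : q < 1) (t : ℕ) :
    normSq (w t - w 0) ≤
      (1 - q)⁻¹ * ∑ s ∈ Finset.range t, (q ^ s)⁻¹ * normSq (w (s + 1) - w s) := by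
  have hent : ∀ j c, (w t - w 0) j c ^ 2 ≤
      (1 - q)⁻¹ * ∑ s ∈ Finset.range t, (q ^ s)⁻¹ * (w (s + 1) - w s) j c ^ 2 := by
    intro j c
    have e : (w t - w 0) j c = ∑ s ∈ Finset.range t, (w (s + 1) - w s) j c := by
      rw [← Finset.sum_range_sub w t, Matrix.sum_apply]
    rw [e]
    -- Cauchy-Schwarz with weights q^s, whose sum is bounded uniformly in `t`; equal weights would
    -- cost a factor `t`.
    have hcs := Finset.sum_sq_le_sum_mul_sum_of_sq_le_mul (Finset.range t)
      (r := fun s => (w (s + 1) - w s) j c) (f := fun s => q ^ s)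
      (g := fun s => (q ^ s)⁻¹ * (w (s + 1) - w s) j c ^ 2)
      (fun s _ => by positivity) (fun s _ => by positivity)
      (fun s _ => le_of_eq (by field_simp))
    refine hcs.trans (mul_le_mul_of_nonneg_right (geom_sum_le_inv h0.le h1 t) ?_)
    exact Finset.sum_nonneg fun s _ => by positivity
  refine (Finset.sum_le_sum fun j _ => Finset.sum_le_sum fun c _ => hent j c).trans (le_of_eq ?_)
  simp only [← Finset.mul_sum, normSq]
  congr 1
  have : ∀ s, (q ^ s)⁻¹ * ∑ j, ∑ c, (w (s + 1) - w s) j c ^ 2 =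
      ∑ j, ∑ c, (q ^ s)⁻¹ * (w (s + 1) - w s) j c ^ 2 := by
    intro s; simp only [Finset.mul_sum]
  simp_rw [this]
  rw [Finset.sum_comm (s := Finset.range t)]
  refine Finset.sum_congr rfl fun j _ => ?_
  rw [Finset.sum_comm (s := Finset.range t)]

section Trajectory

variable {n d m k : ℕ} (x : Fin n → EuclideanSpace ℝ (Fin d)) (y : Fin n → EuclideanSpace ℝ (Fin k))
  (B : ℕ) (η : ℝ) (V : Matrix (Fin k) (Fin m) ℝ) (W0 : Matrix (Fin m) (Fin d) ℝ)

lemma sgd_succ (b : ℕ → Finset (Fin n)) (t : ℕ) :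
    sgd x y B η V W0 b (t + 1) = sgdStep x y B η V (sgd x y B η V W0 b t) (b t) := rfl

lemma dependsOn_sgd (t : ℕ) :
    DependsOn (fun b => sgd x y B η V W0 b t) (Set.Iio t) := by
  induction t with
  | zero => intro b b' _; rfl
  | succ t ih =>
    intro b b' h
    have h1 : sgd x y B η V W0 b t = sgd x y B η V W0 b' t :=
      ih fun i hi => h i (Set.mem_Iio.2 (Nat.lt_succ_of_lt hi))
    simp only [sgd_succ]
    rw [h1, h t (Set.mem_Iio.2 (Nat.lt_succ_self t))]

/-- The first `t` iterates stay in the Frobenius ball of squared radius `R2` around `W0`. -/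
def Stays (R2 : ℝ) (t : ℕ) (b : ℕ → Finset (Fin n)) : Prop :=
  ∀ s ≤ t, normSq (sgd x y B η V W0 b s - W0) ≤ R2

lemma dependsOn_stays (R2 : ℝ) (t : ℕ) :
    DependsOn (Stays x y B η V W0 R2 t) (Set.Iio t) := by
  intro b b' h
  have : ∀ s ≤ t, sgd x y B η V W0 b s = sgd x y B η V W0 b' s := fun s hs =>
    dependsOn_sgd x y B η V W0 s fun i hi => h i (Set.mem_Iio.2 (lt_of_lt_of_le hi hs))
  simp only [Stays, eq_iff_iff]
  refine forall_congr' fun s => forall_congr' fun hs => ?_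
  rw [this s hs]

open Classical in
/-- The loss after `t` steps, cut off once the iterates have left the ball. -/
def stayLoss (R2 : ℝ) (t : ℕ) (b : ℕ → Finset (Fin n)) : ℝ :=
  if Stays x y B η V W0 R2 t b then totalLoss x y V (sgd x y B η V W0 b t) else 0

lemma stayLoss_nonneg (R2 : ℝ) (t : ℕ) (b : ℕ → Finset (Fin n)) :
    0 ≤ stayLoss x y B η V W0 R2 t b := by
  unfold stayLoss
  split_ifs
  · exact totalLoss_nonneg _
  · exact le_rfl

open Classical in
lemma dependsOn_stayLoss (R2 : ℝ) (t : ℕ) :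
    DependsOn (stayLoss x y B η V W0 R2 t) (Set.Iio t) := by
  intro b b' h
  have h1 := dependsOn_sgd x y B η V W0 t h
  have h2 := dependsOn_stays x y B η V W0 R2 t h
  simp only at h1
  simp only [stayLoss, h1]
  exact if_congr (iff_of_eq h2) rfl rfl

end Trajectory

/-! ### Decay of the stopped loss and confinement of the trajectory -/

section Convergence

variable {n d m k : ℕ} {x : Fin n → EuclideanSpace ℝ (Fin d)} {y : Fin n → EuclideanSpace ℝ (Fin k)}
  {W0 : Matrix (Fin m) (Fin d) ℝ} {V : Matrix (Fin k) (Fin m) ℝ} {B : ℕ} {η R2 γ : ℝ}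

-- The one-step contraction is known only inside the ball. Cutting the loss off at the exit keeps
-- the induction alive: as losses are nonnegative, the condition on the newest iterate may be
-- dropped before averaging over the newest batch.
open Classical in
lemma integral_stayLoss_le (hBn : B ≤ n) (hR2 : 0 ≤ R2) (hγ : γ ≤ 1)
    (hstep : ∀ W, normSq (W - W0) ≤ R2 →
      ∫ b, totalLoss x y V (sgdStep x y B η V W b) ∂(minibatchLaw n B) ≤
        (1 - γ) * totalLoss x y V W) (t : ℕ) :
    ∫ b, stayLoss x y B η V W0 R2 t b ∂(minibatchSeqLaw n B hBn) ≤
      (1 - γ) ^ t * totalLoss x y V W0 := by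
  have := isProbabilityMeasure_minibatchSeqLaw hBn
  induction t with
  | zero =>
    have : ∀ b, stayLoss x y B η V W0 R2 0 b = totalLoss x y V W0 := by
      intro b
      rw [stayLoss, if_pos]
      · rfl
      · intro s hs
        rw [Nat.le_zero.1 hs]
        simpa [sgd, normSq] using hR2
    simp [this]
  | succ t ih =>
    set F : (ℕ → Finset (Fin n)) → Finset (Fin n) → ℝ := fun b s =>
      if Stays x y B η V W0 R2 t b then
        totalLoss x y V (sgdStep x y B η V (sgd x y B η V W0 b t) s) else 0 with hF
    have hFdep : DependsOn F (Set.Iio t) := by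
      intro b b' h
      have h1 := dependsOn_sgd x y B η V W0 t h
      have h2 := dependsOn_stays x y B η V W0 R2 t h
      simp only at h1
      simp only [hF, h1, h2]
    have hFdep' : DependsOn (fun b => F b (b t)) (Set.Iio (t + 1)) := by
      intro b b' h
      have h1 : F b = F b' := hFdep fun i hi => h i (Set.mem_Iio.2 (Nat.lt_succ_of_lt hi))
      simp only
      rw [h1, h t (Set.mem_Iio.2 (Nat.lt_succ_self t))]
    calc ∫ b, stayLoss x y B η V W0 R2 (t + 1) b ∂(minibatchSeqLaw n B hBn)
        ≤ ∫ b, F b (b t) ∂(minibatchSeqLaw n B hBn) := by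
          refine integral_mono (integrable_of_dependsOn hBn (dependsOn_stayLoss x y B η V W0 R2 _))
            (integrable_of_dependsOn hBn hFdep') fun b => ?_
          simp only [stayLoss, hF, sgd_succ]
          by_cases h1 : Stays x y B η V W0 R2 (t + 1) b
          · have h2 : Stays x y B η V W0 R2 t b := fun s hs => h1 s (by omega)
            rw [if_pos h1, if_pos h2]
          · rw [if_neg h1]
            split_ifs
            · exact totalLoss_nonneg _
            · exact le_rfl
      _ = ∫ b, ∫ s, F b s ∂(minibatchLaw n B) ∂(minibatchSeqLaw n B hBn) :=
          integral_minibatchSeqLaw_step hBn t F hFdep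
      _ ≤ ∫ b, (1 - γ) * stayLoss x y B η V W0 R2 t b ∂(minibatchSeqLaw n B hBn) := by
          refine integral_mono (integrable_of_dependsOn hBn (t := t) ?_)
            ((integrable_of_dependsOn hBn (dependsOn_stayLoss x y B η V W0 R2 t)).const_mul _)
            fun b => ?_
          · intro b b' h
            simp only
            rw [hFdep h]
          · simp only [stayLoss, hF]
            by_cases h1 : Stays x y B η V W0 R2 t b
            · simp only [if_pos h1]
              exact hstep _ (h1 t le_rfl)
            · simp [if_neg h1]
      _ ≤ (1 - γ) ^ (t + 1) * totalLoss x y V W0 := by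
          rw [integral_const_mul, pow_succ, mul_comm _ (1 - γ), mul_assoc]
          exact mul_le_mul_of_nonneg_left ih (by linarith)

-- Expected squared steps decay like (1-γ)^s before the exit. Their sum weighted by q^(-s) therefore
-- has a bounded mean, it dominates (1-q)·(displacement)² at the first exit, and Markov's inequality
-- concludes, uniformly in `T`.
open Classical in
lemma measureReal_not_stays_le (hBn : B ≤ n) (hR2 : 0 < R2) (hγ0 : 0 < γ) (hγ : γ < 1) {D : ℝ}
    (hD : 0 ≤ D)
    (hstep : ∀ W, normSq (W - W0) ≤ R2 →
      ∫ b, totalLoss x y V (sgdStep x y B η V W b) ∂(minibatchLaw n B) ≤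
        (1 - γ) * totalLoss x y V W)
    (hmove : ∀ W, ∫ b, normSq (sgdStep x y B η V W b - W) ∂(minibatchLaw n B) ≤
      D * totalLoss x y V W) (T : ℕ) :
    (minibatchSeqLaw n B hBn).real {b | ¬ Stays x y B η V W0 R2 T b} ≤
      4 * D * totalLoss x y V W0 / (γ ^ 2 * R2) := by
  have hprob := isProbabilityMeasure_minibatchSeqLaw hBn
  set P := minibatchSeqLaw n B hBn
  -- Then 1 - γ ≤ q², so that dividing the decay by q^s still leaves the summable factor q^s.
  set q : ℝ := 1 - γ / 2 with hq
  have hq0 : 0 < q := by rw [hq]; linarith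
  have hq1 : q < 1 := by rw [hq]; linarith
  set Φ0 := totalLoss x y V W0
  have hΦ0 : 0 ≤ Φ0 := totalLoss_nonneg W0
  set Δ : ℕ → (ℕ → Finset (Fin n)) → Finset (Fin n) → ℝ := fun s b c =>
    if Stays x y B η V W0 R2 s b then
      normSq (sgdStep x y B η V (sgd x y B η V W0 b s) c - sgd x y B η V W0 b s) else 0 with hΔ
  have hΔ0 : ∀ s b c, 0 ≤ Δ s b c := by
    intro s b c
    simp only [hΔ]
    split_ifs
    · exact normSq_nonneg _
    · exact le_rfl
  have hΔdep : ∀ s, DependsOn (Δ s) (Set.Iio s) := by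
    intro s b b' h
    have h1 := dependsOn_sgd x y B η V W0 s h
    have h2 := dependsOn_stays x y B η V W0 R2 s h
    simp only at h1
    simp only [hΔ, h1, h2]
  have hΔdep' : ∀ s, DependsOn (fun b => Δ s b (b s)) (Set.Iio (s + 1)) := by
    intro s b b' h
    have h1 : Δ s b = Δ s b' := hΔdep s fun i hi => h i (Set.mem_Iio.2 (Nat.lt_succ_of_lt hi))
    simp only
    rw [h1, h s (Set.mem_Iio.2 (Nat.lt_succ_self s))]
  have hΔint : ∀ s, ∫ b, Δ s b (b s) ∂P ≤ D * ((1 - γ) ^ s * Φ0) := by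
    intro s
    rw [integral_minibatchSeqLaw_step hBn s (Δ s) (hΔdep s)]
    calc ∫ b, ∫ c, Δ s b c ∂(minibatchLaw n B) ∂P
        ≤ ∫ b, D * stayLoss x y B η V W0 R2 s b ∂P := by
          refine integral_mono (integrable_of_dependsOn hBn (t := s) ?_)
            ((integrable_of_dependsOn hBn (dependsOn_stayLoss x y B η V W0 R2 s)).const_mul _)
            fun b => ?_
          · intro b b' h
            simp only
            rw [hΔdep s h]
          · simp only [stayLoss, hΔ]
            by_cases h1 : Stays x y B η V W0 R2 s b
            · simp only [if_pos h1]
              exact hmove _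
            · simp [if_neg h1]
      _ ≤ _ := by
          rw [integral_const_mul]
          exact mul_le_mul_of_nonneg_left (integral_stayLoss_le hBn hR2.le hγ.le hstep s) hD
  set X : (ℕ → Finset (Fin n)) → ℝ := fun b =>
    ∑ s ∈ Finset.range T, (q ^ s)⁻¹ * Δ s b (b s) with hX
  have hXint : Integrable X P := integrable_finsetSum _ fun s _ =>
    (integrable_of_dependsOn hBn (hΔdep' s)).const_mul _
  have hX0 : ∀ b, 0 ≤ X b := fun b =>
    Finset.sum_nonneg fun s _ => mul_nonneg (by positivity) (hΔ0 s b _)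
  have hEX : ∫ b, X b ∂P ≤ D * Φ0 * (1 - q)⁻¹ := by
    rw [integral_finsetSum _ fun s _ => (integrable_of_dependsOn hBn (hΔdep' s)).const_mul _]
    calc ∑ s ∈ Finset.range T, ∫ b, (q ^ s)⁻¹ * Δ s b (b s) ∂P
        ≤ ∑ s ∈ Finset.range T, D * Φ0 * q ^ s := by
          refine Finset.sum_le_sum fun s _ => ?_
          rw [integral_const_mul]
          have hqq : (1 - γ) ^ s ≤ q ^ s * q ^ s := by
            rw [← mul_pow]
            exact pow_le_pow_left₀ (by linarith) (by rw [hq]; nlinarith) s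
          calc (q ^ s)⁻¹ * ∫ b, Δ s b (b s) ∂P
              ≤ (q ^ s)⁻¹ * (D * ((q ^ s * q ^ s) * Φ0)) := by
                refine mul_le_mul_of_nonneg_left ((hΔint s).trans ?_) (by positivity)
                gcongr
            _ = D * Φ0 * q ^ s := by field_simp
      _ = D * Φ0 * ∑ s ∈ Finset.range T, q ^ s := by rw [Finset.mul_sum]
      _ ≤ _ := mul_le_mul_of_nonneg_left (geom_sum_le_inv hq0.le hq1 T) (by positivity)
  have hsub : {b | ¬ Stays x y B η V W0 R2 T b} ⊆ {b | (1 - q) * R2 ≤ X b} := by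
    intro b hb
    -- Consider the first exit time. All earlier iterates lie in the ball, so up to that time the
    -- cut-off increments are the true ones.
    have hex : ∃ t, t ≤ T ∧ R2 < normSq (sgd x y B η V W0 b t - W0) := by
      by_contra hcon
      push Not at hcon
      exact hb hcon
    obtain ⟨hfT, hfR⟩ := Nat.find_spec hex
    set t := Nat.find hex with ht
    have hstay : ∀ s < t, Stays x y B η V W0 R2 s b := by
      intro s hs r hr
      by_contra hcon
      exact Nat.find_min hex (lt_of_le_of_lt hr hs) ⟨by omega, not_le.1 hcon⟩
    have hw := normSq_sub_le_weighted (fun s => sgd x y B η V W0 b s) hq0 hq1 t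
    have hle : ∑ s ∈ Finset.range t, (q ^ s)⁻¹ *
        normSq (sgd x y B η V W0 b (s + 1) - sgd x y B η V W0 b s) ≤ X b := by
      calc _ = ∑ s ∈ Finset.range t, (q ^ s)⁻¹ * Δ s b (b s) := by
            refine Finset.sum_congr rfl fun s hs => ?_
            simp only [hΔ]
            rw [if_pos (hstay s (Finset.mem_range.1 hs)), sgd_succ]
        _ ≤ X b := Finset.sum_le_sum_of_subset_of_nonneg
            (Finset.range_mono hfT)
            fun s _ _ => mul_nonneg (by positivity) (hΔ0 s b _)
    have h3 : R2 < (1 - q)⁻¹ * X b := by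
      refine lt_of_lt_of_le hfR (le_trans hw ?_)
      exact mul_le_mul_of_nonneg_left hle (inv_nonneg.2 (by linarith))
    have h1q : 0 < 1 - q := by linarith
    rw [inv_mul_eq_div, lt_div_iff₀ h1q] at h3
    show (1 - q) * R2 ≤ X b
    linarith
  have hmarkov := mul_meas_ge_le_integral_of_nonneg (Filter.Eventually.of_forall hX0) hXint
    ((1 - q) * R2)
  have h1q : 1 - q = γ / 2 := by rw [hq]; ring
  rw [le_div_iff₀ (by positivity)]
  calc P.real {b | ¬ Stays x y B η V W0 R2 T b} * (γ ^ 2 * R2)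
      ≤ P.real {b | (1 - q) * R2 ≤ X b} * (γ ^ 2 * R2) := by
        refine mul_le_mul_of_nonneg_right (measureReal_mono hsub) (by positivity)
    _ = (1 - q) * R2 * P.real {b | (1 - q) * R2 ≤ X b} * (2 * γ) := by rw [h1q]; ring
    _ ≤ D * Φ0 * (1 - q)⁻¹ * (2 * γ) :=
        mul_le_mul_of_nonneg_right (hmarkov.trans hEX) (by positivity)
    _ = 4 * D * Φ0 := by rw [h1q]; field_simp; ring

/-- The event that all iterates stay in the ball is likely, and on it the loss decays
geometrically in expectation. -/
lemma exists_stay_event (hBn : B ≤ n) (hR2 : 0 < R2) (hγ0 : 0 < γ) (hγ : γ < 1) {D : ℝ}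
    (hD : 0 ≤ D)
    (hstep : ∀ W, normSq (W - W0) ≤ R2 →
      ∫ b, totalLoss x y V (sgdStep x y B η V W b) ∂(minibatchLaw n B) ≤
        (1 - γ) * totalLoss x y V W)
    (hmove : ∀ W, ∫ b, normSq (sgdStep x y B η V W b - W) ∂(minibatchLaw n B) ≤
      D * totalLoss x y V W) :
    ∃ A : Set (ℕ → Finset (Fin n)), MeasurableSet A ∧
      1 - 4 * D * totalLoss x y V W0 / (γ ^ 2 * R2) ≤ (minibatchSeqLaw n B hBn).real A ∧
      ∀ T, ∫ b in A, totalLoss x y V (sgd x y B η V W0 b T) ∂(minibatchSeqLaw n B hBn) ≤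
        (1 - γ) ^ T * totalLoss x y V W0 := by
  classical
  have hprob := isProbabilityMeasure_minibatchSeqLaw hBn
  set P := minibatchSeqLaw n B hBn
  have hmeas : ∀ T, MeasurableSet {b | ¬ Stays x y B η V W0 R2 T b} := by
    intro T
    have h := measurable_of_dependsOn (dependsOn_stays x y B η V W0 R2 T)
    exact (measurableSet_setOfPred.2 h).compl
  set E : ℕ → Set (ℕ → Finset (Fin n)) := fun T => {b | ¬ Stays x y B η V W0 R2 T b} with hE
  have hmono : Monotone E := by
    intro T T' hTT b hb hcon
    exact hb fun s hs => hcon s (hs.trans hTT)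
  have hEm : MeasurableSet (⋃ T, E T) := MeasurableSet.iUnion hmeas
  -- The event that no iterate ever leaves: it does not depend on the number of steps, and
  -- continuity from below preserves the uniform bound.
  refine ⟨(⋃ T, E T)ᶜ, hEm.compl, ?_, ?_⟩
  · rw [probReal_compl_eq_one_sub hEm]
    have hb0 : 0 ≤ 4 * D * totalLoss x y V W0 / (γ ^ 2 * R2) := by
      have := totalLoss_nonneg (x := x) (y := y) (V := V) W0
      positivity
    have : P.real (⋃ T, E T) ≤ 4 * D * totalLoss x y V W0 / (γ ^ 2 * R2) := by
      rw [measureReal_def, hmono.measure_iUnion]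
      refine ENNReal.toReal_le_of_le_ofReal hb0 (iSup_le fun T => ?_)
      rw [← ofReal_measureReal]
      exact ENNReal.ofReal_le_ofReal
        (measureReal_not_stays_le hBn hR2 hγ0 hγ hD hstep hmove T)
    linarith
  · intro T
    refine le_trans ?_ (integral_stayLoss_le hBn hR2.le hγ.le hstep T)
    rw [← integral_indicator hEm.compl]
    have hdep : DependsOn (fun b => totalLoss x y V (sgd x y B η V W0 b T)) (Set.Iio T) := by
      intro b b' h
      have h1 := dependsOn_sgd x y B η V W0 T h
      simp only at h1 ⊢
      rw [h1]
    refine integral_mono ((integrable_of_dependsOn hBn hdep).indicator hEm.compl)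
      (integrable_of_dependsOn hBn (dependsOn_stayLoss x y B η V W0 R2 T)) fun b => ?_
    by_cases hb : b ∈ (⋃ T, E T)ᶜ
    · rw [Set.indicator_of_mem hb, stayLoss, if_pos]
      by_contra hcon
      exact hb (Set.mem_iUnion.2 ⟨T, hcon⟩)
    · rw [Set.indicator_of_notMem hb]
      exact stayLoss_nonneg x y B η V W0 R2 T b

end Convergence


/-! ### Moments of the initialization -/

/-- The fourth moment of the standard Gaussian. -/
def gaussFourth : ℝ := ∫ z, z ^ 4 ∂(gaussianReal 0 1)

lemma gaussFourth_nonneg : 0 ≤ gaussFourth := integral_nonneg fun z => by positivity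

lemma integrable_pow_four_gaussian (v : ℝ≥0) : Integrable (fun z : ℝ => z ^ 4) (gaussianReal 0 v) := by
  have h := (memLp_id_gaussianReal' (μ := 0) (v := v) 4 (by simp)).integrable_norm_pow (by norm_num)
  refine h.congr (Filter.Eventually.of_forall fun z => ?_)
  simp only [id, Real.norm_eq_abs]
  exact (by decide : Even 4).pow_abs z

lemma integral_pow_four_gaussian (v : ℝ≥0) :
    ∫ z, z ^ 4 ∂(gaussianReal 0 v) = gaussFourth * (v : ℝ) ^ 2 := by
  have hmap : gaussianReal 0 v = (gaussianReal 0 1).map (fun z => √(v : ℝ) * z) := by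
    rw [gaussianReal_map_const_mul]
    congr 1
    · simp
    · ext; simp
  rw [hmap, integral_map (by fun_prop) (by fun_prop), gaussFourth, ← integral_mul_const]
  refine integral_congr_ae (Filter.Eventually.of_forall fun z => ?_)
  simp only [mul_pow]
  rw [show √(v : ℝ) ^ 4 = (√(v : ℝ) ^ 2) ^ 2 by ring, Real.sq_sqrt v.coe_nonneg]
  ring

lemma integral_sq_gaussian (v : ℝ≥0) : ∫ z, z ^ 2 ∂(gaussianReal 0 v) = v := by
  have h := variance_eq_sub (memLp_id_gaussianReal' (μ := 0) (v := v) 2 (by simp))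
  rw [variance_id_gaussianReal] at h
  simp only [id, Pi.pow_apply] at h
  simpa using h.symm

/-- The law of `V`. -/
abbrev outputLaw (k m : ℕ) : Measure (Fin k → Fin m → ℝ) :=
  Measure.pi fun _ => Measure.pi fun _ => gaussianReal 0 (1 / (k : ℝ≥0))

/-- The law of one row of `W^{(0)}`. -/
abbrev rowLaw (d m : ℕ) : Measure (Fin d → ℝ) :=
  Measure.pi fun _ => gaussianReal 0 (2 / (m : ℝ≥0))

/-- The law of `W^{(0)}`. -/
abbrev hiddenLaw (d m : ℕ) : Measure (Fin m → Fin d → ℝ) :=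
  Measure.pi fun _ => rowLaw d m

lemma initLaw_eq (d m k : ℕ) : initLaw d m k = (hiddenLaw d m).prod (outputLaw k m) := rfl

section Output
variable {k m : ℕ}

lemma measurePreserving_entry (a : Fin k) (j : Fin m) :
    MeasurePreserving (fun V : Fin k → Fin m → ℝ => V a j) (outputLaw k m)
      (gaussianReal 0 (1 / (k : ℝ≥0))) :=
  (measurePreserving_eval (fun _ : Fin m => gaussianReal 0 (1 / (k : ℝ≥0))) j).comp
    (measurePreserving_eval (fun _ : Fin k =>
      Measure.pi fun _ : Fin m => gaussianReal 0 (1 / (k : ℝ≥0))) a)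

lemma iIndepFun_entries :
    iIndepFun (fun (p : Fin k × Fin m) (V : Fin k → Fin m → ℝ) => V p.1 p.2) (outputLaw k m) := by
  have h := iIndepFun_uncurry_infinitePi' (X := fun (_ : Fin k) (_ : Fin m) (z : ℝ) => z)
    (fun (_ : Fin k) (_ : Fin m) => gaussianReal 0 (1 / (k : ℝ≥0))) (fun _ _ => measurable_id)
  simpa only [Measure.infinitePi_eq_pi] using h

lemma integral_entry (f : ℝ → ℝ) (hf : Measurable f) (a : Fin k) (j : Fin m) :
    ∫ V, f (V a j) ∂(outputLaw k m) = ∫ z, f z ∂(gaussianReal 0 (1 / (k : ℝ≥0))) := by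
  rw [← (measurePreserving_entry a j).map_eq,
    integral_map (measurePreserving_entry a j).aemeasurable hf.aestronglyMeasurable]

lemma integrable_entry {f : ℝ → ℝ} (hf : Integrable f (gaussianReal 0 (1 / (k : ℝ≥0))))
    (a : Fin k) (j : Fin m) : Integrable (fun V : Fin k → Fin m → ℝ => f (V a j)) (outputLaw k m) :=
  (measurePreserving_entry a j).integrable_comp_of_integrable hf

lemma integrable_entry_mul_sq (a b : Fin k) (j : Fin m) :
    Integrable (fun V : Fin k → Fin m → ℝ => (V a j * V b j) ^ 2) (outputLaw k m) := by
  refine ((integrable_entry (integrable_pow_four_gaussian _) a j).add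
    (integrable_entry (integrable_pow_four_gaussian _) b j)).mono'
    (Measurable.aestronglyMeasurable (by fun_prop)) (Filter.Eventually.of_forall fun V => ?_)
  rw [Real.norm_of_nonneg (by positivity)]
  simp only [Pi.add_apply]
  nlinarith [sq_nonneg (V a j ^ 2 - V b j ^ 2), sq_nonneg (V a j ^ 2), sq_nonneg (V b j ^ 2)]

lemma integral_entry_mul_sq_le (a b : Fin k) (j : Fin m) :
    ∫ V, (V a j * V b j) ^ 2 ∂(outputLaw k m) ≤ gaussFourth * (1 / (k : ℝ)) ^ 2 := by
  have h1 := integrable_entry (m := m) (integrable_pow_four_gaussian (1 / (k : ℝ≥0))) a j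
  have h2 := integrable_entry (m := m) (integrable_pow_four_gaussian (1 / (k : ℝ≥0))) b j
  have e : ∀ c : Fin k, ∫ V, V c j ^ 4 ∂(outputLaw k m) = gaussFourth * (1 / (k : ℝ)) ^ 2 := by
    intro c
    rw [integral_entry (fun z => z ^ 4) (by fun_prop), integral_pow_four_gaussian]
    simp
  calc ∫ V, (V a j * V b j) ^ 2 ∂(outputLaw k m)
      ≤ ∫ V, (1 / 2 * V a j ^ 4 + 1 / 2 * V b j ^ 4) ∂(outputLaw k m) := by
        refine integral_mono (integrable_entry_mul_sq a b j)
          ((h1.const_mul _).add (h2.const_mul _)) fun V => ?_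
        simp only
        nlinarith [sq_nonneg (V a j ^ 2 - V b j ^ 2)]
    _ = gaussFourth * (1 / (k : ℝ)) ^ 2 := by
        rw [integral_add (h1.const_mul _) (h2.const_mul _), integral_const_mul,
          integral_const_mul, e, e]
        ring

lemma integral_entry_mul (a b : Fin k) (j : Fin m) :
    ∫ V, V a j * V b j ∂(outputLaw k m) = if a = b then 1 / (k : ℝ) else 0 := by
  split_ifs with h
  · subst h
    simp_rw [← sq]
    rw [integral_entry (fun z => z ^ 2) (by fun_prop), integral_sq_gaussian]
    simp
  · have hind := (iIndepFun_entries (k := k) (m := m)).indepFun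
      (i := (a, j)) (j := (b, j)) (by simpa using h)
    have := hind.integral_mul_eq_mul_integral
      (Measurable.aestronglyMeasurable (by fun_prop)) (Measurable.aestronglyMeasurable (by fun_prop))
    simp only [Pi.mul_apply] at this
    rw [this, integral_entry (fun z => z) measurable_id a j]
    simp

lemma indepFun_entry_mul (a b : Fin k) {j l : Fin m} (h : j ≠ l) :
    IndepFun (fun V : Fin k → Fin m → ℝ => V a j * V b j) (fun V => V a l * V b l)
      (outputLaw k m) :=
  (iIndepFun_entries (k := k) (m := m)).indepFun_mul_mul (fun p => by fun_prop)
    (a, j) (b, j) (a, l) (b, l) (by simp [h]) (by simp [h]) (by simp [h]) (by simp [h])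

end Output

/-! ### Concentration of `∑ⱼ g(wⱼ) vⱼ vⱼᵀ` -/

section Concentration

variable {d m k : ℕ}

/-- The entry `(a, b)` of `g(wⱼ) vⱼ vⱼᵀ`. -/
def neuronEntry (g : (Fin d → ℝ) → ℝ) (a b : Fin k) (j : Fin m)
    (θ : (Fin m → Fin d → ℝ) × (Fin k → Fin m → ℝ)) : ℝ :=
  g (θ.1 j) * (θ.2 a j * θ.2 b j)

variable {g : (Fin d → ℝ) → ℝ}

lemma integrable_comp_row {f : (Fin d → ℝ) → ℝ} (hf : Integrable f (rowLaw d m)) (j : Fin m) :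
    Integrable (fun W : Fin m → Fin d → ℝ => f (W j)) (hiddenLaw d m) :=
  (measurePreserving_eval (fun _ : Fin m => rowLaw d m) j).integrable_comp_of_integrable hf

lemma integral_comp_row {f : (Fin d → ℝ) → ℝ} (hf : Measurable f) (j : Fin m) :
    ∫ W, f (W j) ∂(hiddenLaw d m) = ∫ w, f w ∂(rowLaw d m) := by
  have h := measurePreserving_eval (fun _ : Fin m => rowLaw d m) j
  rw [← h.map_eq, integral_map h.aemeasurable hf.aestronglyMeasurable]

lemma integrable_of_unit {α : Type*} [MeasurableSpace α] {μ : Measure α} [IsFiniteMeasure μ]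
    {f : α → ℝ} (hf : Measurable f) (h01 : ∀ w, f w = 0 ∨ f w = 1) : Integrable f μ :=
  Integrable.of_bound hf.aestronglyMeasurable 1
    (Filter.Eventually.of_forall fun w => by rcases h01 w with h | h <;> simp [h])

lemma memLp_neuronEntry (hg : Measurable g) (h01 : ∀ w, g w = 0 ∨ g w = 1) (a b : Fin k)
    (j : Fin m) : MemLp (neuronEntry g a b j) 2 (initLaw d m k) := by
  have hm : Measurable (neuronEntry (k := k) (m := m) g a b j) := by
    unfold neuronEntry; fun_prop
  rw [memLp_two_iff_integrable_sq hm.aestronglyMeasurable, initLaw_eq]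
  have h1 := integrable_comp_row (m := m) (integrable_of_unit (μ := rowLaw d m) hg h01) j
  refine (h1.mul_prod (integrable_entry_mul_sq a b j)).congr
    (Filter.Eventually.of_forall fun θ => ?_)
  simp only [neuronEntry, mul_pow]
  rcases h01 (θ.1 j) with h | h <;> simp [h]

lemma integral_neuronEntry (hg : Measurable g) (a b : Fin k) (j : Fin m) :
    ∫ θ, neuronEntry g a b j θ ∂(initLaw d m k) =
      (∫ w, g w ∂(rowLaw d m)) * (if a = b then 1 / (k : ℝ) else 0) := by
  rw [initLaw_eq]
  unfold neuronEntry
  rw [integral_prod_mul (fun W : Fin m → Fin d → ℝ => g (W j))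
    (fun V : Fin k → Fin m → ℝ => V a j * V b j), integral_entry_mul, integral_comp_row hg]

/-- Since g² = g, the bound is linear in the mean of `g`. This keeps the relative deviation small
for a rare event such as a preactivation near zero. -/
lemma variance_neuronEntry_le (hg : Measurable g) (h01 : ∀ w, g w = 0 ∨ g w = 1) (a b : Fin k)
    (j : Fin m) : Var[neuronEntry g a b j; initLaw d m k] ≤
      (∫ w, g w ∂(rowLaw d m)) * (gaussFourth * (1 / (k : ℝ)) ^ 2) := by
  have hprob : IsProbabilityMeasure (initLaw d m k) := by rw [initLaw_eq]; infer_instance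
  have hq : 0 ≤ ∫ w, g w ∂(rowLaw d m) :=
    integral_nonneg fun w => by rcases h01 w with h | h <;> simp [h]
  refine (variance_le_expectation_sq (memLp_neuronEntry hg h01 a b j).aestronglyMeasurable).trans ?_
  have e : ∫ θ, (neuronEntry g a b j ^ 2) θ ∂(initLaw d m k) =
      (∫ w, g w ∂(rowLaw d m)) * ∫ V, (V a j * V b j) ^ 2 ∂(outputLaw k m) := by
    rw [initLaw_eq, ← integral_comp_row hg j, ← integral_prod_mul]
    refine integral_congr_ae (Filter.Eventually.of_forall fun θ => ?_)
    simp only [neuronEntry, Pi.pow_apply, mul_pow]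
    rcases h01 (θ.1 j) with h | h <;> simp [h]
  rw [e]
  exact mul_le_mul_of_nonneg_left (integral_entry_mul_sq_le a b j) hq

/-- Distinct neurons use independent rows of `W` and independent columns of `V`, so the mean of the
product factors. -/
lemma covariance_neuronEntry (hg : Measurable g) (h01 : ∀ w, g w = 0 ∨ g w = 1) (a b : Fin k)
    {j l : Fin m} (hjl : j ≠ l) :
    cov[neuronEntry g a b j, neuronEntry g a b l; initLaw d m k] = 0 := by
  have hprob : IsProbabilityMeasure (initLaw d m k) := by rw [initLaw_eq]; infer_instance
  rw [covariance_eq_sub (memLp_neuronEntry hg h01 a b j) (memLp_neuronEntry hg h01 a b l),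
    integral_neuronEntry hg, integral_neuronEntry hg]
  have hrow : IndepFun (fun W : Fin m → Fin d → ℝ => g (W j)) (fun W => g (W l))
      (hiddenLaw d m) :=
    (iIndepFun_pi (μ := fun _ : Fin m => rowLaw d m) (X := fun _ => g)
      (fun _ => hg.aemeasurable)).indepFun hjl
  have e1 := hrow.integral_mul_eq_mul_integral
    (Measurable.aestronglyMeasurable (by fun_prop)) (Measurable.aestronglyMeasurable (by fun_prop))
  have e2 := (indepFun_entry_mul (m := m) a b hjl).integral_mul_eq_mul_integral
    (Measurable.aestronglyMeasurable (by fun_prop)) (Measurable.aestronglyMeasurable (by fun_prop))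
  simp only [Pi.mul_apply] at e1 e2
  have e : ∫ θ, (neuronEntry g a b j * neuronEntry g a b l) θ ∂(initLaw d m k) =
      (∫ W, g (W j) * g (W l) ∂(hiddenLaw d m)) *
        ∫ V, (V a j * V b j) * (V a l * V b l) ∂(outputLaw k m) := by
    rw [initLaw_eq, ← integral_prod_mul]
    refine integral_congr_ae (Filter.Eventually.of_forall fun θ => ?_)
    simp only [neuronEntry, Pi.mul_apply]
    ring
  rw [e, e1, e2, integral_comp_row hg, integral_comp_row hg, integral_entry_mul,
    integral_entry_mul]
  ring

/-- The squared Frobenius distance between `∑ⱼ g(wⱼ) vⱼ vⱼᵀ` and its mean. -/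
def neuronDev (g : (Fin d → ℝ) → ℝ) (θ : (Fin m → Fin d → ℝ) × (Fin k → Fin m → ℝ)) : ℝ :=
  ∑ a, ∑ b, (∑ j, g (θ.1 j) * (θ.2 a j * θ.2 b j) -
    (m : ℝ) / k * (∫ w, g w ∂(rowLaw d m)) * (if a = b then 1 else 0)) ^ 2

lemma measurable_neuronDev (hg : Measurable g) :
    Measurable (neuronDev (k := k) (m := m) g) := by
  unfold neuronDev; fun_prop

/-- Each of the k² entries is a sum of m uncorrelated terms of variance at most q·`gaussFourth`/k².
Hence the expected squared Frobenius deviation is at most `gaussFourth`·m·q, and Markov's inequality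
applies. -/
lemma measureReal_neuronDev_ge_le (hk : 1 ≤ k) (hg : Measurable g)
    (h01 : ∀ w, g w = 0 ∨ g w = 1) {s : ℝ} (hs : 0 < s) :
    (initLaw d m k).real {θ | s ^ 2 ≤ neuronDev g θ} ≤
      gaussFourth * m * (∫ w, g w ∂(rowLaw d m)) / s ^ 2 := by
  have hprob : IsProbabilityMeasure (initLaw d m k) := by rw [initLaw_eq]; infer_instance
  have hk0 : (0 : ℝ) < k := by exact_mod_cast hk
  set q := ∫ w, g w ∂(rowLaw d m) with hqdef
  set S : Fin k → Fin k → (Fin m → Fin d → ℝ) × (Fin k → Fin m → ℝ) → ℝ := fun a b θ =>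
    ∑ j, neuronEntry g a b j θ with hS
  have hSmem : ∀ a b, MemLp (S a b) 2 (initLaw d m k) := fun a b =>
    memLp_finsetSum _ fun j _ => memLp_neuronEntry hg h01 a b j
  have hSmean : ∀ a b, ∫ θ, S a b θ ∂(initLaw d m k) =
      (m : ℝ) / k * q * (if a = b then 1 else 0) := by
    intro a b
    simp only [hS]
    rw [integral_finsetSum _ fun j _ =>
      (memLp_neuronEntry hg h01 a b j).integrable (by norm_num)]
    simp_rw [integral_neuronEntry hg]
    simp only [Finset.sum_const, Finset.card_univ, Fintype.card_fin, nsmul_eq_mul]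
    split_ifs <;> ring
  have hSvar : ∀ a b, Var[S a b; initLaw d m k] ≤ m * (q * (gaussFourth * (1 / (k : ℝ)) ^ 2)) := by
    intro a b
    simp only [hS]
    rw [variance_fun_sum fun j => memLp_neuronEntry hg h01 a b j]
    calc ∑ j : Fin m, ∑ l : Fin m,
          cov[neuronEntry g a b j, neuronEntry g a b l; initLaw d m k]
        = ∑ j : Fin m, Var[neuronEntry g a b j; initLaw d m k] := by
          refine Finset.sum_congr rfl fun j _ => ?_
          rw [Finset.sum_eq_single j]
          · exact covariance_self (memLp_neuronEntry hg h01 a b j).aemeasurable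
          · intro l _ hl
            exact covariance_neuronEntry hg h01 a b hl.symm
          · simp
      _ ≤ ∑ j : Fin m, q * (gaussFourth * (1 / (k : ℝ)) ^ 2) :=
          Finset.sum_le_sum fun j _ => variance_neuronEntry_le hg h01 a b j
      _ = _ := by simp
  have hdevint : ∀ a b, Integrable (fun θ => (S a b θ -
      (m : ℝ) / k * q * (if a = b then 1 else 0)) ^ 2) (initLaw d m k) := fun a b =>
    ((hSmem a b).sub (memLp_const _)).integrable_sq
  have hdev : ∀ a b, ∫ θ, (S a b θ - (m : ℝ) / k * q * (if a = b then 1 else 0)) ^ 2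
      ∂(initLaw d m k) ≤ m * (q * (gaussFourth * (1 / (k : ℝ)) ^ 2)) := by
    intro a b
    rw [← hSmean, ← variance_eq_integral (hSmem a b).aemeasurable]
    exact hSvar a b
  have hnd : neuronDev (k := k) (m := m) g = fun θ => ∑ a, ∑ b, (S a b θ -
      (m : ℝ) / k * q * (if a = b then 1 else 0)) ^ 2 := rfl
  have hint : Integrable (neuronDev (k := k) (m := m) g) (initLaw d m k) := by
    rw [hnd]
    exact integrable_finsetSum _ fun a _ => integrable_finsetSum _ fun b _ => hdevint a b
  have hE : ∫ θ, neuronDev g θ ∂(initLaw d m k) ≤ gaussFourth * m * q := by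
    rw [hnd, integral_finsetSum _ fun a _ => integrable_finsetSum _ fun b _ => hdevint a b]
    simp_rw [integral_finsetSum _ fun b _ => hdevint _ b]
    calc _ ≤ ∑ a : Fin k, ∑ b : Fin k, (m : ℝ) * (q * (gaussFourth * (1 / (k : ℝ)) ^ 2)) :=
          Finset.sum_le_sum fun a _ => Finset.sum_le_sum fun b _ => hdev a b
      _ = gaussFourth * m * q := by
          simp only [Finset.sum_const, Finset.card_univ, Fintype.card_fin, nsmul_eq_mul]
          field_simp
  have hmk := mul_meas_ge_le_integral_of_nonneg
    (Filter.Eventually.of_forall fun θ => (show 0 ≤ neuronDev g θ from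
      Finset.sum_nonneg fun a _ => Finset.sum_nonneg fun b _ => sq_nonneg _)) hint (s ^ 2)
  rw [le_div_iff₀ (by positivity), mul_comm]
  exact hmk.trans hE

/-- The Frobenius norm dominates the operator norm, so one event serves all vectors `u`, `u'` at
once, in particular residuals that depend on the initialization. -/
lemma abs_bilin_le_of_neuronDev {θ : (Fin m → Fin d → ℝ) × (Fin k → Fin m → ℝ)} {s : ℝ}
    (hs : 0 ≤ s) (h : neuronDev g θ ≤ s ^ 2) (u u' : Fin k → ℝ) :
    |∑ j, g (θ.1 j) * ((u ᵥ* Matrix.of θ.2) j * (u' ᵥ* Matrix.of θ.2) j) -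
      (m : ℝ) / k * (∫ w, g w ∂(rowLaw d m)) * ∑ a, u a * u' a| ≤
      s * (√(∑ a, u a ^ 2) * √(∑ a, u' a ^ 2)) := by
  set q := ∫ w, g w ∂(rowLaw d m)
  set D : Fin k → Fin k → ℝ := fun a b => ∑ j, g (θ.1 j) * (θ.2 a j * θ.2 b j) -
    (m : ℝ) / k * q * (if a = b then 1 else 0) with hD
  have e : ∑ j, g (θ.1 j) * ((u ᵥ* Matrix.of θ.2) j * (u' ᵥ* Matrix.of θ.2) j) -
      (m : ℝ) / k * q * ∑ a, u a * u' a = ∑ a, ∑ b, (u a * u' b) * D a b := by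
    have e1 : ∀ j, g (θ.1 j) * ((u ᵥ* Matrix.of θ.2) j * (u' ᵥ* Matrix.of θ.2) j) =
        ∑ a, ∑ b, (u a * u' b) * (g (θ.1 j) * (θ.2 a j * θ.2 b j)) := by
      intro j
      simp only [Matrix.vecMul, dotProduct, Matrix.of_apply]
      rw [Finset.sum_mul_sum, Finset.mul_sum]
      refine Finset.sum_congr rfl fun a _ => ?_
      rw [Finset.mul_sum]
      exact Finset.sum_congr rfl fun b _ => by ring
    have e2 : (m : ℝ) / k * q * ∑ a, u a * u' a =
        ∑ a, ∑ b, (u a * u' b) * ((m : ℝ) / k * q * (if a = b then 1 else 0)) := by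
      rw [Finset.mul_sum]
      refine Finset.sum_congr rfl fun a _ => ?_
      simp
      ring
    simp_rw [e1]
    rw [e2, Finset.sum_comm, ← Finset.sum_sub_distrib]
    refine Finset.sum_congr rfl fun a _ => ?_
    rw [Finset.sum_comm, ← Finset.sum_sub_distrib]
    refine Finset.sum_congr rfl fun b _ => ?_
    rw [← Finset.mul_sum, hD]
    ring
  rw [e]
  have hcs : (∑ a, ∑ b, (u a * u' b) * D a b) ^ 2 ≤
      (∑ a, ∑ b, (u a * u' b) ^ 2) * ∑ a, ∑ b, D a b ^ 2 := by
    have := Finset.sum_mul_sq_le_sq_mul_sq (Finset.univ : Finset (Fin k × Fin k))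
      (fun p => u p.1 * u' p.2) (fun p => D p.1 p.2)
    simpa only [Fintype.sum_prod_type] using this
  have hprod : ∑ a, ∑ b, (u a * u' b) ^ 2 = (∑ a, u a ^ 2) * ∑ b, u' b ^ 2 := by
    rw [Finset.sum_mul_sum]
    exact Finset.sum_congr rfl fun a _ => Finset.sum_congr rfl fun b _ => by ring
  refine abs_le_of_sq_le_sq ?_ (by positivity)
  refine hcs.trans ?_
  rw [hprod, mul_pow, mul_pow, Real.sq_sqrt (Finset.sum_nonneg fun _ _ => sq_nonneg _),
    Real.sq_sqrt (Finset.sum_nonneg fun _ _ => sq_nonneg _), mul_comm]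
  exact mul_le_mul_of_nonneg_right h (mul_nonneg (Finset.sum_nonneg fun _ _ => sq_nonneg _)
    (Finset.sum_nonneg fun _ _ => sq_nonneg _))

end Concentration


/-! ### Tails and small balls -/

lemma measurePreserving_dot {ι : Type*} [Fintype ι] (v : ℝ≥0) (c : ι → ℝ) :
    MeasurePreserving (fun w : ι → ℝ => ∑ a, w a * c a) (Measure.pi fun _ : ι => gaussianReal 0 v)
      (gaussianReal 0 (v * (∑ a, c a ^ 2).toNNReal)) :=
  ⟨by fun_prop, map_dot_pi_gaussian v c⟩

lemma gaussian_smallBall_le (v : ℝ≥0) (hv : v ≠ 0) {ρ : ℝ} (hρ : 0 ≤ ρ) :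
    (gaussianReal 0 v).real {z | |z| ≤ ρ} ≤ 2 * ρ / √(2 * Real.pi * v) := by
  have hset : {z : ℝ | |z| ≤ ρ} = Set.Icc (-ρ) ρ := by ext z; simp [abs_le]
  have hnn : 0 ≤ ∫ z in Set.Icc (-ρ) ρ, gaussianPDFReal 0 v z :=
    integral_nonneg fun z => gaussianPDFReal_nonneg _ _ _
  rw [hset, measureReal_def, gaussianReal_apply_eq_integral _ hv, ENNReal.toReal_ofReal hnn]
  calc ∫ z in Set.Icc (-ρ) ρ, gaussianPDFReal 0 v z
      ≤ ∫ z in Set.Icc (-ρ) ρ, (√(2 * Real.pi * v))⁻¹ := by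
        refine integral_mono (integrable_gaussianPDFReal 0 v).integrableOn
          (integrable_const _) fun z => ?_
        simp only [gaussianPDFReal]
        refine mul_le_of_le_one_right (by positivity) (Real.exp_le_one_iff.2 ?_)
        exact div_nonpos_of_nonpos_of_nonneg (by nlinarith [sq_nonneg (z - 0)]) (by positivity)
    _ = 2 * ρ / √(2 * Real.pi * v) := by
        rw [setIntegral_const, measureReal_def, Real.volume_Icc,
          ENNReal.toReal_ofReal (by linarith), smul_eq_mul]
        ring

/-- Chernoff's bound on either side, at the optimal parameter τ/v. -/
lemma gaussian_tail_le (v : ℝ≥0) (hv : v ≠ 0) {M : ℝ} (hM : 0 ≤ M) :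
    (gaussianReal 0 v).real {z | M * v ≤ z ^ 2} ≤ 2 * Real.exp (-M / 2) := by
  have hv0 : (0 : ℝ) < v := by positivity
  set τ := √(M * v) with hτ
  have hτ2 : τ ^ 2 = M * v := Real.sq_sqrt (by positivity)
  have hτ0 : 0 ≤ τ := Real.sqrt_nonneg _
  have hsub : {z : ℝ | M * v ≤ z ^ 2} ⊆ {z | τ ≤ id z} ∪ {z | id z ≤ -τ} := by
    intro z hz
    have hz' : τ ^ 2 ≤ z ^ 2 := by rw [hτ2]; exact hz
    have := sq_le_sq.1 hz'
    rw [abs_of_nonneg hτ0] at this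
    rcases le_abs.1 this with h | h
    · exact Or.inl h
    · right
      show z ≤ -τ
      linarith
  have hexp : Real.exp (-(τ / v) * τ) * mgf id (gaussianReal 0 v) (τ / v) = Real.exp (-M / 2) := by
    rw [mgf_id_gaussianReal, ← Real.exp_add]
    congr 1
    field_simp
    linear_combination (-1) * hτ2
  have hexp' : Real.exp (-(-(τ / v)) * (-τ)) * mgf id (gaussianReal 0 v) (-(τ / v)) =
      Real.exp (-M / 2) := by
    rw [mgf_id_gaussianReal, ← Real.exp_add]
    congr 1
    field_simp
    linear_combination (-1) * hτ2
  have h1 := measure_ge_le_exp_mul_mgf (X := id) (μ := gaussianReal 0 v) τ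
    (t := τ / v) (by positivity) (integrable_exp_mul_gaussianReal _)
  have h2 := measure_le_le_exp_mul_mgf (X := id) (μ := gaussianReal 0 v) (-τ)
    (t := -(τ / v)) (by simpa using (by positivity : 0 ≤ τ / (v : ℝ)))
    (integrable_exp_mul_gaussianReal _)
  rw [hexp] at h1
  rw [hexp'] at h2
  calc _ ≤ (gaussianReal 0 v).real ({z | τ ≤ id z} ∪ {z | id z ≤ -τ}) := measureReal_mono hsub
    _ ≤ _ := measureReal_union_le _ _
    _ ≤ _ := by linarith

/-! ### The loss at initialization -/

lemma sum_sq_sq_le {ι : Type*} [Fintype ι] (f : ι → ℝ) :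
    (∑ b, f b ^ 2) ^ 2 ≤ Fintype.card ι * ∑ b, f b ^ 4 := by
  have := sq_sum_le_card_mul_sum_sq (s := Finset.univ) (f := fun b => f b ^ 2)
  simpa [← pow_mul] using this

section Loss

variable {n d m k : ℕ}

/-- For fixed activations `s` every output coordinate is Gaussian with variance ‖s‖²/k. The lower
Lebesgue integral lets Tonelli's theorem apply later without an integrability proof. -/
lemma lintegral_output_le (hk : 1 ≤ k) (s : Fin m → ℝ) :
    ∫⁻ V, ENNReal.ofReal ((∑ b, (∑ j, V b j * s j) ^ 2) ^ 2) ∂(outputLaw k m) ≤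
      ENNReal.ofReal (gaussFourth * (∑ j, s j ^ 2) ^ 2) := by
  have hk0 : (0 : ℝ) < k := by exact_mod_cast hk
  have hs0 : 0 ≤ ∑ j, s j ^ 2 := Finset.sum_nonneg fun _ _ => sq_nonneg _
  have hmp : ∀ b : Fin k, MeasurePreserving (fun V : Fin k → Fin m → ℝ => ∑ j, V b j * s j)
      (outputLaw k m) (gaussianReal 0 (1 / (k : ℝ≥0) * (∑ j, s j ^ 2).toNNReal)) := fun b =>
    (measurePreserving_dot (1 / (k : ℝ≥0)) s).comp
      (measurePreserving_eval (fun _ : Fin k =>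
        Measure.pi fun _ : Fin m => gaussianReal 0 (1 / (k : ℝ≥0))) b)
  have hint : ∀ b : Fin k, Integrable (fun V : Fin k → Fin m → ℝ => (∑ j, V b j * s j) ^ 4)
      (outputLaw k m) := fun b =>
    (hmp b).integrable_comp_of_integrable (integrable_pow_four_gaussian _)
  have hval : ∀ b : Fin k, ∫ V, (∑ j, V b j * s j) ^ 4 ∂(outputLaw k m) =
      gaussFourth * (1 / k * ∑ j, s j ^ 2) ^ 2 := by
    intro b
    have h := integral_map (hmp b).aemeasurable (f := fun z : ℝ => z ^ 4)
      (Measurable.aestronglyMeasurable (by fun_prop))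
    rw [(hmp b).map_eq, integral_pow_four_gaussian] at h
    rw [← h]
    simp [Real.coe_toNNReal _ hs0]
  calc _ ≤ ∫⁻ V, ENNReal.ofReal (k * ∑ b, (∑ j, V b j * s j) ^ 4) ∂(outputLaw k m) := by
        refine lintegral_mono fun V => ENNReal.ofReal_le_ofReal ?_
        simpa using sum_sq_sq_le fun b => ∑ j, V b j * s j
    _ = ENNReal.ofReal (∫ V, k * ∑ b, (∑ j, V b j * s j) ^ 4 ∂(outputLaw k m)) := by
        rw [ofReal_integral_eq_lintegral_ofReal
          ((integrable_finsetSum _ fun b _ => hint b).const_mul _)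
          (Filter.Eventually.of_forall fun V => ?_)]
        exact mul_nonneg hk0.le (Finset.sum_nonneg fun b _ => by positivity)
    _ ≤ _ := by
        refine ENNReal.ofReal_le_ofReal (le_of_eq ?_)
        rw [integral_const_mul, integral_finsetSum _ fun b _ => hint b]
        simp_rw [hval]
        simp only [Finset.sum_const, Finset.card_univ, Fintype.card_fin, nsmul_eq_mul]
        field_simp

lemma relu_pow_four_le (z : ℝ) : relu z ^ 4 ≤ z ^ 4 := by
  unfold relu
  rcases le_total z 0 with h | h
  · rw [max_eq_right h, zero_pow (by norm_num)]; positivity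
  · rw [max_eq_left h]

lemma measurable_relu : Measurable relu := measurable_id.max measurable_const

lemma lintegral_network_le (hk : 1 ≤ k) (hm : 1 ≤ m) (z : EuclideanSpace ℝ (Fin d))
    (hz : ‖z‖ = 1) :
    ∫⁻ θ, ENNReal.ofReal ((∑ b, network (Matrix.of θ.2) (Matrix.of θ.1) z b ^ 2) ^ 2)
      ∂(initLaw d m k) ≤ ENNReal.ofReal (4 * gaussFourth ^ 2) := by
  have hm0 : (0 : ℝ) < m := by exact_mod_cast hm
  have hC := gaussFourth_nonneg
  have hzs : ∑ c, z c ^ 2 = 1 := by rw [← EuclideanSpace.real_norm_sq_eq, hz]; norm_num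
  have hnet : ∀ (W : Fin m → Fin d → ℝ) (V : Fin k → Fin m → ℝ) (b : Fin k),
      network (Matrix.of V) (Matrix.of W) z b = ∑ j, V b j * relu (∑ c, W j c * z c) := by
    intro W V b
    rw [network_apply]
    simp [Matrix.mulVec, dotProduct]
  simp_rw [hnet]
  have hmeas : Measurable fun θ : (Fin m → Fin d → ℝ) × (Fin k → Fin m → ℝ) =>
      ENNReal.ofReal ((∑ b, (∑ j, θ.2 b j * relu (∑ c, θ.1 j c * z c)) ^ 2) ^ 2) := by
    have := measurable_relu
    fun_prop
  rw [initLaw_eq, lintegral_prod _ hmeas.aemeasurable]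
  have hmp : ∀ j : Fin m, MeasurePreserving (fun W : Fin m → Fin d → ℝ => ∑ c, W j c * z c)
      (hiddenLaw d m) (gaussianReal 0 (2 / (m : ℝ≥0) * (∑ c, z c ^ 2).toNNReal)) := fun j =>
    (measurePreserving_dot (2 / (m : ℝ≥0)) (fun c => z c)).comp
      (measurePreserving_eval (fun _ : Fin m => rowLaw d m) j)
  have hint : ∀ j : Fin m, Integrable (fun W : Fin m → Fin d → ℝ => (∑ c, W j c * z c) ^ 4)
      (hiddenLaw d m) := fun j =>
    (hmp j).integrable_comp_of_integrable (integrable_pow_four_gaussian _)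
  have hval : ∀ j : Fin m, ∫ W, (∑ c, W j c * z c) ^ 4 ∂(hiddenLaw d m) =
      gaussFourth * (2 / m) ^ 2 := by
    intro j
    have h := integral_map (hmp j).aemeasurable (f := fun z : ℝ => z ^ 4)
      (Measurable.aestronglyMeasurable (by fun_prop))
    rw [(hmp j).map_eq, integral_pow_four_gaussian] at h
    rw [← h, hzs]
    simp
  calc _ ≤ ∫⁻ W, ENNReal.ofReal (gaussFourth * (∑ j, relu (∑ c, W j c * z c) ^ 2) ^ 2)
        ∂(hiddenLaw d m) := lintegral_mono fun W => lintegral_output_le hk _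
    _ ≤ ∫⁻ W, ENNReal.ofReal (gaussFourth * (m * ∑ j, (∑ c, W j c * z c) ^ 4))
        ∂(hiddenLaw d m) := by
        refine lintegral_mono fun W => ENNReal.ofReal_le_ofReal ?_
        refine mul_le_mul_of_nonneg_left ?_ hC
        have h1 := sum_sq_sq_le fun j => relu (∑ c, W j c * z c)
        rw [Fintype.card_fin] at h1
        refine h1.trans ?_
        exact mul_le_mul_of_nonneg_left (Finset.sum_le_sum fun j _ => relu_pow_four_le _) hm0.le
    _ = ENNReal.ofReal (∫ W, gaussFourth * (m * ∑ j, (∑ c, W j c * z c) ^ 4)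
        ∂(hiddenLaw d m)) := by
        rw [ofReal_integral_eq_lintegral_ofReal
          (((integrable_finsetSum _ fun b _ => hint b).const_mul _).const_mul _)
          (Filter.Eventually.of_forall fun V => ?_)]
        exact mul_nonneg hC (mul_nonneg hm0.le (Finset.sum_nonneg fun b _ => by positivity))
    _ ≤ _ := by
        refine ENNReal.ofReal_le_ofReal (le_of_eq ?_)
        rw [integral_const_mul, integral_const_mul, integral_finsetSum _ fun b _ => hint b]
        simp_rw [hval]
        simp only [Finset.sum_const, Finset.card_univ, Fintype.card_fin, nsmul_eq_mul]
        field_simp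
        ring

/-- The sum of the squared outputs of the network at the training inputs. -/
def outputSq (x : Fin n → EuclideanSpace ℝ (Fin d))
    (θ : (Fin m → Fin d → ℝ) × (Fin k → Fin m → ℝ)) : ℝ :=
  ∑ i, ∑ b, network (Matrix.of θ.2) (Matrix.of θ.1) (x i) b ^ 2

lemma measurable_network (z : EuclideanSpace ℝ (Fin d)) (b : Fin k) :
    Measurable fun θ : (Fin m → Fin d → ℝ) × (Fin k → Fin m → ℝ) =>
      network (Matrix.of θ.2) (Matrix.of θ.1) z b := by
  have := measurable_relu
  simp_rw [network_apply, Matrix.mulVec, dotProduct, Matrix.of_apply]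
  fun_prop

lemma measurable_outputSq (x : Fin n → EuclideanSpace ℝ (Fin d)) :
    Measurable (outputSq (m := m) (k := k) x) :=
  Finset.measurable_sum _ fun i _ => Finset.measurable_sum _ fun b _ =>
    (measurable_network (x i) b).pow_const 2

/-- Markov's inequality for the square of the output energy, whose mean is O(n²), at level n³. The
first moment would give failure probability of order n^(-1/2) only. -/
lemma measureReal_outputSq_ge_le (hn : 1 ≤ n) (hk : 1 ≤ k) (hm : 1 ≤ m)
    (x : Fin n → EuclideanSpace ℝ (Fin d)) (hx : ∀ i, ‖x i‖ = 1) :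
    (initLaw d m k).real {θ | n * √n ≤ outputSq x θ} ≤ 4 * gaussFourth ^ 2 / n := by
  have hn0 : (0 : ℝ) < n := by exact_mod_cast hn
  have hprob : IsProbabilityMeasure (initLaw d m k) := by rw [initLaw_eq]; infer_instance
  have hms : ∀ i, Measurable fun θ : (Fin m → Fin d → ℝ) × (Fin k → Fin m → ℝ) =>
      (∑ b, network (Matrix.of θ.2) (Matrix.of θ.1) (x i) b ^ 2) ^ 2 := fun i =>
    (Finset.measurable_sum _ fun b _ => (measurable_network (x i) b).pow_const 2).pow_const 2
  have hL : ∫⁻ θ, ENNReal.ofReal (outputSq x θ ^ 2) ∂(initLaw d m k) ≤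
      ENNReal.ofReal (n ^ 2 * (4 * gaussFourth ^ 2)) := by
    calc _ ≤ ∫⁻ θ, ENNReal.ofReal n * ∑ i, ENNReal.ofReal
          ((∑ b, network (Matrix.of θ.2) (Matrix.of θ.1) (x i) b ^ 2) ^ 2) ∂(initLaw d m k) := by
          refine lintegral_mono fun θ => ?_
          rw [← ENNReal.ofReal_sum_of_nonneg (fun i _ => sq_nonneg _),
            ← ENNReal.ofReal_mul hn0.le]
          refine ENNReal.ofReal_le_ofReal ?_
          have := sq_sum_le_card_mul_sum_sq (s := Finset.univ)
            (f := fun i => ∑ b, network (Matrix.of θ.2) (Matrix.of θ.1) (x i) b ^ 2)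
          simpa [outputSq] using this
      _ = ENNReal.ofReal n * ∑ i, ∫⁻ θ, ENNReal.ofReal
          ((∑ b, network (Matrix.of θ.2) (Matrix.of θ.1) (x i) b ^ 2) ^ 2) ∂(initLaw d m k) := by
          rw [lintegral_const_mul _ (Finset.measurable_sum _ fun i _ => (hms i).ennreal_ofReal),
            lintegral_finsetSum _ fun i _ => (hms i).ennreal_ofReal]
      _ ≤ ENNReal.ofReal n * ∑ i : Fin n, ENNReal.ofReal (4 * gaussFourth ^ 2) := by
          gcongr with i
          exact lintegral_network_le hk hm (x i) (hx i)
      _ = _ := by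
          rw [← ENNReal.ofReal_sum_of_nonneg (fun i _ => by positivity),
            ← ENNReal.ofReal_mul hn0.le]
          congr 1
          simp
          ring
  have hmk := mul_meas_ge_le_lintegral (μ := initLaw d m k)
    ((measurable_outputSq (m := m) (k := k) x).pow_const 2).ennreal_ofReal
    (ENNReal.ofReal (n ^ 3))
  have hsub : {θ | n * √n ≤ outputSq (m := m) (k := k) x θ} ⊆
      {θ | ENNReal.ofReal ((n : ℝ) ^ 3) ≤ ENNReal.ofReal (outputSq x θ ^ 2)} := by
    intro θ hθ
    have hθ' : n * √n ≤ outputSq x θ := hθ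
    show ENNReal.ofReal ((n : ℝ) ^ 3) ≤ ENNReal.ofReal (outputSq x θ ^ 2)
    refine ENNReal.ofReal_le_ofReal ?_
    calc (n : ℝ) ^ 3 = (n * √n) ^ 2 := by rw [mul_pow, Real.sq_sqrt hn0.le]; ring
      _ ≤ _ := by gcongr
  have h3 := hmk.trans hL
  have h4 := ENNReal.toReal_mono ENNReal.ofReal_ne_top h3
  rw [ENNReal.toReal_mul, ENNReal.toReal_ofReal (by positivity),
    ENNReal.toReal_ofReal (by positivity)] at h4
  rw [le_div_iff₀ hn0]
  have h5 : (initLaw d m k).real {θ | n * √n ≤ outputSq x θ} ≤ (initLaw d m k).real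
      {θ | ENNReal.ofReal ((n : ℝ) ^ 3) ≤ ENNReal.ofReal (outputSq x θ ^ 2)} := measureReal_mono hsub
  rw [measureReal_def] at h5 ⊢
  have h6 : (n : ℝ) ^ 2 * (((initLaw d m k) {θ | n * √n ≤ outputSq x θ}).toReal * n) ≤
      n ^ 2 * (4 * gaussFourth ^ 2) := by
    refine le_trans (le_of_eq ?_) ((mul_le_mul_of_nonneg_left h5
      (by positivity : 0 ≤ (n : ℝ) ^ 3)).trans h4)
    ring
  exact le_of_mul_le_mul_left h6 (by positivity)

end Loss


/-! ### Good initializations -/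

section GoodInitialization

variable {n d m k : ℕ}

/-- The indicator of the event that a neuron with weights `w` has preactivation at most `ρ` in
absolute value at the input `z`. -/
def nearZero (ρ : ℝ) (z : EuclideanSpace ℝ (Fin d)) (w : Fin d → ℝ) : ℝ :=
  if |∑ c, w c * z c| ≤ ρ then 1 else 0

/-- The indicator of the event that a neuron with weights `w` is active at both inputs. -/
def bothActive (z z' : EuclideanSpace ℝ (Fin d)) (w : Fin d → ℝ) : ℝ :=
  reluDeriv (∑ c, w c * z c) * reluDeriv (∑ c, w c * z' c)

lemma of_mulVec_apply (W : Fin m → Fin d → ℝ) (z : EuclideanSpace ℝ (Fin d)) (j : Fin m) :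
    (Matrix.of W *ᵥ z.ofLp) j = ∑ c, W j c * z c := by
  simp [Matrix.mulVec, dotProduct]

lemma measurableSet_nearZero (ρ : ℝ) (z : EuclideanSpace ℝ (Fin d)) :
    MeasurableSet {w : Fin d → ℝ | |∑ c, w c * z c| ≤ ρ} :=
  measurableSet_le (by fun_prop) measurable_const

lemma measurable_nearZero (ρ : ℝ) (z : EuclideanSpace ℝ (Fin d)) : Measurable (nearZero ρ z) :=
  Measurable.ite (measurableSet_nearZero ρ z) measurable_const measurable_const

lemma nearZero_eq_zero_or_one (ρ : ℝ) (z : EuclideanSpace ℝ (Fin d)) (w : Fin d → ℝ) :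
    nearZero ρ z w = 0 ∨ nearZero ρ z w = 1 := by
  unfold nearZero; split_ifs <;> simp

lemma measurable_reluDeriv : Measurable reluDeriv :=
  Measurable.ite measurableSet_Ioi measurable_const measurable_const

lemma measurable_bothActive (z z' : EuclideanSpace ℝ (Fin d)) : Measurable (bothActive z z') := by
  have := measurable_reluDeriv
  unfold bothActive
  fun_prop

lemma bothActive_eq_zero_or_one (z z' : EuclideanSpace ℝ (Fin d)) (w : Fin d → ℝ) :
    bothActive z z' w = 0 ∨ bothActive z z' w = 1 := by
  unfold bothActive reluDeriv; split_ifs <;> simp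

lemma integral_nearZero_le (hm : 1 ≤ m) {ρ : ℝ} (hρ : 0 ≤ ρ) (z : EuclideanSpace ℝ (Fin d))
    (hz : ‖z‖ = 1) : ∫ w, nearZero ρ z w ∂(rowLaw d m) ≤ ρ * √m := by
  have hm0 : (0 : ℝ) < m := by exact_mod_cast hm
  have hzs : ∑ c, z c ^ 2 = 1 := by rw [← EuclideanSpace.real_norm_sq_eq, hz]; norm_num
  have hv : (2 / (m : ℝ≥0)) ≠ 0 := by
    have : (m : ℝ≥0) ≠ 0 := by exact_mod_cast (by omega : m ≠ 0)
    positivity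
  have e1 : ∫ w, nearZero ρ z w ∂(rowLaw d m) =
      (rowLaw d m).real {w : Fin d → ℝ | |∑ c, w c * z c| ≤ ρ} := by
    rw [← integral_indicator_one (measurableSet_nearZero ρ z)]
    refine integral_congr_ae (Filter.Eventually.of_forall fun w => ?_)
    simp [nearZero, Set.indicator_apply]
  have hmp := measurePreserving_dot (2 / (m : ℝ≥0)) (fun c => z c)
  rw [hzs, Real.toNNReal_one, mul_one] at hmp
  have e2 : (rowLaw d m).real {w : Fin d → ℝ | |∑ c, w c * z c| ≤ ρ} =
      (gaussianReal 0 (2 / (m : ℝ≥0))).real {t | |t| ≤ ρ} := by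
    rw [measureReal_def, measureReal_def, ← hmp.measure_preimage
      (measurableSet_le (by fun_prop) measurable_const).nullMeasurableSet]
    rfl
  rw [e1, e2]
  refine (gaussian_smallBall_le _ hv hρ).trans ?_
  have hpi := Real.pi_gt_three
  have hsq : 2 / √m ≤ √(2 * Real.pi * ((2 / (m : ℝ≥0) : ℝ≥0) : ℝ)) := by
    refine Real.le_sqrt_of_sq_le ?_
    rw [div_pow, Real.sq_sqrt hm0.le]
    push_cast
    rw [← mul_div_assoc]
    gcongr
    linarith
  have hsm : 0 < √(m : ℝ) := Real.sqrt_pos.2 hm0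
  calc _ ≤ 2 * ρ / (2 / √m) := by gcongr
    _ = ρ * √m := by field_simp

lemma integral_bothActive (hm : 1 ≤ m) (z z' : EuclideanSpace ℝ (Fin d)) (hz : ‖z‖ = 1)
    (hz' : ‖z'‖ = 1) : ∫ w, bothActive z z' w ∂(rowLaw d m) =
      1 / 4 + Real.arcsin (inner ℝ z z') / (2 * Real.pi) := by
  have hv : (2 / (m : ℝ≥0)) ≠ 0 := by
    have : (m : ℝ≥0) ≠ 0 := by exact_mod_cast (by omega : m ≠ 0)
    positivity
  rw [← gaussian_quadrant (2 / (m : ℝ≥0)) hv z z' hz hz',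
    ← integral_indicator_one (measurableSet_pos_and (by fun_prop) (by fun_prop))]
  refine integral_congr_ae (Filter.Eventually.of_forall fun w => ?_)
  by_cases h1 : 0 < ∑ c, w c * z c <;> by_cases h2 : 0 < ∑ c, w c * z' c <;>
    simp [bothActive, reluDeriv, h1, h2]

lemma integral_bothActive_le_one (z z' : EuclideanSpace ℝ (Fin d)) :
    ∫ w, bothActive z z' w ∂(rowLaw d m) ≤ 1 := by
  calc _ ≤ ∫ w, (1 : ℝ) ∂(rowLaw d m) := by
        refine integral_mono_of_nonneg (Filter.Eventually.of_forall fun w => ?_)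
          (integrable_const _) (Filter.Eventually.of_forall fun w => ?_)
        · rcases bothActive_eq_zero_or_one z z' w with h | h <;> simp [h]
        · rcases bothActive_eq_zero_or_one z z' w with h | h <;> simp [h]
    _ = 1 := by simp

/-- The form splits over the output coordinates. In each, the constant 1/4 contributes a Gram form,
which is nonnegative and dropped, and the arcsine part carries the bound. -/
lemma kernel_lower (hm : 1 ≤ m) (x : Fin n → EuclideanSpace ℝ (Fin d)) (hx : ∀ i, ‖x i‖ = 1)
    {δ : ℝ} (hδ : 0 < δ) (hδ1 : δ ≤ 1) (hoff : ∀ i j, i ≠ j → |inner ℝ (x i) (x j)| ≤ 1 - δ)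
    {N : ℕ} (hN : 1 ≤ N) (hNn : n * (1 - δ) ^ N ≤ 1 / 2) (U : Fin n → Fin k → ℝ) :
    1 / (48 * Real.pi * √N) * ∑ i, ∑ b, U i b ^ 2 ≤
      ∑ i, ∑ i', inner ℝ (x i) (x i') *
        ((∫ w, bothActive (x i) (x i') w ∂(rowLaw d m)) * ∑ b, U i b * U i' b) := by
  have hpi := Real.pi_pos
  have hb : ∀ b, 1 / (48 * Real.pi * √N) * ∑ i, U i b ^ 2 ≤
      ∑ i, ∑ i', inner ℝ (x i) (x i') *
        ((∫ w, bothActive (x i) (x i') w ∂(rowLaw d m)) * (U i b * U i' b)) := by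
    intro b
    have h1 := quadForm_gram_pow_nonneg x 1 (fun i => U i b)
    have h2 := quadForm_arcsin_lower x hx δ hδ hδ1 hoff N hN hNn (fun i => U i b)
    have e : ∑ i, ∑ i', inner ℝ (x i) (x i') *
        ((∫ w, bothActive (x i) (x i') w ∂(rowLaw d m)) * (U i b * U i' b)) =
        1 / 4 * (∑ i, ∑ j, U i b * U j b * inner ℝ (x i) (x j) ^ 1) +
        1 / (2 * Real.pi) * ∑ i, ∑ j, U i b * U j b *
          (inner ℝ (x i) (x j) * Real.arcsin (inner ℝ (x i) (x j))) := by
      simp only [Finset.mul_sum]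
      rw [← Finset.sum_add_distrib]
      refine Finset.sum_congr rfl fun i _ => ?_
      rw [← Finset.sum_add_distrib]
      refine Finset.sum_congr rfl fun i' _ => ?_
      rw [integral_bothActive hm _ _ (hx i) (hx i')]
      ring
    rw [e]
    have h3 := mul_le_mul_of_nonneg_left h2 (by positivity : 0 ≤ 1 / (2 * Real.pi))
    have e2 : 1 / (48 * Real.pi * √N) * ∑ i, U i b ^ 2 =
        1 / (2 * Real.pi) * (1 / (24 * √N) * ∑ i, U i b ^ 2) := by
      rw [← mul_assoc]
      congr 1
      field_simp
      norm_num
    rw [e2]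
    linarith
  calc _ = ∑ b, 1 / (48 * Real.pi * √N) * ∑ i, U i b ^ 2 := by
        rw [← Finset.mul_sum, Finset.sum_comm]
    _ ≤ _ := Finset.sum_le_sum fun b _ => hb b
    _ = _ := by
        rw [Finset.sum_comm]
        refine Finset.sum_congr rfl fun i _ => ?_
        rw [Finset.sum_comm]
        refine Finset.sum_congr rfl fun i' _ => ?_
        simp only [Finset.mul_sum]

/-- The first-layer gradient of `∑ᵢ ⟨U i, f(xᵢ)⟩` has squared norm a quadratic form in `U`. -/
lemma sum_sq_grad_eq (x : Fin n → EuclideanSpace ℝ (Fin d))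
    (θ : (Fin m → Fin d → ℝ) × (Fin k → Fin m → ℝ)) (U : Fin n → Fin k → ℝ) :
    ∑ j, ∑ c, (∑ i, (U i ᵥ* Matrix.of θ.2) j *
        reluDeriv ((Matrix.of θ.1 *ᵥ (x i).ofLp) j) * x i c) ^ 2 =
      ∑ i, ∑ i', inner ℝ (x i) (x i') * ∑ j, bothActive (x i) (x i') (θ.1 j) *
        ((U i ᵥ* Matrix.of θ.2) j * (U i' ᵥ* Matrix.of θ.2) j) := by
  have e1 : ∀ j c, (∑ i, (U i ᵥ* Matrix.of θ.2) j *
        reluDeriv ((Matrix.of θ.1 *ᵥ (x i).ofLp) j) * x i c) ^ 2 =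
      ∑ i, ∑ i', (bothActive (x i) (x i') (θ.1 j) *
        ((U i ᵥ* Matrix.of θ.2) j * (U i' ᵥ* Matrix.of θ.2) j)) * (x i' c * x i c) := by
    intro j c
    rw [sq, Finset.sum_mul_sum]
    refine Finset.sum_congr rfl fun i _ => Finset.sum_congr rfl fun i' _ => ?_
    rw [of_mulVec_apply, of_mulVec_apply, bothActive]
    ring
  have e2 : ∀ i i', inner ℝ (x i) (x i') = ∑ c, x i' c * x i c := by
    intro i i'
    simp [PiLp.inner_apply]
  calc _ = ∑ j, ∑ i, ∑ i', (bothActive (x i) (x i') (θ.1 j) *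
        ((U i ᵥ* Matrix.of θ.2) j * (U i' ᵥ* Matrix.of θ.2) j)) * ∑ c, (x i' c * x i c) := by
        refine Finset.sum_congr rfl fun j _ => ?_
        simp_rw [e1, Finset.mul_sum]
        rw [Finset.sum_comm]
        refine Finset.sum_congr rfl fun i _ => ?_
        rw [Finset.sum_comm]
    _ = _ := by
        rw [Finset.sum_comm]
        refine Finset.sum_congr rfl fun i _ => ?_
        rw [Finset.sum_comm]
        refine Finset.sum_congr rfl fun i' _ => ?_
        rw [← Finset.sum_mul, e2, mul_comm]

/-- With a = m/k, each property is the mean plus the allowed deviation: a + a for `op`, aρ√m + aρ√m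
for `small`, and for `lower` the kernel bound 2λa minus λa. The last loss comes from n² blocks, each
off by at most aλ/n, through (∑|z_i|)² ≤ n∑z_i². -/
lemma goodInit_of_neuronDev (hn : 1 ≤ n) (hk : 1 ≤ k) (hm : 1 ≤ m)
    (x : Fin n → EuclideanSpace ℝ (Fin d))
    (hx : ∀ i, ‖x i‖ = 1) {δ : ℝ} (hδ : 0 < δ) (hδ1 : δ ≤ 1)
    (hoff : ∀ i j, i ≠ j → |inner ℝ (x i) (x j)| ≤ 1 - δ)
    {N : ℕ} (hN : 1 ≤ N) (hNn : n * (1 - δ) ^ N ≤ 1 / 2) {ρ M lam : ℝ} (hρ : 0 < ρ)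
    (hlam : 0 < lam) (hlamN : 2 * lam ≤ 1 / (48 * Real.pi * √N))
    {θ : (Fin m → Fin d → ℝ) × (Fin k → Fin m → ℝ)}
    (h1 : neuronDev (fun _ => 1) θ ≤ ((m : ℝ) / k) ^ 2)
    (h2 : ∀ i, neuronDev (nearZero ρ (x i)) θ ≤ ((m : ℝ) / k * (ρ * √m)) ^ 2)
    (h3 : ∀ i i', neuronDev (bothActive (x i) (x i')) θ ≤ ((m : ℝ) / k * (lam / n)) ^ 2)
    (h4 : ∀ b j, θ.2 b j ^ 2 ≤ M * (1 / k)) :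
    GoodInit x (Matrix.of θ.1) (Matrix.of θ.2) ρ (m / k) (2 * (ρ * √m)) M lam := by
  have hn0 : (0 : ℝ) < n := by exact_mod_cast hn
  have hk0 : (0 : ℝ) < k := by exact_mod_cast hk
  have hm0 : (0 : ℝ) < m := by exact_mod_cast hm
  have ha : (0 : ℝ) < m / k := by positivity
  have hU0 : ∀ u : Fin k → ℝ, 0 ≤ ∑ b, u b ^ 2 := fun u =>
    Finset.sum_nonneg fun _ _ => sq_nonneg _
  have hsm : 0 < √(m : ℝ) := Real.sqrt_pos.2 hm0
  refine ⟨fun u => ?_, fun i u => ?_, fun j => ?_, fun U => ?_⟩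
  · have h := (abs_le.1 (abs_bilin_le_of_neuronDev ha.le h1 u u)).2
    rw [Real.mul_self_sqrt (hU0 u)] at h
    simp only [one_mul, integral_const, probReal_univ, smul_eq_mul, ← sq] at h
    linarith
  · have h := (abs_le.1 (abs_bilin_le_of_neuronDev (by positivity) (h2 i) u u)).2
    rw [Real.mul_self_sqrt (hU0 u)] at h
    have e : ∀ j, (if |(Matrix.of θ.1 *ᵥ (x i).ofLp) j| ≤ ρ then (u ᵥ* Matrix.of θ.2) j ^ 2
        else 0) = nearZero ρ (x i) (θ.1 j) *
          ((u ᵥ* Matrix.of θ.2) j * (u ᵥ* Matrix.of θ.2) j) := by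
      intro j
      rw [of_mulVec_apply, nearZero]
      split_ifs
      · ring
      · ring
    simp_rw [e]
    have hq := mul_le_mul_of_nonneg_right (mul_le_mul_of_nonneg_left
      (integral_nearZero_le hm hρ.le (x i) (hx i)) ha.le) (hU0 u)
    simp only [← sq] at h ⊢
    linarith
  · calc ∑ b, Matrix.of θ.2 b j ^ 2 ≤ ∑ b : Fin k, M * (1 / k) :=
          Finset.sum_le_sum fun b _ => h4 b j
      _ = M := by simp; field_simp
  · rw [sum_sq_grad_eq]
    have hK := kernel_lower (m := m) hm x hx hδ hδ1 hoff hN hNn U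
    have hUU : 0 ≤ ∑ i, ∑ b, U i b ^ 2 := Finset.sum_nonneg fun i _ => hU0 (U i)
    set s := (m : ℝ) / k * (lam / n) with hs
    have hs0 : 0 ≤ s := by positivity
    have hterm : ∀ i i', (m : ℝ) / k * (inner ℝ (x i) (x i') *
        ((∫ w, bothActive (x i) (x i') w ∂(rowLaw d m)) * ∑ b, U i b * U i' b)) -
        s * (|√(∑ b, U i b ^ 2)| * |√(∑ b, U i' b ^ 2)|) ≤
        inner ℝ (x i) (x i') * ∑ j, bothActive (x i) (x i') (θ.1 j) *
        ((U i ᵥ* Matrix.of θ.2) j * (U i' ᵥ* Matrix.of θ.2) j) := by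
      intro i i'
      have hb := abs_bilin_le_of_neuronDev hs0 (h3 i i') (U i) (U i')
      rw [abs_of_nonneg (Real.sqrt_nonneg _), abs_of_nonneg (Real.sqrt_nonneg _)]
      have hin : |inner ℝ (x i) (x i')| ≤ 1 := by
        have := abs_real_inner_le_norm (x i) (x i')
        rwa [hx, hx, mul_one] at this
      have hmul := mul_le_mul hin hb (abs_nonneg _) zero_le_one
      rw [← abs_mul, one_mul] at hmul
      have := (abs_le.1 hmul).1
      rw [mul_sub] at this
      linarith
    refine le_trans ?_ (Finset.sum_le_sum fun i _ => Finset.sum_le_sum fun i' _ => hterm i i')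
    simp only [Finset.sum_sub_distrib, ← Finset.mul_sum]
    have hcs := sum_abs_sq_le (fun i => √(∑ b, U i b ^ 2))
    simp only [Real.sq_sqrt (hU0 _)] at hcs
    simp only [← Finset.mul_sum] at hcs
    have hA := mul_le_mul_of_nonneg_left hcs hs0
    have hB := mul_le_mul_of_nonneg_left hK ha.le
    have hC := mul_le_mul_of_nonneg_left (mul_le_mul_of_nonneg_right hlamN hUU) ha.le
    have hsn : s * (n * ∑ i, ∑ b, U i b ^ 2) = m / k * (lam * ∑ i, ∑ b, U i b ^ 2) := by
      rw [hs]; field_simp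
    linarith

end GoodInitialization


/-! ### Probability of a good initialization and size of the initial loss -/

section GoodEvent

variable {n d m k : ℕ}

lemma measureReal_entry_ge_le (hk : 1 ≤ k) {M : ℝ} (hM : 0 ≤ M) (b : Fin k) (j : Fin m) :
    (initLaw d m k).real {θ | M * (1 / k) ≤ θ.2 b j ^ 2} ≤ 2 * Real.exp (-M / 2) := by
  have hv : (1 / (k : ℝ≥0)) ≠ 0 := by
    have : (k : ℝ≥0) ≠ 0 := by exact_mod_cast (by omega : k ≠ 0)
    positivity
  have hmp : MeasurePreserving (fun θ : (Fin m → Fin d → ℝ) × (Fin k → Fin m → ℝ) => θ.2 b j)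
      (initLaw d m k) (gaussianReal 0 (1 / (k : ℝ≥0))) := by
    rw [initLaw_eq]
    exact (measurePreserving_entry b j).comp measurePreserving_snd
  refine le_trans (le_of_eq ?_) (gaussian_tail_le _ hv hM)
  rw [measureReal_def, measureReal_def, ← hmp.measure_preimage
    (measurableSet_le measurable_const (by fun_prop)).nullMeasurableSet]
  simp

/-- A union bound. The five terms belong to the operator norm of `V`, the near-zero neurons at each
input, the kernel block of each pair of inputs, the entries of `V`, and the output energy. -/
lemma exists_goodInit_event (hn : 1 ≤ n) (hk : 1 ≤ k) (hm : 1 ≤ m)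
    (x : Fin n → EuclideanSpace ℝ (Fin d))
    (hx : ∀ i, ‖x i‖ = 1) {δ : ℝ} (hδ : 0 < δ) (hδ1 : δ ≤ 1)
    (hoff : ∀ i j, i ≠ j → |inner ℝ (x i) (x j)| ≤ 1 - δ)
    {N : ℕ} (hN : 1 ≤ N) (hNn : n * (1 - δ) ^ N ≤ 1 / 2) {ρ M lam : ℝ} (hρ : 0 < ρ)
    (hM : 0 ≤ M) (hlam : 0 < lam) (hlamN : 2 * lam ≤ 1 / (48 * Real.pi * √N)) :
    ∃ G : Set ((Fin m → Fin d → ℝ) × (Fin k → Fin m → ℝ)), MeasurableSet G ∧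
      1 - (gaussFourth * k ^ 2 / m + n * (gaussFourth * k ^ 2 / (m * (ρ * √m))) +
        n ^ 4 * (gaussFourth * k ^ 2 / (m * lam ^ 2)) + 2 * k * m * Real.exp (-M / 2) +
        4 * gaussFourth ^ 2 / n) ≤ (initLaw d m k).real G ∧
      ∀ θ ∈ G, GoodInit x (Matrix.of θ.1) (Matrix.of θ.2) ρ (m / k) (2 * (ρ * √m)) M lam ∧
        outputSq x θ ≤ n * √n := by
  have hn0 : (0 : ℝ) < n := by exact_mod_cast hn
  have hk0 : (0 : ℝ) < k := by exact_mod_cast hk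
  have hm0 : (0 : ℝ) < m := by exact_mod_cast hm
  have hsm : 0 < √(m : ℝ) := Real.sqrt_pos.2 hm0
  have hC := gaussFourth_nonneg
  have hprob : IsProbabilityMeasure (initLaw d m k) := by rw [initLaw_eq]; infer_instance
  set P := (initLaw d m k) with hP
  set E1 : Set ((Fin m → Fin d → ℝ) × (Fin k → Fin m → ℝ)) :=
    {θ | ((m : ℝ) / k) ^ 2 ≤ neuronDev (fun _ => 1) θ} with hE1
  set E2 : Fin n → Set ((Fin m → Fin d → ℝ) × (Fin k → Fin m → ℝ)) := fun i =>
    {θ | ((m : ℝ) / k * (ρ * √m)) ^ 2 ≤ neuronDev (nearZero ρ (x i)) θ} with hE2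
  set E3 : Fin n × Fin n → Set ((Fin m → Fin d → ℝ) × (Fin k → Fin m → ℝ)) := fun p =>
    {θ | ((m : ℝ) / k * (lam / n)) ^ 2 ≤ neuronDev (bothActive (x p.1) (x p.2)) θ} with hE3
  set E4 : Fin k × Fin m → Set ((Fin m → Fin d → ℝ) × (Fin k → Fin m → ℝ)) := fun p =>
    {θ | M * (1 / k) ≤ θ.2 p.1 p.2 ^ 2} with hE4
  set E5 : Set ((Fin m → Fin d → ℝ) × (Fin k → Fin m → ℝ)) :=
    {θ | n * √n ≤ outputSq x θ} with hE5
  set E := E1 ∪ (⋃ i, E2 i) ∪ (⋃ p, E3 p) ∪ (⋃ p, E4 p) ∪ E5 with hE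
  have hmE : MeasurableSet E := by
    refine ((((?_ : MeasurableSet E1).union (MeasurableSet.iUnion fun i => ?_)).union
      (MeasurableSet.iUnion fun p => ?_)).union (MeasurableSet.iUnion fun p => ?_)).union ?_
    · exact measurableSet_le measurable_const (measurable_neuronDev measurable_const)
    · exact measurableSet_le measurable_const (measurable_neuronDev (measurable_nearZero _ _))
    · exact measurableSet_le measurable_const (measurable_neuronDev (measurable_bothActive _ _))
    · exact measurableSet_le measurable_const (by fun_prop)
    · exact measurableSet_le measurable_const (measurable_outputSq x)
  have b1 : P.real E1 ≤ gaussFourth * k ^ 2 / m := by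
    refine (measureReal_neuronDev_ge_le hk measurable_const (fun _ => Or.inr rfl)
      (by positivity : 0 < (m : ℝ) / k)).trans (le_of_eq ?_)
    simp only [integral_const, probReal_univ, smul_eq_mul]
    field_simp
  have b2 : ∀ i, P.real (E2 i) ≤ gaussFourth * k ^ 2 / (m * (ρ * √m)) := by
    intro i
    refine (measureReal_neuronDev_ge_le hk (measurable_nearZero _ _)
      (nearZero_eq_zero_or_one _ _) (by positivity : 0 < (m : ℝ) / k * (ρ * √m))).trans ?_
    have hq := integral_nearZero_le hm hρ.le (x i) (hx i)
    calc _ ≤ gaussFourth * m * (ρ * √m) / ((m : ℝ) / k * (ρ * √m)) ^ 2 :=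
          div_le_div_of_nonneg_right (mul_le_mul_of_nonneg_left hq (by positivity)) (by positivity)
      _ = _ := by
          generalize ρ * √m = p at *
          field_simp
  have b3 : ∀ p, P.real (E3 p) ≤ n ^ 2 * (gaussFourth * k ^ 2 / (m * lam ^ 2)) := by
    intro p
    refine (measureReal_neuronDev_ge_le hk (measurable_bothActive _ _)
      (bothActive_eq_zero_or_one _ _) (by positivity : 0 < (m : ℝ) / k * (lam / n))).trans ?_
    have hq := integral_bothActive_le_one (m := m) (x p.1) (x p.2)
    calc _ ≤ gaussFourth * m * 1 / ((m : ℝ) / k * (lam / n)) ^ 2 :=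
          div_le_div_of_nonneg_right (mul_le_mul_of_nonneg_left hq (by positivity)) (by positivity)
      _ = _ := by field_simp
  have b4 : ∀ p, P.real (E4 p) ≤ 2 * Real.exp (-M / 2) := fun p =>
    measureReal_entry_ge_le hk hM p.1 p.2
  have b5 : P.real E5 ≤ 4 * gaussFourth ^ 2 / n := measureReal_outputSq_ge_le hn hk hm x hx
  have s2 : P.real (⋃ i, E2 i) ≤ n * (gaussFourth * k ^ 2 / (m * (ρ * √m))) := by
    refine (measureReal_iUnion_fintype_le _).trans ((Finset.sum_le_sum fun i _ => b2 i).trans ?_)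
    simp
  have s3 : P.real (⋃ p, E3 p) ≤ n ^ 4 * (gaussFourth * k ^ 2 / (m * lam ^ 2)) := by
    refine (measureReal_iUnion_fintype_le _).trans ((Finset.sum_le_sum fun i _ => b3 i).trans ?_)
    rw [Finset.sum_const, nsmul_eq_mul, Finset.card_univ, Fintype.card_prod, Fintype.card_fin]
    push_cast
    exact le_of_eq (by ring)
  have s4 : P.real (⋃ p, E4 p) ≤ 2 * k * m * Real.exp (-M / 2) := by
    refine (measureReal_iUnion_fintype_le _).trans ((Finset.sum_le_sum fun i _ => b4 i).trans ?_)
    rw [Finset.sum_const, nsmul_eq_mul, Finset.card_univ, Fintype.card_prod, Fintype.card_fin,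
      Fintype.card_fin]
    push_cast
    exact le_of_eq (by ring)
  have hEle : P.real E ≤ _ := ((((measureReal_union_le _ _).trans (add_le_add_left
    ((measureReal_union_le _ _).trans (add_le_add_left ((measureReal_union_le _ _).trans
      (add_le_add_left (measureReal_union_le _ _) _)) _)) _))))
  refine ⟨Eᶜ, hmE.compl, ?_, fun θ hθ => ?_⟩
  · rw [probReal_compl_eq_one_sub hmE]
    linarith
  · simp only [hE, Set.mem_compl_iff, Set.mem_union, Set.mem_iUnion, not_or, not_exists] at hθ
    obtain ⟨⟨⟨⟨h1, h2⟩, h3⟩, h4⟩, h5⟩ := hθ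
    refine ⟨goodInit_of_neuronDev hn hk hm x hx hδ hδ1 hoff hN hNn hρ hlam hlamN
      (not_le.1 h1).le (fun i => (not_le.1 (h2 i)).le) (fun i i' => (not_le.1 (h3 (i, i'))).le)
      (fun b j => (not_le.1 (h4 (b, j))).le), (not_le.1 h5).le⟩

lemma totalLoss_le_outputSq (x : Fin n → EuclideanSpace ℝ (Fin d))
    (y : Fin n → EuclideanSpace ℝ (Fin k)) {Y : ℝ} (hy : ∀ i, ‖y i‖ ≤ Y)
    (θ : (Fin m → Fin d → ℝ) × (Fin k → Fin m → ℝ)) :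
    totalLoss x y (Matrix.of θ.2) (Matrix.of θ.1) ≤ outputSq x θ + n * Y ^ 2 := by
  have hi : ∀ i, exampleLoss (Matrix.of θ.2) (x i) (y i) (Matrix.of θ.1) ≤
      ∑ b, network (Matrix.of θ.2) (Matrix.of θ.1) (x i) b ^ 2 + Y ^ 2 := by
    intro i
    rw [exampleLoss, ← EuclideanSpace.real_norm_sq_eq]
    have h1 := norm_sub_le (network (Matrix.of θ.2) (Matrix.of θ.1) (x i)) (y i)
    have h2 := hy i
    have h3 := norm_nonneg (network (Matrix.of θ.2) (Matrix.of θ.1) (x i) - y i)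
    have h4 := norm_nonneg (y i)
    nlinarith [sq_nonneg (‖network (Matrix.of θ.2) (Matrix.of θ.1) (x i)‖ - ‖y i‖)]
  calc _ ≤ ∑ i, (∑ b, network (Matrix.of θ.2) (Matrix.of θ.1) (x i) b ^ 2 + Y ^ 2) :=
        Finset.sum_le_sum fun i _ => hi i
    _ = _ := by rw [Finset.sum_add_distrib]; simp [outputSq]

end GoodEvent


/-! ### The choice of the parameters -/

section Parameters

variable {n d m k : ℕ}

/-- Expanding ‖x ∓ x'‖² = 2 ∓ 2⟨x, x'⟩ even gives the denominator 2; with 4 the gap is at most 1 as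
soon as φ ≤ 2. -/
lemma abs_inner_le_of_separated {x x' : EuclideanSpace ℝ (Fin d)} (hx : ‖x‖ = 1) (hx' : ‖x'‖ = 1)
    {φ μ ν : ℝ} (hφ : 0 < φ) (hν : 0 < ν) (hν1 : ν ≤ 1) (hνμ : ν ≤ μ) (h1 : φ ≤ ‖x - x'‖)
    (h2 : μ * φ ≤ ‖x + x'‖) : |inner ℝ x x'| ≤ 1 - ν ^ 2 * φ ^ 2 / 4 := by
  have e1 := norm_sub_sq_real x x'
  have e2 := norm_add_sq_real x x'
  rw [hx, hx'] at e1 e2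
  have h3 : ν * φ ≤ ‖x - x'‖ := le_trans (by nlinarith) h1
  have h4 : ν * φ ≤ ‖x + x'‖ := le_trans (mul_le_mul_of_nonneg_right hνμ hφ.le) h2
  have h5 : (ν * φ) ^ 2 ≤ ‖x - x'‖ ^ 2 := by gcongr
  have h6 : (ν * φ) ^ 2 ≤ ‖x + x'‖ ^ 2 := by gcongr
  have h7 : 0 ≤ ν ^ 2 * φ ^ 2 := by positivity
  rw [mul_pow] at h5 h6
  rw [abs_le]
  constructor <;> linarith

lemma exists_pow_le {δ : ℝ} (hn : 2 ≤ n) (hδ : 0 < δ) (hδ1 : δ ≤ 1) :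
    ∃ N : ℕ, 1 ≤ N ∧ n * (1 - δ) ^ N ≤ 1 / 2 ∧ N ≤ 2 * Real.log (2 * n) / δ := by
  have hn2 : (2 : ℝ) ≤ n := by exact_mod_cast hn
  have hlog : 1 ≤ Real.log (2 * n) := by
    have h1 : Real.log (2 * 2) ≤ Real.log (2 * n) := Real.log_le_log (by norm_num) (by linarith)
    have h2 := Real.log_two_gt_d9
    rw [Real.log_mul (by norm_num) (by norm_num)] at h1
    linarith
  have hq : 1 ≤ Real.log (2 * n) / δ := by rw [le_div_iff₀ hδ]; linarith
  -- Then (1-δ)^N ≤ exp(-δN) ≤ 1/(2n), and rounding up at most doubles a number that is at least 1.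
  refine ⟨⌈Real.log (2 * n) / δ⌉₊, Nat.ceil_pos.2 (by linarith), ?_, ?_⟩
  · have h1 : (1 - δ) ^ ⌈Real.log (2 * n) / δ⌉₊ ≤
        Real.exp (-δ) ^ ⌈Real.log (2 * n) / δ⌉₊ := by
      refine pow_le_pow_left₀ (by linarith) ?_ _
      have := Real.add_one_le_exp (-δ)
      linarith
    have h2 : Real.exp (-δ) ^ ⌈Real.log (2 * n) / δ⌉₊ ≤ (2 * (n : ℝ))⁻¹ := by
      rw [← Real.exp_nat_mul, ← Real.exp_log (by linarith : (0 : ℝ) < 2 * n), ← Real.exp_neg,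
        Real.exp_log (by linarith : (0 : ℝ) < 2 * n)]
      refine Real.exp_le_exp.2 ?_
      have := Nat.le_ceil (Real.log (2 * n) / δ)
      rw [div_le_iff₀ hδ] at this
      linarith
    calc n * (1 - δ) ^ ⌈Real.log (2 * n) / δ⌉₊ ≤ n * (2 * (n : ℝ))⁻¹ :=
          mul_le_mul_of_nonneg_left (h1.trans h2) (by linarith)
      _ = 1 / 2 := by field_simp
  · have := (Nat.ceil_lt_add_one (by linarith : 0 ≤ Real.log (2 * n) / δ)).le
    rw [mul_div_assoc]
    linarith

/-- Here r is a power of n standing in for √log n: log(2n) = 8 log(r²) ≤ 8r². Hence √N ≤ 8r/(νφ),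
and 3000 exceeds 2·48·3.15·8. -/
lemma le_inv_sqrt_of_le {N : ℕ} {r ν φ : ℝ} (hN : 1 ≤ N) (hr : 1 ≤ r) (hrn : r ^ 16 = 2 * n)
    (hν : 0 < ν) (hφ : 0 < φ) (h : N ≤ 2 * Real.log (2 * n) / (ν ^ 2 * φ ^ 2 / 4)) :
    2 * (ν * φ / (3000 * r)) ≤ 1 / (48 * Real.pi * √N) := by
  have hN0 : (0 : ℝ) < N := by exact_mod_cast hN
  have hsN : 0 < √(N : ℝ) := Real.sqrt_pos.2 hN0
  have hpi := Real.pi_lt_d2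
  have hpi0 := Real.pi_pos
  have hlog : Real.log (2 * n) ≤ 8 * r ^ 2 := by
    rw [← hrn, show r ^ 16 = (r ^ 2) ^ 8 by ring, Real.log_pow]
    have := Real.log_le_sub_one_of_pos (by positivity : 0 < r ^ 2)
    push_cast
    linarith
  have hs : √(N : ℝ) ≤ 8 * r / (ν * φ) := by
    refine Real.sqrt_le_iff.2 ⟨by positivity, h.trans ?_⟩
    rw [div_pow, div_le_div_iff₀ (by positivity) (by positivity)]
    have := mul_le_mul_of_nonneg_right hlog (by positivity : 0 ≤ (ν * φ) ^ 2)
    nlinarith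
  rw [le_div_iff₀ (by positivity)]
  calc 2 * (ν * φ / (3000 * r)) * (48 * Real.pi * √N)
      ≤ 2 * (ν * φ / (3000 * r)) * (48 * 3.15 * (8 * r / (ν * φ))) := by gcongr
    _ = 2 * 48 * 3.15 * 8 / 3000 := by field_simp
    _ ≤ 1 := by norm_num

lemma sqrt_mul_pow_eight_le {r : ℝ} (hrn : r ^ 16 = 2 * n) : √n * r ^ 8 ≤ 2 * n := by
  have hn0 : (0 : ℝ) ≤ n := by positivity
  refine abs_le_of_sq_le_sq' ?_ (by positivity) |>.2
  rw [mul_pow, Real.sq_sqrt hn0, ← pow_mul, hrn]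
  nlinarith [sq_nonneg (n : ℝ)]

/-- The factor by which the width must exceed `log m * n ^ (19 / 2) * k ^ 2 / λ ^ 8`, where `λ` bounds
the least eigenvalue of the kernel from below. -/
def widthConst : ℝ := 24 * 512 * 4096 ^ 2 * 2048

/-- The width hypothesis in terms of the least eigenvalue. -/
lemma width_key {B : ℕ} {r ν φ : ℝ} (hB : 1 ≤ B) (hBn : B ≤ n) (hk : 1 ≤ k) (hm : 2 ≤ m)
    (hr : 1 ≤ r) (hrn : r ^ 16 = 2 * n) (hν : 0 < ν) (hφ : 0 < φ)
    (hw : 8 * widthConst * 3000 ^ 8 / ν ^ 8 * ((k : ℝ) ^ ((5 : ℝ) / 2) * (n : ℝ) ^ 11 *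
      Real.log m ^ 3 / (φ ^ 8 * B)) ≤ m) :
    widthConst * (Real.log m * n ^ 9 * √n * k ^ 2) ≤ m * (ν * φ / (3000 * r)) ^ 8 := by
  have hC : 0 < widthConst := by unfold widthConst; norm_num
  have hk1 : (1 : ℝ) ≤ k := by exact_mod_cast hk
  have hB1 : (1 : ℝ) ≤ B := by exact_mod_cast hB
  have hBn' : (B : ℝ) ≤ n := by exact_mod_cast hBn
  have hn1 : (1 : ℝ) ≤ n := hB1.trans hBn'
  have hlog : 1 / 2 ≤ Real.log m := by
    have h1 : Real.log 2 ≤ Real.log m := Real.log_le_log (by norm_num) (by exact_mod_cast hm)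
    have h2 := Real.log_two_gt_d9
    linarith
  have hk2 : (k : ℝ) ^ 2 ≤ (k : ℝ) ^ ((5 : ℝ) / 2) := by
    rw [← Real.rpow_natCast]
    exact Real.rpow_le_rpow_of_exponent_le hk1 (by norm_num)
  -- The width hypothesis has room to spare: √k, n/B and log²m are discarded, using log m ≥ 1/2 for
  -- the last.
  have h1 : (k : ℝ) ^ 2 * n ^ 10 * (Real.log m / 4) / φ ^ 8 ≤
      (k : ℝ) ^ ((5 : ℝ) / 2) * (n : ℝ) ^ 11 * Real.log m ^ 3 / (φ ^ 8 * B) := by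
    rw [div_le_div_iff₀ (by positivity) (by positivity)]
    have e1 : Real.log m / 4 ≤ Real.log m ^ 3 := by nlinarith [sq_nonneg (Real.log m)]
    have e2 : (k : ℝ) ^ 2 * n ^ 10 * (Real.log m / 4) * B ≤
        (k : ℝ) ^ ((5 : ℝ) / 2) * n ^ 10 * Real.log m ^ 3 * n := by gcongr
    calc _ = (k : ℝ) ^ 2 * n ^ 10 * (Real.log m / 4) * B * φ ^ 8 := by ring
      _ ≤ (k : ℝ) ^ ((5 : ℝ) / 2) * n ^ 10 * Real.log m ^ 3 * n * φ ^ 8 := by gcongr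
      _ = _ := by ring
  have h2 : 8 * widthConst * 3000 ^ 8 / ν ^ 8 *
      ((k : ℝ) ^ 2 * n ^ 10 * (Real.log m / 4) / φ ^ 8) ≤ m :=
    le_trans (mul_le_mul_of_nonneg_left h1 (by positivity)) hw
  have h3 := sqrt_mul_pow_eight_le hrn
  calc widthConst * (Real.log m * n ^ 9 * √n * k ^ 2)
      -- The eighth power of λ brings in r⁸ = √(2n), which combines with √n into at most 2n. This is
      -- why r is a sixteenth root.
      = widthConst * (Real.log m * n ^ 9 * (√n * r ^ 8) * k ^ 2) / r ^ 8 := by field_simp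
    _ ≤ widthConst * (Real.log m * n ^ 9 * (2 * n) * k ^ 2) / r ^ 8 := by
        have : 0 ≤ Real.log m := by linarith
        gcongr
    _ = 8 * widthConst * 3000 ^ 8 / ν ^ 8 *
      ((k : ℝ) ^ 2 * n ^ 10 * (Real.log m / 4) / φ ^ 8) * (ν * φ / (3000 * r)) ^ 8 := by
        field_simp
        ring
    _ ≤ _ := by gcongr

end Parameters

/-! ### Convergence from a good initialization -/

section Convergence

variable {n d m k : ℕ} {x : Fin n → EuclideanSpace ℝ (Fin d)} {y : Fin n → EuclideanSpace ℝ (Fin k)}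
  {W0 : Matrix (Fin m) (Fin d) ℝ} {V : Matrix (Fin k) (Fin m) ℝ} {ρ a κ M lam η : ℝ} {B : ℕ}

lemma GoodInit.exists_event (h : GoodInit x W0 V ρ a κ M lam) (hx : ∀ i, ‖x i‖ = 1)
    (ha : 0 < a) (hρ : 0 < ρ) (hlam : 0 < lam) (hlam1 : lam ≤ 1) (hM : 0 ≤ M) (hB : 1 ≤ B)
    (hBn : B ≤ n) (hη : 0 < η) (hηa : η * a ≤ lam / (32 * n))
    (hκ : κ * a + M * (4 * (512 * n ^ 3 * √n / (a * lam ^ 2))) / ρ ^ 2 ≤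
      lam ^ 2 / (1024 * n ^ 2) * a)
    (h0 : totalLoss x y V W0 ≤ 2 * n * √n) :
    ∃ A : Set (ℕ → Finset (Fin n)), MeasurableSet A ∧
      1 - 1 / (n : ℝ) ≤ (minibatchSeqLaw n B hBn).real A ∧
      ∀ T, ∫ b in A, totalLoss x y V (sgd x y B η V W0 b T) ∂(minibatchSeqLaw n B hBn) ≤
        (1 - η * a * lam / (4 * n)) ^ T * totalLoss x y V W0 := by
  have hn1 : (1 : ℝ) ≤ n := by exact_mod_cast hB.trans hBn
  have hsn : 0 < √(n : ℝ) := Real.sqrt_pos.2 (by linarith)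
  have hηa1 : η * a ≤ 1 := hηa.trans (by
    rw [div_le_one (by positivity)]; linarith)
  have hR2 : 0 < 512 * n ^ 3 * √n / (a * lam ^ 2) := by positivity
  have hγ : 0 < η * a * lam / (4 * n) := by positivity
  have hγ1 : η * a * lam / (4 * n) < 1 := by
    rw [div_lt_one (by positivity)]
    have := mul_le_mul hηa1 hlam1 hlam.le zero_le_one
    linarith
  have hR : 16 * η ^ 2 * a * totalLoss x y V W0 ≤ 512 * n ^ 3 * √n / (a * lam ^ 2) := by
    rw [le_div_iff₀ (by positivity)]
    have e1 : (η * a) ^ 2 ≤ 1 := pow_le_one₀ (by positivity) hηa1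
    have e2 : lam ^ 2 ≤ 1 := pow_le_one₀ hlam.le hlam1
    have e3 : totalLoss x y V W0 ≤ 2 * n ^ 3 * √n := h0.trans (by
      have : (n : ℝ) ≤ n ^ 3 := le_self_pow₀ hn1 (by norm_num)
      gcongr)
    calc 16 * η ^ 2 * a * totalLoss x y V W0 * (a * lam ^ 2)
        = 16 * ((η * a) ^ 2 * lam ^ 2 * totalLoss x y V W0) := by ring
      _ ≤ 16 * (1 * 1 * (2 * n ^ 3 * √n)) := by
          have := totalLoss_nonneg (x := x) (y := y) (V := V) W0
          gcongr
      _ ≤ _ := by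
          have : 0 ≤ (n : ℝ) ^ 3 * √n := by positivity
          linarith
  obtain ⟨A, hA, hPA, hT⟩ := exists_stay_event (x := x) (y := y) (V := V) (W0 := W0) (η := η)
    (B := B) hBn hR2 hγ hγ1 (D := η ^ 2 * (4 * a) / n) (by positivity)
    (fun W hW => h.integral_totalLoss_sgdStep_le ha.le hx hρ hlam hlam1 hM hB hBn hη hκ le_rfl
      hηa hR W hW)
    (fun W => h.integral_normSq_sgdStep_sub_le hx hB hBn η W)
  refine ⟨A, hA, le_trans ?_ hPA, hT⟩
  refine sub_le_sub_left ?_ 1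
  -- The radius was chosen to make the exit probability exactly 1/n for an initial loss of 2n√n:
  -- 4·4·2·16 = 512. The step size cancels.
  calc _ ≤ 4 * (η ^ 2 * (4 * a) / n) * (2 * n * √n) /
        ((η * a * lam / (4 * n)) ^ 2 * (512 * n ^ 3 * √n / (a * lam ^ 2))) := by gcongr
    _ = 1 / n := by
        field_simp
        norm_num

/-- The decay factor after sufficiently many steps beats the loss at initialization. -/
lemma decay_le {s γ ε : ℝ} {T : ℕ} (hs : 1 ≤ s) (hγ1 : γ ≤ 1) (hε : 0 < ε) (hε2 : ε ≤ 1 / 2)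
    (hT : 9 * s * Real.log (1 / ε) ≤ γ * T) : (1 - γ) ^ T * (4 * s) ≤ ε := by
  have hℓ : 1 / 2 ≤ Real.log (1 / ε) := by
    have h1 : Real.log 2 ≤ Real.log (1 / ε) := Real.log_le_log (by norm_num) (by
      rw [le_div_iff₀ hε]; linarith)
    have h2 := Real.log_two_gt_d9
    linarith
  have hpow : (1 - γ) ^ T ≤ Real.exp (-(γ * T)) := by
    have h1 : (1 - γ) ^ T ≤ Real.exp (-γ) ^ T := by
      refine pow_le_pow_left₀ (by linarith) ?_ _
      have := Real.add_one_le_exp (-γ)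
      linarith
    rw [← Real.exp_nat_mul] at h1
    refine h1.trans (le_of_eq ?_)
    congr 1
    ring
  have hexp : Real.exp (-(γ * T)) ≤ Real.exp (-(4 * s)) * ε := by
    have : ε = Real.exp (-Real.log (1 / ε)) := by
      rw [one_div, Real.log_inv, neg_neg, Real.exp_log hε]
    nth_rewrite 1 [this]
    rw [← Real.exp_add]
    refine Real.exp_le_exp.2 ?_
    -- Since ℓ = log(1/ε) ≥ 1/2 and s ≥ 1, 9sℓ ≥ 8sℓ + sℓ ≥ 4s + ℓ.
    nlinarith
  -- A crude replacement for log(4s); it costs about √n in the iteration count, which n⁵ can absorb.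
  have h4 : 4 * s ≤ Real.exp (4 * s) := by
    have := Real.add_one_le_exp (4 * s)
    linarith
  calc (1 - γ) ^ T * (4 * s) ≤ Real.exp (-(4 * s)) * ε * Real.exp (4 * s) :=
        mul_le_mul (hpow.trans hexp) h4 (by linarith) (by positivity)
    _ = ε * (Real.exp (-(4 * s)) * Real.exp (4 * s)) := by ring
    _ = ε := by rw [← Real.exp_add]; simp

end Convergence


/-! ### The width, step-size and iteration-count inequalities -/

section Assembly

variable {n d m k : ℕ}

lemma half_le_log (hm : 2 ≤ m) : 1 / 2 ≤ Real.log m := by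
  have h1 : Real.log 2 ≤ Real.log m := Real.log_le_log (by norm_num) (by exact_mod_cast hm)
  have h2 := Real.log_two_gt_d9
  linarith

lemma le_mul_sq_of_width_key {lam : ℝ} (hn : 1 ≤ n) (hm : 2 ≤ m) (hlam : 0 < lam)
    (hlam1 : lam ≤ 1)
    (hkey : widthConst * (Real.log m * n ^ 9 * √n * k ^ 2) ≤ m * lam ^ 8) :
    4096 * (n ^ 5 * (k : ℝ) ^ 2) ≤ m * lam ^ 2 := by
  have hn1 : (1 : ℝ) ≤ n := by exact_mod_cast hn
  have hL := half_le_log hm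
  have hs : 1 ≤ √(n : ℝ) := Real.one_le_sqrt.2 hn1
  have h1 : (1 / 2) * n ^ 5 * 1 * (k : ℝ) ^ 2 ≤ Real.log m * n ^ 9 * √n * k ^ 2 := by
    have : (n : ℝ) ^ 5 ≤ n ^ 9 := pow_le_pow_right₀ hn1 (by norm_num)
    gcongr
  have h2 : lam ^ 8 ≤ lam ^ 2 := pow_le_pow_of_le_one hlam.le hlam1 (by norm_num)
  have h3 : (m : ℝ) * lam ^ 8 ≤ m * lam ^ 2 := by gcongr
  have h4 : 8192 * ((1 / 2) * n ^ 5 * 1 * (k : ℝ) ^ 2) ≤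
      widthConst * (Real.log m * n ^ 9 * √n * k ^ 2) := by
    have : (8192 : ℝ) ≤ widthConst := by unfold widthConst; norm_num
    have : 0 < Real.log m := by linarith
    gcongr
  linarith

/-- The kernel term is the one that needs n⁵k² ≤ mλ². The tail level 6 log m makes an entry of `V`
too large with probability at most 2/m³, which beats the km entries. -/
lemma failure_le {lam ρ : ℝ} (hn : 1 ≤ n) (hk : 1 ≤ k) (hm : 2 ≤ m) (hlam : 0 < lam)
    (hlam1 : lam ≤ 1) (hρ : ρ * √m = lam ^ 2 / (4096 * n ^ 2))
    (hkey : 4096 * (n ^ 5 * (k : ℝ) ^ 2) ≤ m * lam ^ 2) :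
    gaussFourth * k ^ 2 / m + n * (gaussFourth * k ^ 2 / (m * (ρ * √m))) +
      n ^ 4 * (gaussFourth * k ^ 2 / (m * lam ^ 2)) +
      2 * k * m * Real.exp (-(6 * Real.log m) / 2) + 4 * gaussFourth ^ 2 / n ≤
      (4 * gaussFourth ^ 2 + 3 * gaussFourth + 2) / n := by
  have hn1 : (1 : ℝ) ≤ n := by exact_mod_cast hn
  have hk1 : (1 : ℝ) ≤ k := by exact_mod_cast hk
  have hm0 : (0 : ℝ) < m := by exact_mod_cast (by omega : 0 < m)
  have hC := gaussFourth_nonneg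
  have hm2 : (m : ℝ) * lam ^ 2 ≤ m := mul_le_of_le_one_right hm0.le (pow_le_one₀ hlam.le hlam1)
  have hnk : n * (k : ℝ) ^ 2 ≤ n ^ 5 * (k : ℝ) ^ 2 := by
    have : (n : ℝ) ≤ n ^ 5 := le_self_pow₀ hn1 (by norm_num)
    gcongr
  have hnk0 : 0 < n * (k : ℝ) ^ 2 := by positivity
  have hmn : n * (k : ℝ) ^ 2 ≤ m := by linarith
  have t1 : gaussFourth * k ^ 2 / m ≤ gaussFourth / n := by
    rw [div_le_div_iff₀ hm0 (by linarith), mul_assoc]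
    exact mul_le_mul_of_nonneg_left (by linarith) hC
  have t2 : n * (gaussFourth * k ^ 2 / (m * (ρ * √m))) ≤ gaussFourth / n := by
    rw [hρ, ← mul_div_assoc, ← mul_div_assoc, div_div_eq_mul_div,
      div_le_div_iff₀ (by positivity) (by linarith)]
    have := mul_le_mul_of_nonneg_left hkey hC
    have h5 : (n : ℝ) ^ 4 ≤ n ^ 5 := pow_le_pow_right₀ hn1 (by norm_num)
    calc _ = gaussFourth * (4096 * (n ^ 4 * (k : ℝ) ^ 2)) := by ring
      _ ≤ gaussFourth * (4096 * (n ^ 5 * (k : ℝ) ^ 2)) := by gcongr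
      _ ≤ _ := this
  have t3 : n ^ 4 * (gaussFourth * k ^ 2 / (m * lam ^ 2)) ≤ gaussFourth / n := by
    rw [← mul_div_assoc, div_le_div_iff₀ (by positivity) (by linarith)]
    have h5 : n ^ 5 * (k : ℝ) ^ 2 ≤ m * lam ^ 2 := by
      have : 0 ≤ n ^ 5 * (k : ℝ) ^ 2 := by positivity
      linarith
    have := mul_le_mul_of_nonneg_left h5 hC
    calc _ = gaussFourth * (n ^ 5 * (k : ℝ) ^ 2) := by ring
      _ ≤ _ := this
  have t4 : 2 * k * m * Real.exp (-(6 * Real.log m) / 2) ≤ 2 / n := by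
    have e : Real.exp (-(6 * Real.log m) / 2) = 1 / (m : ℝ) ^ 3 := by
      rw [show -(6 * Real.log m) / 2 = -((3 : ℕ) * Real.log m) by push_cast; ring, Real.exp_neg,
        Real.exp_nat_mul, Real.exp_log hm0, one_div]
    rw [e, mul_one_div, div_le_div_iff₀ (by positivity) (by linarith)]
    have hkk : (k : ℝ) ≤ k ^ 2 := le_self_pow₀ hk1 (by norm_num)
    have h1 : (k : ℝ) * n ≤ m := by
      refine le_trans ?_ hmn
      rw [mul_comm]
      gcongr
    have hm1 : (1 : ℝ) ≤ m := by exact_mod_cast (by omega : 1 ≤ m)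
    have h2 : (m : ℝ) * m ≤ m ^ 3 := by
      rw [← sq]; exact pow_le_pow_right₀ hm1 (by norm_num)
    have h3 := mul_le_mul_of_nonneg_right h1 hm0.le
    linarith
  have e : (4 * gaussFourth ^ 2 + 3 * gaussFourth + 2) / (n : ℝ) =
      4 * gaussFourth ^ 2 / n + 3 * (gaussFourth / n) + 2 / n := by ring
  rw [e]
  linarith

/-- By the choice of ρ, the neurons initially near zero use exactly half of the allowance
λ²/(1024n²). The other half must cover those that move by ρ inside the ball of squared radius 4R2,
and clearing denominators in this requirement is how `widthConst` and λ⁸ arise. -/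
lemma flip_budget {lam ρ : ℝ} (hn : 1 ≤ n) (hk : 1 ≤ k) (hm : 2 ≤ m) (hlam : 0 < lam)
    (hρ0 : 0 < ρ) (hρ : ρ * √m = lam ^ 2 / (4096 * n ^ 2))
    (hkey : widthConst * (Real.log m * n ^ 9 * √n * k ^ 2) ≤ m * lam ^ 8) :
    2 * (ρ * √m) * ((m : ℝ) / k) + 6 * Real.log m *
      (4 * (512 * n ^ 3 * √n / ((m : ℝ) / k * lam ^ 2))) / ρ ^ 2 ≤
      lam ^ 2 / (1024 * n ^ 2) * ((m : ℝ) / k) := by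
  have hn1 : (1 : ℝ) ≤ n := by exact_mod_cast hn
  have hk1 : (1 : ℝ) ≤ k := by exact_mod_cast hk
  have hm0 : (0 : ℝ) < m := by exact_mod_cast (by omega : 0 < m)
  have hρ2 : ρ ^ 2 = (lam ^ 2 / (4096 * n ^ 2)) ^ 2 / m := by
    rw [← hρ, mul_pow, Real.sq_sqrt hm0.le]
    field_simp
  rw [hρ, hρ2]
  have e1 : lam ^ 2 / (1024 * n ^ 2) * ((m : ℝ) / k) = 2 * (lam ^ 2 / (4096 * n ^ 2)) * (m / k) +
      m * lam ^ 8 / (2048 * n ^ 2 * k * lam ^ 6) := by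
    field_simp
    ring
  have e2 : 6 * Real.log m * (4 * (512 * n ^ 3 * √n / ((m : ℝ) / k * lam ^ 2))) /
      ((lam ^ 2 / (4096 * n ^ 2)) ^ 2 / m) =
      widthConst * (Real.log m * n ^ 9 * √n * k ^ 2) / (2048 * n ^ 2 * k * lam ^ 6) := by
    unfold widthConst
    field_simp
    ring
  rw [e1, e2]
  gcongr

/-- With B ≤ n, r ≤ n and log m ≥ 1/2 it reduces to 3000·32·c ≤ ν/2. -/
lemma step_mul_le {B : ℕ} {c ν φ r : ℝ} (hn : 1 ≤ n) (hk : 1 ≤ k) (hm : 2 ≤ m) (hBn : B ≤ n)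
    (hc0 : 0 < c) (hc : c ≤ ν / 192000) (hν : 0 < ν) (hφ : 0 < φ) (hr : 1 ≤ r) (hrn : r ≤ √n) :
    c * (k * B * φ / ((n : ℝ) ^ 3 * m * Real.log m)) * ((m : ℝ) / k) ≤
      ν * φ / (3000 * r) / (32 * n) := by
  have hn1 : (1 : ℝ) ≤ n := by exact_mod_cast hn
  have hk1 : (1 : ℝ) ≤ k := by exact_mod_cast hk
  have hm0 : (0 : ℝ) < m := by exact_mod_cast (by omega : 0 < m)
  have hL := half_le_log hm
  have hL0 : 0 < Real.log m := by linarith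
  have hBn' : (B : ℝ) ≤ n := by exact_mod_cast hBn
  have hrn' : r ≤ n := hrn.trans (Real.sqrt_le_iff.2 ⟨by linarith, by nlinarith⟩)
  have e : c * (k * B * φ / ((n : ℝ) ^ 3 * m * Real.log m)) * ((m : ℝ) / k) =
      c * B * φ / (n ^ 3 * Real.log m) := by field_simp
  rw [e, div_div, div_le_div_iff₀ (by positivity) (by positivity)]
  calc c * B * φ * (3000 * r * (32 * n)) ≤ ν / 192000 * n * φ * (3000 * n * (32 * n)) := by gcongr
    _ = ν * φ * (n ^ 3 * (1 / 2)) := by ring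
    _ ≤ _ := by gcongr

/-- At the stated number of steps the exponent equals 9(n/r)ℓ, and r ≤ √n turns n/r into at least
√n. -/
lemma decay_exponent {B T : ℕ} {c ν φ r ℓ : ℝ} (hn : 1 ≤ n) (hk : 1 ≤ k) (hm : 2 ≤ m)
    (hB : 1 ≤ B) (hc0 : 0 < c) (hν : 0 < ν) (hφ : 0 < φ) (hr : 1 ≤ r) (hrn : r ≤ √n) (hℓ : 0 ≤ ℓ)
    (hT : 108000 / (c * ν) * ((n : ℝ) ^ 5 * Real.log m * ℓ / (B * φ ^ 2)) ≤ T) :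
    9 * √n * ℓ ≤ c * (k * B * φ / ((n : ℝ) ^ 3 * m * Real.log m)) * ((m : ℝ) / k) *
      (ν * φ / (3000 * r)) / (4 * n) * T := by
  have hn1 : (1 : ℝ) ≤ n := by exact_mod_cast hn
  have hk1 : (1 : ℝ) ≤ k := by exact_mod_cast hk
  have hB1 : (1 : ℝ) ≤ B := by exact_mod_cast hB
  have hm0 : (0 : ℝ) < m := by exact_mod_cast (by omega : 0 < m)
  have hL0 : 0 < Real.log m := by have := half_le_log hm; linarith
  have hs : √(n : ℝ) ≤ n / r := by
    rw [le_div_iff₀ (by linarith)]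
    calc √(n : ℝ) * r ≤ √n * √n := by gcongr
      _ = n := Real.mul_self_sqrt (by linarith)
  calc 9 * √n * ℓ ≤ 9 * (n / r) * ℓ := by gcongr
    _ = c * (k * B * φ / ((n : ℝ) ^ 3 * m * Real.log m)) * ((m : ℝ) / k) *
      (ν * φ / (3000 * r)) / (4 * n) *
        (108000 / (c * ν) * ((n : ℝ) ^ 5 * Real.log m * ℓ / (B * φ ^ 2))) := by
        field_simp
        ring
    _ ≤ _ := by gcongr

end Assembly

end TwoLayerReLU
end

/-! ### The main theorem -/

open TwoLayerReLU
theorem mainTheorem3 (Y μ : ℝ) (hμ : 0 < μ) :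
    ∃ c₀ > (0 : ℝ), ∃ Cwidth > (0 : ℝ), ∃ Cprob > (0 : ℝ),
    ∀ c : ℝ, 0 < c → c ≤ c₀ → ∃ Citer > (0 : ℝ),
    ∀ (n d m k B : ℕ) (hB : B ≤ n) (φ : ℝ)
      (x : Fin n → EuclideanSpace ℝ (Fin d)) (y : Fin n → EuclideanSpace ℝ (Fin k)),
      1 ≤ B → 1 ≤ k → 2 ≤ m → 0 < φ →
      (∀ i, ‖x i‖ = 1) →
      (∀ i j, i ≠ j → φ ≤ ‖x i - x j‖) →
      (∀ i j, i ≠ j → μ * φ ≤ ‖x i + x j‖) →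
      (∀ i, ‖y i‖ ≤ Y) →
      Cwidth * ((k : ℝ) ^ ((5 : ℝ) / 2) * (n : ℝ) ^ 11 * Real.log m ^ 3 / (φ ^ 8 * B)) ≤ m →
      ∃ G : Set ((Fin m → Fin d → ℝ) × (Fin k → Fin m → ℝ)), MeasurableSet G ∧
        1 - Cprob / n ≤ (initLaw d m k).real G ∧
        ∀ θ ∈ G, ∃ A : Set (ℕ → Finset (Fin n)), MeasurableSet A ∧
          1 - Cprob / n ≤ (minibatchSeqLaw n B hB).real A ∧
          ∀ ε : ℝ, 0 < ε → ε ≤ 1 / 2 → ∀ T : ℕ,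
            Citer * ((n : ℝ) ^ 5 * Real.log m * Real.log (1 / ε) / (B * φ ^ 2)) ≤ T →
            ∫ b, trainLoss x y (Matrix.of θ.2)
                (sgd x y B (c * (k * B * φ / ((n : ℝ) ^ 3 * m * Real.log m)))
                  (Matrix.of θ.2) (Matrix.of θ.1) b T)
              ∂((minibatchSeqLaw n B hB)[|A]) ≤ ε := by
  have hC := gaussFourth_nonneg
  set ν := min 1 μ with hνdef
  have hν : 0 < ν := lt_min one_pos hμ
  have hν1 : ν ≤ 1 := min_le_left _ _
  have hνμ : ν ≤ μ := min_le_right _ _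
  have hWC : 0 < widthConst := by unfold widthConst; norm_num
  -- The summand Y⁴ in the probability constant forces Y² ≤ √n whenever n exceeds it, so that the
  -- targets are absorbed in the initial loss bound 2n√n. The summand 2 forces n > 2.
  refine ⟨ν / 192000, by positivity, 8 * widthConst * 3000 ^ 8 / ν ^ 8, by positivity,
    4 * gaussFourth ^ 2 + 3 * gaussFourth + 2 + Y ^ 4, by positivity, fun c hc0 hc => ?_⟩
  set Cprob := 4 * gaussFourth ^ 2 + 3 * gaussFourth + 2 + Y ^ 4 with hCprob
  have hY4 : 0 ≤ Y ^ 4 := by positivity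
  refine ⟨108000 / (c * ν), by positivity, ?_⟩
  intro n d m k B hBn φ x y hB hk hm hφ hx hsep hsep' hy hw
  have hn : 1 ≤ n := hB.trans hBn
  have hn1 : (1 : ℝ) ≤ n := by exact_mod_cast hn
  have hn0 : (0 : ℝ) < n := by linarith
  -- For small `n` the claimed probability is at most 0 and the empty event suffices.
  rcases le_or_gt (n : ℝ) Cprob with hsmall | hlarge
  · refine ⟨∅, MeasurableSet.empty, ?_, fun θ hθ => absurd hθ (Set.notMem_empty θ)⟩
    rw [measureReal_empty, sub_nonpos, le_div_iff₀ hn0]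
    linarith
  have hC2 : 0 ≤ 4 * gaussFourth ^ 2 := by positivity
  have hn2' : (2 : ℝ) < n := by linarith
  have hn2 : 2 ≤ n := by exact_mod_cast hn2'.le
  have hYn : Y ^ 2 ≤ √n := by
    refine Real.le_sqrt_of_sq_le ?_
    calc (Y ^ 2) ^ 2 = Y ^ 4 := by ring
      _ ≤ (n : ℝ) := by linarith
  -- Two distinct unit vectors are at distance at most 2; a second example exists because n > 2.
  have hφ2 : φ ≤ 2 := by
    have h := hsep ⟨0, by omega⟩ ⟨1, by omega⟩ (by simp)
    refine h.trans ((norm_sub_le _ _).trans ?_)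
    rw [hx, hx]; norm_num
  set δ := ν ^ 2 * φ ^ 2 / 4 with hδdef
  have hδ : 0 < δ := by positivity
  have hδ1 : δ ≤ 1 := by
    have h1 : ν ^ 2 ≤ 1 := pow_le_one₀ hν.le hν1
    have h2 : φ ^ 2 ≤ 4 := by nlinarith
    have := mul_le_mul h1 h2 (by positivity) zero_le_one
    rw [hδdef]; linarith
  obtain ⟨N, hN, hNn, hNle⟩ := exists_pow_le hn2 hδ hδ1
  set r : ℝ := (2 * (n : ℝ)) ^ ((1 : ℝ) / 16) with hrdef
  have hr : 1 ≤ r := Real.one_le_rpow (by linarith) (by norm_num)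
  have hr16 : r ^ 16 = 2 * n := by
    rw [hrdef, ← Real.rpow_natCast, ← Real.rpow_mul (by positivity)]
    norm_num
  have hrn : r ≤ √n := by
    refine le_of_pow_le_pow_left₀ (n := 16) (by norm_num) (Real.sqrt_nonneg _) ?_
    rw [hr16, show √(n : ℝ) ^ 16 = (√(n : ℝ) ^ 2) ^ 8 by ring, Real.sq_sqrt hn0.le]
    calc 2 * (n : ℝ) ≤ n * n := by nlinarith
      _ = n ^ 2 := by ring
      _ ≤ n ^ 8 := pow_le_pow_right₀ hn1 (by norm_num)
  have hlamN := le_inv_sqrt_of_le hN hr hr16 hν hφ hNle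
  have hkey := width_key hB hBn hk hm hr hr16 hν hφ hw
  have hηa := step_mul_le hn hk hm hBn hc0 hc hν hφ hr hrn
  have hexpo := fun (T : ℕ) (ℓ : ℝ) =>
    decay_exponent (T := T) (ℓ := ℓ) hn hk hm hB hc0 hν hφ hr hrn
  have hlam : 0 < ν * φ / (3000 * r) := by positivity
  have hlam1 : ν * φ / (3000 * r) ≤ 1 := by
    rw [div_le_one (by positivity)]
    nlinarith
  have hm0 : (0 : ℝ) < m := by exact_mod_cast (by omega : 0 < m)
  have hk0 : (0 : ℝ) < k := by exact_mod_cast hk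
  have hB0 : (0 : ℝ) < B := by exact_mod_cast hB
  have hL0 : 0 < Real.log m := by have := half_le_log hm; linarith
  have hη : 0 < c * (k * B * φ / ((n : ℝ) ^ 3 * m * Real.log m)) := by positivity
  generalize c * (k * B * φ / ((n : ℝ) ^ 3 * m * Real.log m)) = η at hηa hexpo hη ⊢
  generalize ν * φ / (3000 * r) = lam at hlamN hkey hηa hexpo hlam hlam1
  have hsm : 0 < √(m : ℝ) := Real.sqrt_pos.2 hm0
  -- A preactivation has standard deviation √(2/m), so ρ√m bounds the probability that it is within
  -- ρ of zero; the value makes 2ρ√m half of λ²/(1024n²).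
  obtain ⟨ρ, hρ0, hρ⟩ : ∃ ρ : ℝ, 0 < ρ ∧ ρ * √m = lam ^ 2 / (4096 * n ^ 2) :=
    ⟨lam ^ 2 / (4096 * n ^ 2) / √m, by positivity, div_mul_cancel₀ _ hsm.ne'⟩
  obtain ⟨G, hGm, hGP, hG⟩ := exists_goodInit_event (m := m) (k := k) hn hk (by omega) x hx hδ hδ1
    (fun i j hij => abs_inner_le_of_separated (hx i) (hx j) hφ hν hν1 hνμ (hsep i j hij)
      (hsep' i j hij)) hN hNn hρ0 (M := 6 * Real.log m) (by positivity) hlam hlamN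
  have hfail := failure_le hn hk hm hlam hlam1 hρ (le_mul_sq_of_width_key hn hm hlam hlam1 hkey)
  refine ⟨G, hGm, le_trans (sub_le_sub_left (hfail.trans ?_) 1) hGP, fun θ hθ => ?_⟩
  · exact div_le_div_of_nonneg_right (by linarith) hn0.le
  obtain ⟨hgood, hout⟩ := hG θ hθ
  have h0 : totalLoss x y (Matrix.of θ.2) (Matrix.of θ.1) ≤ 2 * n * √n := by
    refine (totalLoss_le_outputSq x y hy θ).trans ?_
    have := mul_le_mul_of_nonneg_left hYn hn0.le
    linarith
  obtain ⟨A, hAm, hAP, hA⟩ := hgood.exists_event hx (by positivity) hρ0 hlam hlam1 (by positivity)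
    hB hBn hη hηa (flip_budget hn hk hm hlam hρ0 hρ hkey) h0
  refine ⟨A, hAm, le_trans (sub_le_sub_left ?_ 1) hAP, fun ε hε hε2 T hT => ?_⟩
  · exact div_le_div_of_nonneg_right (by linarith) hn0.le
  have hγ1 : η * (m / k) * lam / (4 * n) ≤ 1 := by
    rw [div_le_one (by positivity)]
    have h1 : η * (m / k) ≤ 1 := hηa.trans (by rw [div_le_one (by positivity)]; linarith)
    have := mul_le_mul h1 hlam1 hlam.le zero_le_one
    linarith
  have hdec := decay_le (Real.one_le_sqrt.2 hn1) hγ1 hε hε2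
    (hexpo T (Real.log (1 / ε)) (Real.log_nonneg (by rw [le_div_iff₀ hε]; linarith)) hT)
  have hhalf : 1 / 2 ≤ (minibatchSeqLaw n B hBn).real A := by
    refine le_trans ?_ hAP
    have : 1 / (n : ℝ) ≤ 1 / 2 := one_div_le_one_div_of_le (by norm_num) hn2'.le
    linarith
  have hpow : 0 ≤ (1 - η * (m / k) * lam / (4 * n)) ^ T := pow_nonneg (by linarith) T
  have hint0 : 0 ≤ ∫ b in A, totalLoss x y (Matrix.of θ.2)
      (sgd x y B η (Matrix.of θ.2) (Matrix.of θ.1) b T) ∂(minibatchSeqLaw n B hBn) :=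
    integral_nonneg fun b => totalLoss_nonneg _
  have htrain : ∀ W, trainLoss x y (Matrix.of θ.2) W = totalLoss x y (Matrix.of θ.2) W / n :=
    fun W => rfl
  simp_rw [htrain]
  rw [ProbabilityTheory.cond, integral_smul_measure, integral_div, ENNReal.toReal_inv,
    smul_eq_mul, ← measureReal_def]
  have hinv : ((minibatchSeqLaw n B hBn).real A)⁻¹ ≤ 2 := by
    rw [inv_le_comm₀ (by linarith) (by norm_num)]
    linarith
  -- Conditioning on the event divides by its probability, at least 1/2, and passing to the mean
  -- loss divides by n; this turns 2n√n into 4√n.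
  calc _ ≤ 2 * (((1 - η * (m / k) * lam / (4 * n)) ^ T * (2 * n * √n)) / n) := by
        refine mul_le_mul hinv (div_le_div_of_nonneg_right
          ((hA T).trans (mul_le_mul_of_nonneg_left h0 hpow)) hn0.le) (by positivity) (by norm_num)
    _ = (1 - η * (m / k) * lam / (4 * n)) ^ T * (4 * √n) := by
        generalize (1 - η * (m / k) * lam / (4 * n)) ^ T = q
        field_simp
        ring
    _ ≤ ε := hdec
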